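/- **Model.** A dynamic network has $n\ge 2$ nodes with distinct identifiers from $\{1,\dots,U\}$, where $U\le n^{A}$ for a constant $A$ (identifiers of $O(\log n)$ bits). All nodes know $U$, the parameters $b$ and $T$, and an estimate $N$ with $n/2\le N\le 2n$. Time proceeds in synchronous rounds $t=0,1,2,\dots$. In each round an adaptive adversary first chooses a connected graph on the nodes, depending on everything that happened (including all random choices) in the previous rounds. Then each node, using fresh independent randomness and not knowing its neighbours, chooses a message, and receives the messages of its neighbours. The network is $T$-stable ($T\ge 1$) if the graph changes only every $T$ rounds, i.e. it is constant on each block of rounds $mT,\dots,(m+1)T-1$. Let $b$ be an integer with $b\ge\log n$. In the $k$-indexed-broadcast problem there are $k$ tokens with indices $1,\dots,k$; each token is initially held (with its index) by at least one node, the tokens and their distribution being arbitrary; every node has to output all tokens with their indices. **Algorithm.** The patch-sharing network coding algorithm treats the $k=bT$ tokens $t_i$ of $bT$ bits as vectors over $\mathbb F_2$. A node that initially holds $t_i$ has initially received the vector $(e_i,t_i)\in\mathbb F_2^{2bT}$. Put $\ell=\lfloor\log_2 N\rfloor+2$ and $D=\lfloor T/(2(2\kappa\ell+5))\rfloor$ with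 a constant $\kappa$. Each block of $T$ rounds is a meta round that consists of the following steps. 1. *Patches.* Compute an independent set (the leaders) in the $D$-th power of the graph by $\kappa\ell$ iterations of Luby's algorithm. In each iteration every active node draws a random priority of $4\ell$ bits (ties are broken by identifier), the highest priorities are flooded for $D$ rounds, each active node that heard no higher priority than its own becomes a leader, and a deactivation message is flooded from the new leaders for $D$ rounds. Then in $D$ rounds grow breadth-first trees from all leaders simultaneously, each node choosing as parent the sender of lowest identifier among those from which it first hears. The trees are the patches; a node reached by no tree is in no patch in this meta round. If $D=0$, every node is a leader and a patch by itself. 2. *Share.* Every node of a patch forms a uniformly random linear combination of the vectors it has received. These are summed up the tree to the leader, and the sum is sent down the tree to all nodes of the patch, which add it to their received vectors; both transmissions are pipelined, with vectors cut into $S$ pieces of $O(b)$ bits ($S=\lfloor T/10\rfloor$ if $D\ge1$, $S=T$ if $D=0$). If $D=0$ this step is local and takes no rounds. 3. *Pass.* Every node of a patch broadcasts the sum of its patch to its neighbours in $S$ pieces, and the neighbours add it to their received vectors. 4. *Share.* Step 2 is repeated with the new received vectors (if $D=0$, this is vacuous and omitted). A node outputs as token $i$ the vector $y$ such that $(e_i,y)$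 lies in the span of its received vectors, if there is such a $y$. **Statement.** There is a constant $\kappa$ such that for every $A$ there is a constant $B$ such that for every $c$ there is a constant $C$ with the following property. For all $n\ge2$, $N$, $b\ge\log n$, $T\ge1$ and $U$ as above, the messages of the patch-sharing network coding algorithm have at most $Bb$ bits, and for every $T$-stable adaptive adversary, every assignment of identifiers, all $bT$ tokens of $bT$ bits and every initial distribution of them, and every number of rounds $R\ge C\,(n+bT^2)\log n$, with probability at least $1-n^{-c}$ all nodes output all $bT$ tokens with the correct indices after $R$ rounds. That is, with high probability the algorithm solves $bT$-indexed-broadcast with tokens of size $bT$ in a $T$-stable dynamic network in $O((n+bT^2)\log n)$ rounds with messages of $O(b)$ bits. -/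

import Mathlib

/-! ### Randomized protocols in the dynamic network model -/

/-- A randomized distributed protocol for anonymous broadcast. Every node runs the same code. It
starts from its own identifier and its own input. In round `t` (counted from `0`) it draws a fresh
uniform seed, chooses a message from its state and the seed (without knowing its neighbours), and
then updates its state on receiving the multiset of the messages of its neighbours. Local
computation is unrestricted. -/
structure Protocol (Uid Inp Out : Type) where
  Msg : Type
  State : Type
  Seed : Type
  seedFintype : Fintype Seed
  seedNonempty : Nonempty Seed
  init : Uid → Inp → State
  send : ℕ → State → Seed → Msg
  recv : ℕ → State → Seed → Multiset Msg → State
  out : State → Out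

namespace Protocol

variable {Uid Inp Out : Type}

/-- Messages can be encoded by bit strings of length `m`. -/
def MessageBits (P : Protocol Uid Inp Out) (m : ℕ) : Prop :=
  Finite P.Msg ∧ Nat.card P.Msg ≤ 2 ^ m

/-- The random choices of all nodes in the past rounds, the latest round first. -/
abbrev History (P : Protocol Uid Inp Out) (n : ℕ) : Type := List (Fin n → P.Seed)

/-- An adaptive adversary picks the graph of the current round from all random choices of the past
rounds (which, with the inputs, determine all past messages and all current states), before the
nodes draw the seeds of the current round. -/
abbrev Adversary (P : Protocol Uid Inp Out) (n : ℕ) : Type := P.History n → SimpleGraph (Fin n)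

/-- In every round the graph is connected. -/
def Adversary.AlwaysConnected {P : Protocol Uid Inp Out} {n : ℕ} (adv : P.Adversary n) : Prop :=
  ∀ h, (adv h).Connected

/-- The graph changes only every `T` rounds: the graph of round `t + 1` can differ from the graph of
round `t` only if `T` divides `t + 1`. -/
def Adversary.Stable {P : Protocol Uid Inp Out} {n : ℕ} (adv : P.Adversary n) (T : ℕ) : Prop :=
  ∀ (h : P.History n) (s : Fin n → P.Seed), ¬ T ∣ h.length + 1 → adv (s :: h) = adv h

open Classical in
/-- The states of all nodes after the rounds recorded in a history. -/
noncomputable def run (P : Protocol Uid Inp Out) {n : ℕ} (uid : Fin n → Uid) (inp : Fin n → Inp)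
    (adv : P.Adversary n) : P.History n → Fin n → P.State
  | [] => fun v => P.init (uid v) (inp v)
  | s :: h => fun v =>
      P.recv h.length (P.run uid inp adv h v) (s v)
        ((Finset.univ.filter fun u => (adv h).Adj v u).val.map
          fun u => P.send h.length (P.run uid inp adv h u) (s u))

open Classical in
/-- The law of the random choices of `R` rounds: the seeds of distinct rounds and of distinct nodes
are independent and uniform. -/
noncomputable def historyLaw (P : Protocol Uid Inp Out) (n : ℕ) : ℕ → PMF (P.History n)
  | 0 => PMF.pure []
  | R + 1 =>
      haveI := P.seedFintype
      haveI := P.seedNonempty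
      (P.historyLaw n R).bind fun h =>
        (PMF.uniformOfFintype (Fin n → P.Seed)).map fun s => s :: h

/-- The probability that after `R` rounds the outputs of the nodes satisfy `E`. -/
noncomputable def outputProb (P : Protocol Uid Inp Out) {n : ℕ} (uid : Fin n → Uid)
    (inp : Fin n → Inp) (adv : P.Adversary n) (R : ℕ) (E : (Fin n → Out) → Prop) : ℝ :=
  ((P.historyLaw n R).toOuterMeasure {h | E fun v => P.out (P.run uid inp adv h v)}).toReal

end Protocol

/-! ### Indexed broadcast -/

/-- Tokens of `d` bits. -/
abbrev Token (d : ℕ) : Type := Fin d → ZMod 2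

/-- A node knows the tokens of an index set. -/
abbrev TokenTable (k d : ℕ) : Type := Fin k → Option (Token d)

/-- The input of a node that initially holds the tokens with indices in `H`. -/
def initialTable {k d : ℕ} (tok : Fin k → Token d) (H : Finset (Fin k)) : TokenTable k d :=
  fun i => if i ∈ H then some (tok i) else none

/-- For every assignment of identifiers, all tokens `t_1, …, t_k` of `d` bits, every initial
distribution of the tokens in which each token is held by some node, and every adaptive adversary
that keeps the network connected and `T`-stable, after `R` rounds all nodes output all tokens (with
the right indices) with probability at least `p`. -/
def SolvesIndexedBroadcast {U k d : ℕ} (P : Protocol (Fin U) (TokenTable k d) (TokenTable k d))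
    (n T R : ℕ) (p : ℝ) : Prop :=
  ∀ (uid : Fin n → Fin U), Function.Injective uid →
  ∀ (tok : Fin k → Token d) (H : Fin n → Finset (Fin k)), (∀ i, ∃ v, i ∈ H v) →
  ∀ adv : P.Adversary n, adv.AlwaysConnected → adv.Stable T →
    p ≤ P.outputProb uid (fun v => initialTable tok (H v)) adv R
      (fun o => ∀ v i, o v i = some (tok i))

/-! ### The patch-sharing network coding algorithm -/

namespace PatchSharing

/-- What the nodes know in advance: a constant `κ` that tunes the number of iterations of the
independent set computation, an estimate `N` of the number of nodes, the message size parameter `b`,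
the stability `T`, and the size `U` of the space of identifiers. -/
structure Params where
  κ : ℕ
  N : ℕ
  b : ℕ
  T : ℕ
  U : ℕ

namespace Params

variable (p : Params)

/-- Number of tokens, and number of bits of a token. -/
def k : ℕ := p.b * p.T

/-- About `log n`. -/
def ell : ℕ := Nat.log 2 p.N + 2

/-- Number of iterations of the maximal independent set computation. -/
def iters : ℕ := p.κ * p.ell

/-- The patch radius `D = Θ(T / log n)`. If it is `0`, the patches are the single nodes. -/
def D : ℕ := p.T / (2 * (2 * p.iters + 5))

/-- Number of pieces into which a vector is cut for transmission. -/
def S : ℕ := if p.D = 0 then p.T else p.T / 10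

/-- Length of a piece. -/
def w : ℕ := 2 * p.k / p.S + 1

/-- Number of rounds of a pipelined transmission up or down the trees of the patches; nothing has to
be sent if the patches are single nodes. -/
def E : ℕ := if p.D = 0 then 0 else p.S + p.D

/-- Size of the range of the random priorities. -/
def prioRange : ℕ := 2 ^ (4 * p.ell)

/-! A meta round consists of `T` rounds. The following are the first rounds of its phases. -/

def treeStart : ℕ := 2 * p.D * p.iters
def up₁ : ℕ := p.treeStart + p.D
def down₁ : ℕ := p.up₁ + p.E
def passStart : ℕ := p.down₁ + p.E
def up₂ : ℕ := p.passStart + p.S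
def down₂ : ℕ := p.up₂ + p.E
def idleStart : ℕ := p.down₂ + p.E

end Params

/-- Coded vectors over `𝔽₂`: a coefficient vector followed by a payload. -/
abbrev Vec (p : Params) : Type := Fin (p.k + p.k) → ZMod 2

/-- Pieces of coded vectors. -/
abbrev Piece (p : Params) : Type := Fin p.w → ZMod 2

/-- Priorities, with ties broken by the identifier; `⊥` stands for no priority. -/
abbrev Prio (p : Params) : Type := WithBot (Fin p.prioRange ×ₗ Fin p.U)

/-- The vector of a token: the basis vector of its index, followed by the token. -/
def codeword {p : Params} (i : Fin p.k) (y : Token p.k) : Vec p := Fin.append (Pi.single i 1) y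

/-- The `i`-th piece of a vector, padded with zeros. -/
def piece {p : Params} (i : ℕ) (x : Vec p) : Piece p :=
  fun j => if h : i * p.w + j < p.k + p.k then x ⟨i * p.w + j, h⟩ else 0

/-- The vector with given `i`-th piece and zeros elsewhere. -/
def unpiece {p : Params} (i : ℕ) (c : Piece p) : Vec p :=
  fun j => if (j : ℕ) / p.w = i then c ⟨(j : ℕ) % p.w, Nat.mod_lt _ (Nat.succ_pos _)⟩ else 0

inductive Msg (p : Params) : Type
  | silent
  /-- the highest priority heard -/
  | prio (x : Prio p)
  /-- there is a new leader nearby -/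
  | deactivate
  /-- the sender has just joined the tree of its patch -/
  | tree (sender : Fin p.U)
  /-- a piece, with the identifier of its addressee (up a tree) or of its sender (otherwise) -/
  | vec (u : Fin p.U) (c : Piece p)

/-- The priority that a message carries. -/
def Msg.getPrio {p : Params} : Msg p → Prio p
  | .prio x => x
  | _ => ⊥

/-- The sender of a tree message. -/
def Msg.getTree {p : Params} : Msg p → Option (Fin p.U)
  | .tree u => some u
  | _ => none

/-- The identifier in a message that carries a piece. -/
def Msg.getId {p : Params} : Msg p → Option (Fin p.U)
  | .vec u _ => some u
  | _ => none

/-- The vector whose `i`-th piece is carried by the message with label `u`, else zero. -/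
def Msg.getVec {p : Params} (i : ℕ) (u : Fin p.U) : Msg p → Vec p
  | .vec u' c => if u' = u then unpiece i c else 0
  | _ => 0

structure State (p : Params) : Type where
  uid : Fin p.U
  /-- all vectors received so far -/
  known : Finset (Vec p)
  /-- still takes part in the independent set computation of this meta round -/
  active : Bool
  /-- is in the independent set -/
  leader : Bool
  /-- own priority in the current iteration -/
  mine : Prio p
  /-- highest priority heard in the current iteration -/
  best : Prio p
  /-- knows of a new leader nearby in the current iteration -/
  flag : Bool
  /-- depth in the tree of the patch, if the node is in a patch -/
  depth : Option ℕ
  /-- parent in the tree of the patch -/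
  parent : Option (Fin p.U)
  /-- cumulative sum of the random sums of the descendants -/
  acc : Vec p
  /-- the random sum of the patch -/
  sum : Vec p
  /-- vectors assembled from the pieces passed by neighbours, by identifier of the neighbour -/
  inbox : Fin p.U → Vec p
  /-- the neighbours that passed something -/
  heard : Finset (Fin p.U)

/-- Per round, a random priority and a random coefficient for each vector. -/
abbrev Seed (p : Params) : Type := Fin p.prioRange × (Vec p → ZMod 2)

/-- The linear combination of the known vectors with the given coefficients. -/
def combination {p : Params} (K : Finset (Vec p)) (r : Vec p → ZMod 2) : Vec p := ∑ x ∈ K, r x • x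

/-- At the beginning each node has received the vectors of its tokens. -/
def init (p : Params) (u : Fin p.U) (inp : TokenTable p.k p.k) : State p where
  uid := u
  known := Finset.univ.biUnion fun i => ((inp i).map (codeword i)).toFinset
  active := false
  leader := false
  mine := ⊥
  best := ⊥
  flag := false
  depth := none
  parent := none
  acc := 0
  sum := 0
  inbox := 0
  heard := ∅

/-! Local computations at the beginning of a phase. -/

/-- New meta round. In the graph power `G⁰` all nodes are in the maximal independent set. -/
def State.reset {p : Params} (st : State p) : State p :=
  { st with
    active := true
    leader := decide (p.D = 0)
    inbox := 0
    heard := ∅ }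

/-- New iteration of the independent set computation: active nodes draw a priority. -/
def State.draw {p : Params} (st : State p) (r : Fin p.prioRange) : State p :=
  let x : Prio p := if st.active then ((toLex (r, st.uid) : Fin p.prioRange ×ₗ Fin p.U) : Prio p) else ⊥
  { st with mine := x, best := x, flag := false }

/-- An active node that heard no higher priority joins the independent set. -/
def State.decideLeader {p : Params} (st : State p) : State p :=
  if st.active = true ∧ st.best = st.mine then
    { st with leader := true, active := false, flag := true }
  else st

/-- The leaders become the roots of the trees. -/
def State.plant {p : Params} (st : State p) : State p :=
  { st with depth := if st.leader then some 0 else none, parent := none }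

/-- A share step begins with a random sum of the own vectors. -/
def State.startUp {p : Params} (st : State p) (r : Vec p → ZMod 2) : State p :=
  { st with acc := combination st.known r }

/-- The root has the sum for the whole patch, which is then distributed. -/
def State.startDown {p : Params} (st : State p) : State p :=
  { st with sum := if st.leader then st.acc else 0 }

/-- The local computations at the beginning of round `s` of a meta round. -/
def prepare (p : Params) (s : ℕ) (r : Seed p) (st : State p) : State p :=
  let st := if s = 0 then st.reset else st
  let st := if s < p.treeStart ∧ s % (2 * p.D) = 0 then st.draw r.1 else st
  let st := if s < p.treeStart ∧ s % (2 * p.D) = p.D then st.decideLeader else st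
  let st := if s = p.treeStart then st.plant else st
  let st := if s = p.up₁ ∨ s = p.up₂ then st.startUp r.2 else st
  if s = p.down₁ ∨ s = p.down₂ then st.startDown else st

/-- What is done in a round; the argument is the number of the round in its phase. -/
inductive Phase : Type
  | prio
  | deactivate
  | tree (j : ℕ)
  | up (j : ℕ)
  | down (j : ℕ)
  | pass (j : ℕ)
  | idle

/-- The schedule of a meta round: in each iteration of the independent set computation `D` rounds for
the priorities and `D` rounds for the deactivation; `D` rounds to build the trees; share (up and
down); pass; share (up and down). -/
def phase (p : Params) (s : ℕ) : Phase :=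
  if s < p.treeStart then if s % (2 * p.D) < p.D then .prio else .deactivate
  else if s < p.up₁ then .tree (s - p.treeStart)
  else if s < p.down₁ then .up (s - p.up₁)
  else if s < p.passStart then .down (s - p.down₁)
  else if s < p.up₂ then .pass (s - p.passStart)
  else if s < p.down₂ then .up (s - p.up₂)
  else if s < p.idleStart then .down (s - p.down₂)
  else .idle

/-- The message of a (prepared) node. Up the tree, a node of depth `δ` sends its `i`-th piece in
round `i + (D - δ)` of the phase; down the tree, in round `i + δ`. -/
def message {p : Params} (st : State p) : Phase → Msg p
  | .prio => .prio st.best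
  | .deactivate => if st.flag then .deactivate else .silent
  | .tree j => if st.depth = some j then .tree st.uid else .silent
  | .up j =>
      match st.depth, st.parent with
      | some δ, some u =>
          if p.D ≤ j + δ ∧ j + δ - p.D < p.S then .vec u (piece (j + δ - p.D) st.acc) else .silent
      | _, _ => .silent
  | .down j =>
      match st.depth with
      | some δ => if δ ≤ j ∧ j - δ < p.S then .vec st.uid (piece (j - δ) st.sum) else .silent
      | none => .silent
  | .pass j => if st.depth.isSome then .vec st.uid (piece j st.sum) else .silent
  | .idle => .silent

open Classical in
/-- The update of a (prepared) node on receiving messages. -/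
noncomputable def update {p : Params} (st : State p) (ms : Multiset (Msg p)) : Phase → State p
  | .prio => { st with best := st.best ⊔ (ms.map Msg.getPrio).sup }
  | .deactivate =>
      if Msg.deactivate ∈ ms then { st with flag := true, active := false } else st
  | .tree j =>
      -- the first tree messages received fix the depth; the parent is the sender of lowest ID
      let senders : Finset (Fin p.U) := (ms.filterMap Msg.getTree).toFinset
      if h : st.depth = none ∧ senders.Nonempty then
        { st with depth := some (j + 1), parent := some (senders.min' h.2) }
      else st
  | .up j =>
      -- the children, of depth `δ + 1`, have sent their pieces with number `j + (δ + 1) - D`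
      match st.depth with
      | some δ =>
          { st with acc := st.acc + (ms.map (Msg.getVec (j + (δ + 1) - p.D) st.uid)).sum }
      | none => st
  | .down j =>
      -- the parent, of depth `δ - 1`, has sent its piece with number `j - (δ - 1)`
      let x : Vec p :=
        match st.depth, st.parent with
        | some δ, some u => st.sum + (ms.map (Msg.getVec (j + 1 - δ) u)).sum
        | _, _ => st.sum
      { st with
        sum := x
        known := if j + 1 = p.E ∧ st.depth.isSome then insert x st.known else st.known }
  | .pass j =>
      let inb : Fin p.U → Vec p := fun u => st.inbox u + (ms.map (Msg.getVec j u)).sum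
      let hd : Finset (Fin p.U) := st.heard ∪ (ms.filterMap Msg.getId).toFinset
      { st with
        inbox := inb
        heard := hd
        known := if j + 1 = p.S then st.known ∪ hd.image inb else st.known }
  | .idle => st

open Classical in
/-- Decoding by linear algebra: token `i` is read off a vector in the span of the received vectors
whose coefficient vector is the `i`-th basis vector. -/
noncomputable def decode {p : Params} (st : State p) : TokenTable p.k p.k := fun i =>
  if h : ∃ y : Token p.k, codeword i y ∈ Submodule.span (ZMod 2) (st.known : Set (Vec p)) then
    some h.choose
  else none

end PatchSharing

/-- The patch-sharing network coding algorithm. Every block of `T` rounds is a meta round, in which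
the nodes compute patches, then share, pass, and share again. -/
noncomputable def patchSharing (p : PatchSharing.Params) :
    Protocol (Fin p.U) (TokenTable p.k p.k) (TokenTable p.k p.k) where
  Msg := PatchSharing.Msg p
  State := PatchSharing.State p
  Seed := PatchSharing.Seed p
  seedFintype := inferInstance
  seedNonempty := ⟨(⟨0, Nat.pow_pos Nat.two_pos⟩, 0)⟩
  init := PatchSharing.init p
  send t st r :=
    PatchSharing.message (PatchSharing.prepare p (t % p.T) r st) (PatchSharing.phase p (t % p.T))
  recv t st r ms :=
    PatchSharing.update (PatchSharing.prepare p (t % p.T) r st) ms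
      (PatchSharing.phase p (t % p.T))
  out := PatchSharing.decode

/-!
A node senses a linear functional `φ` when it has received a vector outside `ker φ`; by duality it
can decode once it senses every nonzero functional of the coefficient vectors. Fix `φ` and let `x`
be the number of nodes that do not sense it. With probability at least one half, Luby's algorithm
ends with a maximal independent set of the `D`-th power of the graph, and then the patches cover
all nodes and have at least `d = D / 2 + 1` nodes each. The random sum of a patch with a sensing
node leaves `ker φ` with probability one half, and then all of the patch senses `φ`. So if every
patch has a sensing node, the first share step halves the expected value of `x`. Otherwise, by
connectivity, a patch without sensing nodes has a neighbour in a patch with one; with constant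
probability `φ` is passed over that edge and then shared, and `x` decreases by at least `d`. Either
way the potential `x * 2 ^ (x / d)` shrinks in expectation by a constant factor in each meta round.
It is at most `n * 2 ^ (n / d)` initially, so `O(bT + n / d + log n)` meta rounds suffice for a
union bound over the `2 ^ (bT)` functionals.
-/

open scoped BigOperators

/-! ### Expectations over uniform random choices -/

theorem tsum_pmf_bind_mul {α β : Type*} (q : PMF α) (g : α → PMF β) (F : β → ENNReal) :
    ∑' b, q.bind g b * F b = ∑' a, q a * ∑' b, g a b * F b := by
  simp_rw [PMF.bind_apply, ← ENNReal.tsum_mul_right, ← ENNReal.tsum_mul_left]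
  rw [ENNReal.tsum_comm]
  simp_rw [mul_assoc]

theorem tsum_pmf_pure_mul {α : Type*} (a : α) (F : α → ENNReal) :
    ∑' b, PMF.pure a b * F b = F a := by
  rw [tsum_eq_single a fun b hb => by simp [PMF.pure_apply, hb]]
  simp

theorem tsum_pmf_map_uniform_mul {α β : Type*} [Fintype α] [Nonempty α] (f : α → β) {F : β → ℝ}
    (hF : ∀ b, 0 ≤ F b) :
    ∑' b, (PMF.uniformOfFintype α).map f b * ENNReal.ofReal (F b)
      = ENNReal.ofReal (𝔼 a, F (f a)) := by
  have card_pos : (0 : ℝ) < Fintype.card α := by exact_mod_cast Fintype.card_pos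
  rw [PMF.map, tsum_pmf_bind_mul]
  simp only [Function.comp_apply, tsum_pmf_pure_mul, PMF.uniformOfFintype_apply]
  rw [tsum_fintype, ← Finset.mul_sum, ← ENNReal.ofReal_sum_of_nonneg fun a _ => hF _,
    Fintype.expect_eq_sum_div_card, div_eq_inv_mul, ENNReal.ofReal_mul (by positivity),
    ENNReal.ofReal_inv_of_pos card_pos, ENNReal.ofReal_natCast]

theorem expect_ite_add_expect_ite_not {Ω : Type*} [Fintype Ω] [Nonempty Ω] (p : Ω → Prop)
    [DecidablePred p] :
    𝔼 r, (if p r then (1 : ℝ) else 0) + 𝔼 r, (if ¬ p r then (1 : ℝ) else 0) = 1 := by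
  rw [← Finset.expect_add_distrib, ← Fintype.expect_const (ι := Ω) (1 : ℝ)]
  exact Finset.expect_congr rfl fun r _ => by by_cases h : p r <;> simp [h]

theorem expect_ite_eq_half_of_perm {Ω : Type*} [Fintype Ω] [Nonempty Ω] (p : Ω → Prop)
    [DecidablePred p] (e : Equiv.Perm Ω) (he : ∀ r, p (e r) ↔ ¬ p r) :
    𝔼 r, (if p r then (1 : ℝ) else 0) = 1 / 2 := by
  have not_eq : 𝔼 r, (if ¬ p r then (1 : ℝ) else 0) = 𝔼 r, (if p r then (1 : ℝ) else 0) := by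
    simp_rw [← he]
    exact Fintype.expect_equiv e _ _ fun r => rfl
  linarith [expect_ite_add_expect_ite_not p]

/-! ### Expectations along the rounds of a protocol -/

namespace Protocol

variable {Uid Inp Out : Type}

attribute [instance] Protocol.seedFintype Protocol.seedNonempty

/-- The operator that takes a function of the history to its conditional expectation one round
earlier. Its powers give the conditional expectations several rounds earlier. -/
noncomputable def expectNext (P : Protocol Uid Inp Out) (n : ℕ) :
    Module.End ℝ (P.History n → ℝ) where
  toFun F h := 𝔼 s : Fin n → P.Seed, F (s :: h)
  map_add' _ _ := funext fun _ => Finset.expect_add_distrib _ _ _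
  map_smul' _ _ := funext fun _ => (Finset.mul_expect _ _ _).symm

variable (P : Protocol Uid Inp Out) {n : ℕ}

theorem expectNext_mono : Monotone (P.expectNext n) := fun _ _ h _ =>
  Finset.expect_le_expect fun _ _ => h _

theorem expectNext_pow_mono (R : ℕ) : Monotone (P.expectNext n ^ R) := by
  rw [Module.End.coe_pow]
  exact P.expectNext_mono.iterate R

theorem expectNext_pow_nonneg {F : P.History n → ℝ} (h : 0 ≤ F) (R : ℕ) :
    0 ≤ (P.expectNext n ^ R) F :=
  (map_zero (P.expectNext n ^ R)).symm.trans_le (P.expectNext_pow_mono R h)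

theorem expectNext_pow_const (a : ℝ) (R : ℕ) :
    (P.expectNext n ^ R) (fun _ => a) = fun _ => a := by
  rw [Module.End.coe_pow]
  exact Function.iterate_fixed (funext fun _ => Fintype.expect_const a) R

theorem expectNext_pow_le_self {F : P.History n → ℝ} (h : ∀ s x, F (s :: x) ≤ F x) (R : ℕ) :
    (P.expectNext n ^ R) F ≤ F := by
  induction R with
  | zero => exact le_rfl
  | succ R ih =>
    have next_le : P.expectNext n F ≤ F := fun x =>
      Finset.expect_le Finset.univ_nonempty fun s _ => h s x
    rw [pow_succ, Module.End.mul_apply]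
    exact (P.expectNext_pow_mono R next_le).trans ih

theorem le_expectNext_pow_self {F : P.History n → ℝ} (h : ∀ s x, F x ≤ F (s :: x)) (R : ℕ) :
    F ≤ (P.expectNext n ^ R) F := by
  have neg_le := P.expectNext_pow_le_self (F := -F) (fun s x => neg_le_neg (h s x)) R
  rwa [map_neg, neg_le_neg_iff] at neg_le

theorem expectNext_pow_le_of_length {F G : P.History n → ℝ} (R : ℕ) (x : P.History n)
    (h : ∀ y : P.History n, y.length = x.length + R → F y ≤ G y) :
    (P.expectNext n ^ R) F x ≤ (P.expectNext n ^ R) G x := by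
  induction R generalizing x with
  | zero => exact h x rfl
  | succ R ih =>
    rw [pow_succ', Module.End.mul_apply, Module.End.mul_apply]
    refine Finset.expect_le_expect fun s _ => ih _ fun y hy => h y ?_
    rw [hy, List.length_cons]
    ring

theorem expectNext_pow_mul_le {F : P.History n → ℝ} {T : ℕ} {a : ℝ} (ha : 0 ≤ a)
    (h : ∀ x : P.History n, T ∣ x.length → (P.expectNext n ^ T) F x ≤ a * F x) (M : ℕ) :
    (P.expectNext n ^ (M * T)) F [] ≤ a ^ M * F [] := by
  induction M with
  | zero => simp
  | succ M ih =>
    calc (P.expectNext n ^ ((M + 1) * T)) F []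
        = (P.expectNext n ^ (M * T)) ((P.expectNext n ^ T) F) [] := by
          rw [add_mul, one_mul, pow_add, Module.End.mul_apply]
      _ ≤ (P.expectNext n ^ (M * T)) (a • F) [] :=
          P.expectNext_pow_le_of_length _ _ fun y hy => h y (by simp [hy])
      _ = a * (P.expectNext n ^ (M * T)) F [] := by rw [map_smul, Pi.smul_apply, smul_eq_mul]
      _ ≤ a * (a ^ M * F []) := mul_le_mul_of_nonneg_left ih ha
      _ = a ^ (M + 1) * F [] := by ring

theorem tsum_historyLaw_mul (R : ℕ) {F : P.History n → ℝ} (hF : 0 ≤ F) :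
    ∑' h, P.historyLaw n R h * ENNReal.ofReal (F h)
      = ENNReal.ofReal ((P.expectNext n ^ R) F []) := by
  induction R generalizing F with
  | zero => exact tsum_pmf_pure_mul _ _
  | succ R ih =>
    rw [pow_succ, Module.End.mul_apply,
      ← ih (F := P.expectNext n F) fun h => Finset.expect_nonneg fun _ _ => hF _,
      historyLaw, tsum_pmf_bind_mul]
    exact tsum_congr fun h => congrArg _ (tsum_pmf_map_uniform_mul (fun s => s :: h) hF)

open Classical in
theorem outputProb_eq_expectNext_pow (uid : Fin n → Uid) (inp : Fin n → Inp) (adv : P.Adversary n)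
    (R : ℕ) (E : (Fin n → Out) → Prop) :
    P.outputProb uid inp adv R E = (P.expectNext n ^ R)
      (fun h => if E fun v => P.out (P.run uid inp adv h v) then 1 else 0) [] := by
  have indicator_nonneg : (0 : P.History n → ℝ) ≤
      fun h => if E fun v => P.out (P.run uid inp adv h v) then 1 else 0 := by
    intro h
    dsimp only [Pi.zero_apply]
    split_ifs <;> norm_num
  rw [outputProb, PMF.toOuterMeasure_apply,
    ← ENNReal.toReal_ofReal (P.expectNext_pow_nonneg indicator_nonneg R []),
    ← P.tsum_historyLaw_mul R indicator_nonneg]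
  congr 2 with h
  by_cases hE : E fun v => P.out (P.run uid inp adv h v) <;> simp [Set.indicator, hE]

theorem expectNext_pow_le_outputProb {uid : Fin n → Uid} {inp : Fin n → Inp}
    {adv : P.Adversary n} {R : ℕ} {E : (Fin n → Out) → Prop} {F : P.History n → ℝ}
    (le_one : ∀ h, F h ≤ 1)
    (nonpos : ∀ h, ¬ E (fun v => P.out (P.run uid inp adv h v)) → F h ≤ 0) :
    (P.expectNext n ^ R) F [] ≤ P.outputProb uid inp adv R E := by
  classical
  rw [outputProb_eq_expectNext_pow]
  refine P.expectNext_pow_mono R (fun h => ?_) []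
  split_ifs with hE
  exacts [le_one h, nonpos h hE]

end Protocol

/-! ### Forests in graphs -/

section GraphDistance

variable {V : Type*} {G : SimpleGraph V}

theorem dist_le_succ_iff (hG : G.Connected) {v w : V} {j : ℕ} :
    G.dist v w ≤ j + 1 ↔ G.dist v w ≤ j ∨ ∃ u, G.Adj v u ∧ G.dist u w ≤ j := by
  constructor
  · intro h
    obtain ⟨q, hq⟩ := hG.exists_walk_length_eq_dist v w
    cases q with
    | nil => simp
    | cons hadj q =>
      rw [SimpleGraph.Walk.length_cons] at hq
      exact Or.inr ⟨_, hadj, (SimpleGraph.dist_le q).trans (by omega)⟩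
  · rintro (h | ⟨u, hu, h⟩)
    · omega
    · have triangle := hG.dist_triangle (u := v) (v := u) (w := w)
      rw [SimpleGraph.dist_eq_one_iff_adj.2 hu] at triangle
      omega

theorem exists_dist_eq_of_le (hG : G.Connected) (x y : V) {i : ℕ} (hi : i ≤ G.dist y x) :
    ∃ w, G.dist w x = i := by
  obtain ⟨q, hq⟩ := hG.exists_walk_length_eq_dist x y
  rw [SimpleGraph.dist_comm, ← hq] at hi
  refine ⟨q.getVert i, ?_⟩
  rw [SimpleGraph.dist_comm, ← SimpleGraph.length_eq_dist_of_subwalk hq (q.isSubwalk_take i),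
    SimpleGraph.Walk.take_length, min_eq_left hi]

variable [Fintype V]

open Classical in
/-- The closed ball of radius `j` around a vertex. -/
noncomputable def distBall (G : SimpleGraph V) (j : ℕ) (v : V) : Finset V :=
  Finset.univ.filter fun u => G.dist v u ≤ j

theorem mem_distBall {j : ℕ} {v u : V} : u ∈ distBall G j v ↔ G.dist v u ≤ j := by
  simp [distBall]

theorem distBall_zero (hG : G.Connected) (v : V) : distBall G 0 v = {v} := by
  ext u
  simp [mem_distBall, hG.dist_eq_zero_iff, eq_comm]

open Classical in
theorem distBall_succ (hG : G.Connected) (j : ℕ) (v : V) :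
    distBall G (j + 1) v
      = distBall G j v ∪ (Finset.univ.filter fun u => G.Adj v u).biUnion (distBall G j) := by
  ext w
  simp [mem_distBall, dist_le_succ_iff hG]

end GraphDistance

/-- A family of disjoint trees of height at most `D` in a graph. The vertices without depth are in
no tree, and `parent` is meaningful at vertices of positive depth only. -/
structure Forest {V : Type*} (G : SimpleGraph V) (D : ℕ) where
  depth : V → Option ℕ
  parent : V → V
  adj_parent {v : V} {δ : ℕ} : depth v = some (δ + 1) → G.Adj v (parent v)
  depth_parent {v : V} {δ : ℕ} : depth v = some (δ + 1) → depth (parent v) = some δ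
  depth_le {v : V} {δ : ℕ} : depth v = some δ → δ ≤ D

namespace Forest

variable {V : Type*} {G : SimpleGraph V} {D : ℕ} (F : Forest G D)

/-- The ancestor that a vertex of depth `δ` has at depth `a ≤ δ`. -/
def ancestor (a : ℕ) (v : V) : V := F.parent^[(F.depth v).getD 0 - a] v

/-- The root of the tree of a vertex. -/
abbrev root (v : V) : V := F.ancestor 0 v

variable {F}

theorem ancestor_self {v : V} {δ : ℕ} (hv : F.depth v = some δ) : F.ancestor δ v = v := by
  simp [ancestor, hv]

theorem ancestor_parent {v : V} {a δ : ℕ} (hv : F.depth v = some (δ + 1)) (ha : a ≤ δ) :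
    F.ancestor a (F.parent v) = F.ancestor a v := by
  simp [ancestor, hv, F.depth_parent hv, Nat.succ_sub ha]

theorem parent_ancestor {v : V} {a δ : ℕ} (hv : F.depth v = some δ) (ha : a < δ) :
    F.parent (F.ancestor (a + 1) v) = F.ancestor a v := by
  rw [ancestor, ancestor, hv, Option.getD_some, ← Function.iterate_succ_apply' F.parent,
    show (δ - (a + 1)).succ = δ - a by omega]

theorem depth_ancestor {v : V} {a δ : ℕ} (hv : F.depth v = some δ) (ha : a ≤ δ) :
    F.depth (F.ancestor a v) = some a := by
  induction δ generalizing v with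
  | zero => rwa [Nat.le_zero.1 ha, ancestor_self hv]
  | succ δ ih =>
    obtain rfl | hlt := ha.eq_or_lt
    · rwa [ancestor_self hv]
    · rw [← ancestor_parent hv (Nat.le_of_lt_succ hlt)]
      exact ih (F.depth_parent hv) (Nat.le_of_lt_succ hlt)

theorem depth_root {v : V} (hv : (F.depth v).isSome) : F.depth (F.root v) = some 0 := by
  obtain ⟨δ, hδ⟩ := Option.isSome_iff_exists.1 hv
  exact depth_ancestor hδ (Nat.zero_le δ)

theorem dist_root_le (hG : G.Connected) {v : V} {δ : ℕ} (hv : F.depth v = some δ) :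
    G.dist v (F.root v) ≤ δ := by
  induction δ generalizing v with
  | zero => simp [root, ancestor_self hv]
  | succ δ ih =>
    rw [root, ← ancestor_parent hv (Nat.zero_le δ)]
    exact (dist_le_succ_iff hG).2 (Or.inr ⟨_, F.adj_parent hv, ih (F.depth_parent hv)⟩)

/-! #### Sums over subtrees -/

variable [Fintype V]

open Classical in
/-- The vertices of the subtree below a vertex of depth `δ`. -/
noncomputable def subtree (F : Forest G D) (δ : ℕ) (v : V) : Finset V :=
  Finset.univ.filter fun u => (∃ ε ≥ δ, F.depth u = some ε) ∧ F.ancestor δ u = v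

/-- The vertices of the tree of a vertex. -/
noncomputable abbrev patch (F : Forest G D) (v : V) : Finset V := F.subtree 0 (F.root v)

open Classical in
/-- The children of a vertex of depth `δ`. -/
noncomputable def children (F : Forest G D) (δ : ℕ) (v : V) : Finset V :=
  Finset.univ.filter fun u => F.depth u = some (δ + 1) ∧ F.parent u = v

theorem mem_children {δ : ℕ} {u v : V} :
    u ∈ F.children δ v ↔ F.depth u = some (δ + 1) ∧ F.parent u = v := by
  simp [children]

theorem mem_subtree {δ : ℕ} {u v : V} :
    u ∈ F.subtree δ v ↔ (∃ ε ≥ δ, F.depth u = some ε) ∧ F.ancestor δ u = v := by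
  simp [subtree]

theorem mem_patch {u v : V} : u ∈ F.patch v ↔ (F.depth u).isSome ∧ F.root u = F.root v := by
  simp [mem_subtree, Option.isSome_iff_exists]

theorem mem_patch_self {v : V} (hv : (F.depth v).isSome) : v ∈ F.patch v := mem_patch.2 ⟨hv, rfl⟩

theorem patch_root {v : V} (hv : (F.depth v).isSome) : F.patch (F.root v) = F.patch v := by
  rw [patch, root, ancestor_self (depth_root hv)]

theorem patch_eq {u v : V} (hu : u ∈ F.patch v) : F.patch u = F.patch v := by
  rw [patch, (mem_patch.1 hu).2]

open Classical in
theorem subtree_eq {v : V} {δ : ℕ} (hv : F.depth v = some δ) :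
    F.subtree δ v = insert v ((F.children δ v).biUnion (F.subtree (δ + 1))) := by
  ext u
  simp only [mem_subtree, Finset.mem_insert, Finset.mem_biUnion, mem_children]
  constructor
  · rintro ⟨⟨ε, hε, hu⟩, rfl⟩
    obtain rfl | hlt := hε.eq_or_lt
    · exact Or.inl (ancestor_self hu).symm
    · exact Or.inr ⟨F.ancestor (δ + 1) u, ⟨depth_ancestor hu hlt, parent_ancestor hu hlt⟩,
        ⟨ε, hlt, hu⟩, rfl⟩
  · rintro (rfl | ⟨w, ⟨-, rfl⟩, ⟨ε, hε, hu⟩, rfl⟩)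
    · exact ⟨⟨δ, le_rfl, hv⟩, ancestor_self hv⟩
    · exact ⟨⟨ε, Nat.le_of_succ_le hε, hu⟩, (parent_ancestor hu hε).symm⟩

theorem sum_subtree {M : Type*} [AddCommMonoid M] (c : V → M) {v : V} {δ : ℕ}
    (hv : F.depth v = some δ) :
    ∑ u ∈ F.subtree δ v, c u = c v + ∑ w ∈ F.children δ v, ∑ u ∈ F.subtree (δ + 1) w, c u := by
  classical
  rw [subtree_eq hv, Finset.sum_insert, Finset.sum_biUnion]
  · refine fun w _ w' _ hne => Finset.disjoint_left.2 fun u hu hu' => hne ?_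
    rw [← (mem_subtree.1 hu).2, ← (mem_subtree.1 hu').2]
  · simp [mem_subtree, hv]

/-! #### Breadth-first search -/

omit [Fintype V]

variable (F)

/-- The forest consists of breadth-first trees, grown simultaneously from all roots. -/
def IsBFS : Prop :=
  ∀ v x, F.depth x = some 0 → G.dist v x ≤ D → ∃ δ ≤ G.dist v x, F.depth v = some δ

/-- The vertices outside the forest that have a neighbour of the greatest possible depth. -/
def frontier : Set V := {v | F.depth v = none ∧ ∃ u, G.Adj v u ∧ F.depth u = some D}

open Classical in
/-- The single vertices of a set as trees of height `0`. -/
noncomputable def ofRoots (G : SimpleGraph V) (A : Set V) : Forest G 0 where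
  depth v := if v ∈ A then some 0 else none
  parent := id
  adj_parent h := by split_ifs at h; simp at h
  depth_parent h := by split_ifs at h; simp at h
  depth_le h := by split_ifs at h; simp_all

variable {F} in
open Classical in
/-- The vertices of the frontier join the forest as children of the vertices given by `q`. -/
noncomputable def grow (q : V → V)
    (hq : ∀ v ∈ F.frontier, G.Adj v (q v) ∧ F.depth (q v) = some D) : Forest G (D + 1) where
  depth v := if v ∈ F.frontier then some (D + 1) else F.depth v
  parent v := if v ∈ F.frontier then q v else F.parent v
  adj_parent {v δ} h := by
    split_ifs at h ⊢ with hv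
    · exact (hq v hv).1
    · exact F.adj_parent h
  depth_parent {v δ} h := by
    have depth_old : ∀ u ε, F.depth u = some ε → u ∉ F.frontier := fun u ε hu hu' => by
      simp [hu'.1] at hu
    split_ifs at h with hv
    · rw [if_pos hv, if_neg (depth_old _ _ (hq v hv).2), (hq v hv).2]
      simpa using h
    · rw [if_neg hv, if_neg (depth_old _ _ (F.depth_parent h)), F.depth_parent h]
  depth_le {v δ} h := by
    split_ifs at h
    · exact (Option.some.inj h).ge
    · exact (F.depth_le h).trans (Nat.le_succ D)

variable {F}

theorem isBFS_ofRoots (hG : G.Connected) (A : Set V) : (ofRoots G A).IsBFS := by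
  intro v x hx hd
  obtain rfl : v = x := hG.dist_eq_zero_iff.1 (Nat.le_zero.1 hd)
  exact ⟨0, Nat.zero_le _, hx⟩

theorem IsBFS.depth_eq_of_adj (hF : F.IsBFS) (hG : G.Connected) {u v : V} {δ : ℕ}
    (hv : F.depth v = none) (huv : G.Adj v u) (hu : F.depth u = some δ) : δ = D := by
  by_contra hne
  have hlt := (F.depth_le hu).lt_of_ne hne
  have dist_le : G.dist v (F.root u) ≤ δ + 1 :=
    (dist_le_succ_iff hG).2 (Or.inr ⟨u, huv, dist_root_le hG hu⟩)
  obtain ⟨ε, -, hε⟩ := hF v _ (depth_root (by simp [hu])) (dist_le.trans hlt)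
  simp [hv] at hε

theorem IsBFS.grow (hF : F.IsBFS) (hG : G.Connected) (q : V → V)
    (hq : ∀ v ∈ F.frontier, G.Adj v (q v) ∧ F.depth (q v) = some D) :
    (Forest.grow q hq).IsBFS := by
  intro v x hx hd
  have hx_old : F.depth x = some 0 := by
    simp only [Forest.grow] at hx
    split_ifs at hx
    · simp at hx
    · exact hx
  by_cases hv : v ∈ F.frontier
  · refine ⟨D + 1, ?_, if_pos hv⟩
    by_contra hlt
    obtain ⟨δ, -, hδ⟩ := hF v x hx_old (by omega)
    simp [hv.1] at hδ
  · suffices h : ∃ δ ≤ G.dist v x, F.depth v = some δ by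
      simpa only [Forest.grow, if_neg hv] using h
    obtain hle | ⟨u, huv, hux⟩ := (dist_le_succ_iff hG).1 hd
    · exact hF v x hx_old hle
    · obtain ⟨δ, -, hδ⟩ := hF u x hx_old hux
      rcases hvd : F.depth v with _ | ε
      · exact absurd ⟨hvd, u, huv, hF.depth_eq_of_adj hG hvd huv hδ ▸ hδ⟩ hv
      · refine ⟨ε, ?_, rfl⟩
        by_contra hlt
        obtain ⟨ε', hle, hε'⟩ := hF v x hx_old (by have := F.depth_le hvd; omega)
        rw [hvd, Option.some.injEq] at hε'
        omega

theorem IsBFS.depth_isSome (hF : F.IsBFS) {v x : V} (hx : F.depth x = some 0)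
    (hvx : G.dist v x ≤ D) : (F.depth v).isSome := by
  obtain ⟨δ, -, hδ⟩ := hF v x hx hvx
  simp [hδ]

theorem IsBFS.half_lt_card_patch [Fintype V] (hF : F.IsBFS) (hG : G.Connected)
    (hsep : ∀ x y, F.depth x = some 0 → F.depth y = some 0 → G.dist x y ≤ D → x = y)
    {x y : V} (hx : F.depth x = some 0) (hy : F.depth y = some 0) (hne : y ≠ x) :
    D / 2 < (F.patch x).card := by
  classical
  have far : D < G.dist y x := not_le.1 fun h => hne (hsep y x hy hx h)
  have subset_image : Finset.range (D / 2 + 1) ⊆ (F.patch x).image fun w => G.dist w x := by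
    intro i hi
    have hi_le : i ≤ D / 2 := Nat.le_of_lt_succ (Finset.mem_range.1 hi)
    obtain ⟨w, hw⟩ := exists_dist_eq_of_le hG x y (show i ≤ G.dist y x by omega)
    obtain ⟨δ, hle, hδ⟩ := hF w x hx (by omega)
    have hw_some : (F.depth w).isSome := by simp [hδ]
    have triangle := hG.dist_triangle (u := F.root w) (v := w) (w := x)
    rw [G.dist_comm (u := F.root w) (v := w)] at triangle
    have root_eq : F.root w = x :=
      hsep _ x (depth_root hw_some) hx (by have := dist_root_le hG hδ; omega)
    exact Finset.mem_image.2 ⟨w, mem_patch.2 ⟨hw_some, root_eq.trans (ancestor_self hx).symm⟩, hw⟩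
  calc D / 2 + 1 = (Finset.range (D / 2 + 1)).card := (Finset.card_range _).symm
    _ ≤ ((F.patch x).image fun w => G.dist w x).card := Finset.card_le_card subset_image
    _ ≤ (F.patch x).card := Finset.card_image_le

end Forest

theorem expect_le_of_expect_ite_eq_half {Ω : Type*} [Fintype Ω] [Nonempty Ω] {X : Ω → ℝ}
    {p : Ω → Prop} [DecidablePred p] {a b : ℝ} (hp : 𝔼 r, (if p r then (1 : ℝ) else 0) = 1 / 2)
    (ha : ∀ r, X r ≤ a) (hb : ∀ r, ¬ p r → X r ≤ b) : 𝔼 r, X r ≤ (a + b) / 2 := by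
  calc 𝔼 r, X r ≤ 𝔼 r, (b + (a - b) * if p r then (1 : ℝ) else 0) := by
        refine Finset.expect_le_expect fun r _ => ?_
        split_ifs with h
        · simpa using ha r
        · simpa using hb r h
    _ = (a + b) / 2 := by
        rw [Finset.expect_add_distrib, Fintype.expect_const, ← Finset.mul_expect, hp]
        ring

/-! ### Strict maxima of independent uniform priorities -/

section StrictMax

variable {V : Type*} [Fintype V] [DecidableEq V]

theorem one_div_card_le_expect_isMax {Ω α : Type*} [Fintype Ω] [Nonempty Ω] [LinearOrder α]
    (f : Ω → α) {W : Finset V} {u : V} (hu : u ∈ W) :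
    1 / (W.card : ℝ) ≤ 𝔼 r : V → Ω, if ∀ w ∈ W, f (r w) ≤ f (r u) then (1 : ℝ) else 0 := by
  set isMax : V → (V → Ω) → ℝ := fun u r => if ∀ w ∈ W, f (r w) ≤ f (r u) then 1 else 0
  have symmetric : ∀ v ∈ W, 𝔼 r, isMax v r = 𝔼 r, isMax u r := by
    intro v hv
    have swap_mem : ∀ w, w ∈ W ↔ Equiv.swap u v w ∈ W := fun w => by
      rw [Equiv.swap_apply_def]
      split_ifs <;> simp_all
    refine Fintype.expect_equiv (Equiv.arrowCongr (Equiv.swap u v) (Equiv.refl _)) _ _ fun r => ?_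
    refine if_congr ?_ rfl rfl
    rw [(Equiv.swap u v).forall_congr_left]
    simp [← swap_mem]
  have sum_ge_one : 1 ≤ ∑ v ∈ W, 𝔼 r, isMax v r := by
    rw [← Finset.expect_sum_comm]
    refine Finset.le_expect Finset.univ_nonempty fun r _ => ?_
    obtain ⟨x, hx, hmax⟩ := Finset.exists_max_image W (fun w => f (r w)) ⟨u, hu⟩
    calc (1 : ℝ) = isMax x r := (if_pos hmax).symm
      _ ≤ ∑ v ∈ W, isMax v r := Finset.single_le_sum (f := fun v => isMax v r)
        (fun v _ => by dsimp only [isMax]; split_ifs <;> norm_num) hx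
  rw [Finset.sum_congr rfl symmetric, Finset.sum_const, nsmul_eq_mul] at sum_ge_one
  rwa [div_le_iff₀' (by exact_mod_cast Finset.card_pos.2 ⟨u, hu⟩)]

theorem ite_isMax_le {α : Type*} [LinearOrder α] (x : V → α) (W : Finset V) (u : V) :
    (if ∀ w ∈ W, x w ≤ x u then (1 : ℝ) else 0)
      ≤ (if ∀ w ∈ W, w ≠ u → x w < x u then (1 : ℝ) else 0)
        + ∑ w ∈ W.erase u, if x w = x u then (1 : ℝ) else 0 := by
  have tie_nonneg : ∀ w ∈ W.erase u, (0 : ℝ) ≤ if x w = x u then (1 : ℝ) else 0 :=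
    fun w _ => by split_ifs <;> norm_num
  have sum_nonneg := Finset.sum_nonneg tie_nonneg
  split_ifs with isMax isStrict isStrict <;> try linarith
  push Not at isStrict
  obtain ⟨w, hw, hne, hle⟩ := isStrict
  have tie_le := Finset.single_le_sum tie_nonneg (Finset.mem_erase.2 ⟨hne, hw⟩)
  rw [if_pos (le_antisymm (isMax w hw) hle)] at tie_le
  linarith

variable {β : Type*} [Fintype β] [Nonempty β] {m : ℕ} [NeZero m]

theorem expect_tie_eq {u w : V} (huw : w ≠ u) :
    𝔼 r : V → Fin m × β, (if (r w).1 = (r u).1 then (1 : ℝ) else 0) = 1 / m := by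
  have shift : ∀ a : Fin m, 𝔼 r : V → Fin m × β, (if (r w).1 = (r u).1 then (1 : ℝ) else 0)
      = 𝔼 r : V → Fin m × β, (if (r w).1 - (r u).1 = a then (1 : ℝ) else 0) := by
    intro a
    let e : (V → Fin m × β) ≃ (V → Fin m × β) :=
      { toFun := fun r => Function.update r u ((r u).1 + a, (r u).2)
        invFun := fun r => Function.update r u ((r u).1 - a, (r u).2)
        left_inv := fun r => by simp
        right_inv := fun r => by simp }
    refine (Fintype.expect_equiv e _ _ fun r => ?_).symm
    simp [e, Function.update_of_ne huw, sub_eq_iff_eq_add, add_comm a]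
  have m_ne_zero : (m : ℝ) ≠ 0 := by exact_mod_cast NeZero.ne m
  rw [eq_div_iff m_ne_zero, mul_comm]
  calc (m : ℝ) * 𝔼 r : V → Fin m × β, (if (r w).1 = (r u).1 then (1 : ℝ) else 0)
      = ∑ a : Fin m, 𝔼 r : V → Fin m × β, (if (r w).1 - (r u).1 = a then (1 : ℝ) else 0) := by
        simp_rw [← shift, Finset.sum_const, Finset.card_univ, Fintype.card_fin, nsmul_eq_mul]
    _ = 𝔼 r : V → Fin m × β, ∑ a : Fin m, (if (r w).1 - (r u).1 = a then (1 : ℝ) else 0) :=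
        (Finset.expect_sum_comm _ _ _).symm
    _ = 1 := by simp

theorem one_div_two_mul_card_le_expect_strictMax {W : Finset V} {u : V} (hu : u ∈ W)
    (hW : 2 * W.card ^ 2 ≤ m) :
    1 / (2 * (W.card : ℝ)) ≤ 𝔼 r : V → Fin m × β,
      (if ∀ w ∈ W, w ≠ u → (r w).1 < (r u).1 then (1 : ℝ) else 0) := by
  have card_pos : (0 : ℝ) < W.card := by exact_mod_cast Finset.card_pos.2 ⟨u, hu⟩
  have m_pos : (0 : ℝ) < m := by exact_mod_cast NeZero.pos m
  have max_ge := one_div_card_le_expect_isMax (Prod.fst : Fin m × β → Fin m) hu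
  have max_le := Finset.expect_le_expect (s := Finset.univ) fun (r : V → Fin m × β) _ =>
    ite_isMax_le (fun v => (r v).1) W u
  rw [Finset.expect_add_distrib, Finset.expect_sum_comm,
    Finset.sum_congr rfl fun w hw => expect_tie_eq (Finset.ne_of_mem_erase hw),
    Finset.sum_const, nsmul_eq_mul] at max_le
  have ties_le : ((W.erase u).card : ℝ) * (1 / m) ≤ 1 / (2 * (W.card : ℝ)) := by
    have card_erase_le : ((W.erase u).card : ℝ) ≤ W.card := by
      exact_mod_cast Finset.card_le_card (Finset.erase_subset u W)
    have hW_real : 2 * (W.card : ℝ) ^ 2 ≤ m := by exact_mod_cast hW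
    rw [mul_one_div, div_le_div_iff₀ m_pos (by positivity)]
    nlinarith
  have two_halves : 1 / (W.card : ℝ) = 1 / (2 * (W.card : ℝ)) + 1 / (2 * (W.card : ℝ)) := by
    field_simp
    norm_num
  linarith

end StrictMax

/-! ### The potential function -/

/-- The potential of `x` nodes that do not sense a functional, for patches of at least `d` nodes. -/
noncomputable def weight (d x : ℕ) : ℝ := x * 2 ^ (x / d)

theorem weight_zero (d : ℕ) : weight d 0 = 0 := by simp [weight]

theorem weight_nonneg (d x : ℕ) : 0 ≤ weight d x := by
  rw [weight]
  positivity

theorem weight_mono (d : ℕ) : Monotone (weight d) := fun x y h => by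
  rw [weight, weight]
  gcongr
  norm_num

theorem one_le_weight (d : ℕ) {x : ℕ} (hx : 0 < x) : 1 ≤ weight d x :=
  one_le_mul_of_one_le_of_one_le (by exact_mod_cast hx) (one_le_pow₀ one_le_two)

theorem weight_le_half {d x y : ℕ} (hd : 0 < d) (h : x + d ≤ y) :
    weight d x ≤ weight d y / 2 := by
  have div_lt : x / d + 1 ≤ y / d := by
    rw [← Nat.add_div_right x hd]
    exact Nat.div_le_div_right h
  rw [weight, weight, le_div_iff₀ two_pos, mul_assoc, ← pow_succ]
  gcongr
  · omega
  · norm_num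

theorem expect_weight_le_of_drop {Ω : Type*} [Fintype Ω] [Nonempty Ω] {f : Ω → ℕ}
    {p : Ω → Prop} [DecidablePred p] {d x : ℕ} (hp : 𝔼 r, (if p r then (1 : ℝ) else 0) = 1 / 2)
    (hd : 0 < d) (hle : ∀ r, f r ≤ x) (hdrop : ∀ r, ¬ p r → f r + d ≤ x) :
    𝔼 r, weight d (f r) ≤ 3 / 4 * weight d x := by
  refine (expect_le_of_expect_ite_eq_half hp (fun r => weight_mono d (hle r))
    fun r hr => weight_le_half hd (hdrop r hr)).trans ?_
  linarith

theorem exists_adj_boundary {V : Type*} {G : SimpleGraph V} (hG : G.Connected) (S : Set V)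
    {x y : V} (hx : x ∈ S) (hy : y ∉ S) : ∃ a z, G.Adj a z ∧ a ∈ S ∧ z ∉ S := by
  obtain ⟨q⟩ := hG.preconnected x y
  obtain ⟨d, -, hfst, hsnd⟩ := q.exists_boundary_dart S hx hy
  exact ⟨d.fst, d.snd, d.adj, hfst, hsnd⟩

namespace PatchSharing

variable {p : Params} {V : Type*}

/-! ### Sensing -/

theorem combination_add_single {K : Finset (Vec p)} {x : Vec p} (hx : x ∈ K)
    (c : Vec p → ZMod 2) : combination K (c + Pi.single x 1) = combination K c + x := by
  simp only [combination, Pi.add_apply, add_smul, Finset.sum_add_distrib]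
  congr 1
  rw [Finset.sum_eq_single_of_mem x hx fun y _ hy => by rw [Pi.single_eq_of_ne hy, zero_smul],
    Pi.single_eq_same, one_smul]

instance : NeZero p.prioRange := ⟨(Nat.pow_pos Nat.two_pos).ne'⟩

/-- The sum of random combinations of the vectors `K` that the nodes in `A` have received. -/
def randomSum (K : V → Finset (Vec p)) (A : Finset V) (r : V → Seed p) : Vec p :=
  ∑ u ∈ A, combination (K u) (r u).2

/-- A node with received vectors `K` senses `φ` if one of the vectors is outside the kernel. -/
def Senses (φ : Vec p →ₗ[ZMod 2] ZMod 2) (K : Finset (Vec p)) : Prop := ∃ x ∈ K, φ x ≠ 0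

theorem Senses.mono {φ : Vec p →ₗ[ZMod 2] ZMod 2} {K K' : Finset (Vec p)} (h : Senses φ K)
    (hK : K ⊆ K') : Senses φ K' := by
  obtain ⟨x, hx, hφ⟩ := h
  exact ⟨x, hK hx, hφ⟩

theorem expect_randomSum_eq_zero [Fintype V] [DecidableEq V] {φ : Vec p →ₗ[ZMod 2] ZMod 2}
    {K : V → Finset (Vec p)} {A : Finset V} {u : V} (hu : u ∈ A) (hK : Senses φ (K u)) :
    𝔼 r : V → Seed p, (if φ (randomSum K A r) = 0 then (1 : ℝ) else 0) = 1 / 2 := by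
  obtain ⟨x, hx, hφ⟩ := hK
  -- Flipping the coefficient of `x` at the node `u` exchanges the two events.
  let flip : (V → Seed p) → V → Seed p := fun r =>
    Function.update r u ((r u).1, (r u).2 + Pi.single x 1)
  have flip_flip : Function.Involutive flip := fun r => by
    simp [flip, add_assoc, CharTwo.add_self_eq_zero]
  have randomSum_flip : ∀ r, randomSum K A (flip r) = randomSum K A r + x := fun r => by
    rw [randomSum, randomSum, ← Finset.add_sum_erase A _ hu, ← Finset.add_sum_erase A _ hu,
      Finset.sum_congr rfl fun w hw => by
        rw [show flip r w = r w from Function.update_of_ne (Finset.ne_of_mem_erase hw) _ _]]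
    simp only [flip, Function.update_self, combination_add_single hx]
    abel
  refine expect_ite_eq_half_of_perm _ flip_flip.toPerm fun r => ?_
  rw [Function.Involutive.coe_toPerm, randomSum_flip, map_add]
  generalize φ (randomSum K A r) = a
  generalize φ x = b at hφ
  revert a b
  decide

variable [Fintype V]

open Classical in
/-- The nodes that do not sense `φ`. -/
noncomputable def ignorant (φ : Vec p →ₗ[ZMod 2] ZMod 2) (K : V → Finset (Vec p)) : Finset V :=
  Finset.univ.filter fun v => ¬ Senses φ (K v)

theorem mem_ignorant {φ : Vec p →ₗ[ZMod 2] ZMod 2} {K : V → Finset (Vec p)} {v : V} :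
    v ∈ ignorant φ K ↔ ¬ Senses φ (K v) := by
  simp [ignorant]

theorem ignorant_anti {φ : Vec p →ₗ[ZMod 2] ZMod 2} {K K' : V → Finset (Vec p)}
    (h : ∀ v, K v ⊆ K' v) : ignorant φ K' ⊆ ignorant φ K := fun v hv =>
  mem_ignorant.2 fun hs => mem_ignorant.1 hv (hs.mono (h v))

/-! ### The effect of a meta round on the received vectors -/

variable {G : SimpleGraph V} {D : ℕ} (F : Forest G D) (K : V → Finset (Vec p)) (r : V → Seed p)

/-- The random sum of the patch of `v`. -/
noncomputable def patchSum (v : V) : Vec p := randomSum K (F.patch v) r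

open Classical in
/-- The received vectors after a share step. -/
noncomputable def shareKnown (v : V) : Finset (Vec p) :=
  if (F.depth v).isSome then insert (patchSum F K r v) (K v) else K v

open Classical in
/-- The neighbours of a node that lie in a tree. -/
noncomputable def passers (v : V) : Finset V :=
  Finset.univ.filter fun u => G.Adj v u ∧ (F.depth u).isSome

open Classical in
/-- The received vectors after a share step and a pass step. -/
noncomputable def passKnown (v : V) : Finset (Vec p) :=
  shareKnown F K r v ∪ (passers F v).image (patchSum F K r)

open Classical in
/-- The received vectors after a meta round in which every node is a patch by itself. -/
noncomputable def singleKnown (G : SimpleGraph V) (v : V) : Finset (Vec p) :=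
  K v ∪ (G.neighborFinset v).image fun u => randomSum K {u} r

variable {F K r}

theorem subset_shareKnown (v : V) : K v ⊆ shareKnown F K r v := by
  rw [shareKnown]
  split_ifs
  · exact Finset.subset_insert _ _
  · exact subset_rfl

theorem patchSum_mem_shareKnown {v : V} (hv : (F.depth v).isSome) :
    patchSum F K r v ∈ shareKnown F K r v := by
  rw [shareKnown, if_pos hv]
  exact Finset.mem_insert_self _ _

theorem subset_passKnown (v : V) : K v ⊆ passKnown F K r v :=
  (subset_shareKnown v).trans Finset.subset_union_left

theorem patchSum_mem_passKnown {u v : V} (huv : G.Adj v u) (hu : (F.depth u).isSome) :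
    patchSum F K r u ∈ passKnown F K r v :=
  Finset.mem_union_right _ (Finset.mem_image_of_mem _ (by simp [passers, huv, hu]))

theorem subset_singleKnown (v : V) : K v ⊆ singleKnown K r G v := Finset.subset_union_left

theorem randomSum_mem_singleKnown {u v : V} (huv : G.Adj v u) :
    randomSum K {u} r ∈ singleKnown K r G v :=
  Finset.mem_union_right _ (Finset.mem_image.2 ⟨u, by simpa using huv, rfl⟩)

variable {W : Submodule (ZMod 2) (Vec p)}

theorem combination_mem {K : Finset (Vec p)} (hK : ∀ x ∈ K, x ∈ W) (c : Vec p → ZMod 2) :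
    combination K c ∈ W :=
  Submodule.sum_mem _ fun x hx => W.smul_mem _ (hK x hx)

omit [Fintype V] in
theorem randomSum_mem (hK : ∀ v, ∀ x ∈ K v, x ∈ W) (A : Finset V) : randomSum K A r ∈ W :=
  Submodule.sum_mem _ fun u _ => combination_mem (hK u) _

theorem shareKnown_mem (hK : ∀ v, ∀ x ∈ K v, x ∈ W) :
    ∀ v, ∀ x ∈ shareKnown F K r v, x ∈ W := by
  intro v x hx
  rw [shareKnown] at hx
  split_ifs at hx
  · rcases Finset.mem_insert.1 hx with rfl | hx
    · exact randomSum_mem hK _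
    · exact hK v x hx
  · exact hK v x hx

theorem passKnown_mem (hK : ∀ v, ∀ x ∈ K v, x ∈ W) : ∀ v, ∀ x ∈ passKnown F K r v, x ∈ W := by
  intro v x hx
  rcases Finset.mem_union.1 hx with hx | hx
  · exact shareKnown_mem hK v x hx
  · obtain ⟨u, -, rfl⟩ := Finset.mem_image.1 hx
    exact randomSum_mem hK _

theorem singleKnown_mem (hK : ∀ v, ∀ x ∈ K v, x ∈ W) :
    ∀ v, ∀ x ∈ singleKnown K r G v, x ∈ W := by
  intro v x hx
  rcases Finset.mem_union.1 hx with hx | hx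
  · exact hK v x hx
  · obtain ⟨u, -, rfl⟩ := Finset.mem_image.1 hx
    exact randomSum_mem hK _

/-! ### The expected progress in a meta round -/

variable {φ : Vec p →ₗ[ZMod 2] ZMod 2} {d : ℕ}

theorem card_ignorant_shareKnown_le (hF : ∀ v, (F.depth v).isSome) :
    ((ignorant φ (shareKnown F K r)).card : ℝ) ≤
      ∑ v ∈ ignorant φ K, if φ (patchSum F K r v) = 0 then 1 else 0 := by
  rw [← Finset.sum_filter, ← Nat.cast_one, ← Nat.cast_sum, ← Finset.card_eq_sum_ones]
  refine Nat.cast_le.2 (Finset.card_le_card fun v hv => Finset.mem_filter.2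
    ⟨ignorant_anti subset_shareKnown hv, ?_⟩)
  by_contra hne
  exact mem_ignorant.1 hv ⟨_, patchSum_mem_shareKnown (hF v), hne⟩

variable [DecidableEq V]

theorem expect_weight_shareKnown_le_half (hF : ∀ v, (F.depth v).isSome)
    (hK : ∀ v, ∃ u ∈ F.patch v, Senses φ (K u)) :
    𝔼 r, weight d (ignorant φ (shareKnown F K r)).card
      ≤ 1 / 2 * weight d (ignorant φ K).card := by
  calc 𝔼 r, weight d (ignorant φ (shareKnown F K r)).card
      ≤ 𝔼 r, (∑ v ∈ ignorant φ K, if φ (patchSum F K r v) = 0 then (1 : ℝ) else 0) *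
          2 ^ ((ignorant φ K).card / d) := by
        refine Finset.expect_le_expect fun r _ => ?_
        rw [weight]
        gcongr
        · exact card_ignorant_shareKnown_le hF
        · exact one_le_two
        · exact ignorant_anti subset_shareKnown
    _ = (∑ v ∈ ignorant φ K, 1 / 2) * 2 ^ ((ignorant φ K).card / d) := by
        rw [← Finset.expect_mul, Finset.expect_sum_comm]
        congr 1
        refine Finset.sum_congr rfl fun v _ => ?_
        obtain ⟨u, hu, hs⟩ := hK v
        exact expect_randomSum_eq_zero hu hs
    _ = 1 / 2 * weight d (ignorant φ K).card := by
        rw [Finset.sum_const, nsmul_eq_mul, weight]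
        ring

theorem expect_weight_shareKnown_le_of_patch {K' : V → Finset (Vec p)} {z : V} (hd : 0 < d)
    (hcard : d ≤ (F.patch z).card) (hz : (F.depth z).isSome) (hK : ∀ v, K v ⊆ K' v)
    (hignorant : ∀ u ∈ F.patch z, ¬ Senses φ (K u)) (hsenses : Senses φ (K' z)) :
    𝔼 r, weight d (ignorant φ (shareKnown F K' r)).card
      ≤ 3 / 4 * weight d (ignorant φ K).card := by
  have anti : ∀ r, ignorant φ (shareKnown F K' r) ⊆ ignorant φ K := fun r =>
    ignorant_anti fun v => (hK v).trans (subset_shareKnown v)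
  refine expect_weight_le_of_drop (expect_randomSum_eq_zero (Forest.mem_patch_self hz) hsenses) hd
    (fun r => Finset.card_le_card (anti r)) fun r hr => ?_
  have patch_senses : Disjoint (ignorant φ (shareKnown F K' r)) (F.patch z) := by
    rw [Finset.disjoint_right]
    intro v hv
    rw [mem_ignorant, not_not]
    refine ⟨_, patchSum_mem_shareKnown (Forest.mem_patch.1 hv).1, ?_⟩
    rwa [patchSum, Forest.patch_eq hv]
  calc (ignorant φ (shareKnown F K' r)).card + d
      ≤ (ignorant φ (shareKnown F K' r) ∪ F.patch z).card := by
        rw [Finset.card_union_of_disjoint patch_senses]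
        gcongr
    _ ≤ (ignorant φ K).card := Finset.card_le_card <|
        Finset.union_subset (anti r) fun v hv => mem_ignorant.2 (hignorant v hv)

/-- A lower bound for the number of nodes of a patch if there is more than one patch. -/
def Params.minPatch (p : Params) : ℕ := p.D / 2 + 1

theorem expect_weight_meta_le {F : Forest G p.D} (hG : G.Connected) (hF : F.IsBFS)
    (hroots : ∀ x y, F.depth x = some 0 → F.depth y = some 0 → G.dist x y ≤ p.D → x = y)
    (hdepth : ∀ v, (F.depth v).isSome) (hK : ∃ v, Senses φ (K v)) :
    𝔼 r, 𝔼 r', weight p.minPatch (ignorant φ (shareKnown F (passKnown F K r) r')).card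
      ≤ 7 / 8 * weight p.minPatch (ignorant φ K).card := by
  have le_self : ∀ r, weight p.minPatch (ignorant φ (passKnown F K r)).card
      ≤ weight p.minPatch (ignorant φ K).card := fun r =>
    weight_mono _ (Finset.card_le_card (ignorant_anti subset_passKnown))
  have nonneg := weight_nonneg p.minPatch (ignorant φ K).card
  by_cases all_patches : ∀ v, ∃ u ∈ F.patch v, Senses φ (K u)
  · refine Finset.expect_le Finset.univ_nonempty fun r _ => ?_
    have pass_all_patches : ∀ v, ∃ u ∈ F.patch v, Senses φ (passKnown F K r u) := fun v => by
      obtain ⟨u, hu, hs⟩ := all_patches v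
      exact ⟨u, hu, hs.mono (subset_passKnown u)⟩
    linarith [le_self r, expect_weight_shareKnown_le_half (d := p.minPatch) hdepth
      pass_all_patches]
  · push Not at all_patches
    obtain ⟨y, hy⟩ := all_patches
    obtain ⟨x, hx⟩ := hK
    obtain ⟨a, z, haz, ⟨u, hu, hs⟩, hz⟩ :=
      exists_adj_boundary hG {v | ∃ u ∈ F.patch v, Senses φ (K u)}
        ⟨x, Forest.mem_patch_self (hdepth x), hx⟩ fun ⟨u, hu, hs⟩ => hy u hu hs
    have patch_z_ignorant : ∀ u ∈ F.patch z, ¬ Senses φ (K u) := fun u hu hs => hz ⟨u, hu, hs⟩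
    have roots_ne : F.root a ≠ F.root z := fun h => by
      refine patch_z_ignorant u ?_ hs
      rwa [Forest.patch, ← h]
    have patch_z_large : p.minPatch ≤ (F.patch z).card := by
      have depth_root := fun v => Forest.depth_root (hdepth v)
      have large := hF.half_lt_card_patch hG hroots (depth_root z) (depth_root a) roots_ne
      rwa [F.patch_root (hdepth z)] at large
    have bound := expect_le_of_expect_ite_eq_half
      (expect_randomSum_eq_zero (K := K) (A := F.patch a) hu hs)
      (X := fun r => 𝔼 r', weight p.minPatch
        (ignorant φ (shareKnown F (passKnown F K r) r')).card)
      (fun r => Finset.expect_le Finset.univ_nonempty fun r' _ => (weight_mono _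
        (Finset.card_le_card (ignorant_anti subset_shareKnown))).trans (le_self r))
      fun r hr => expect_weight_shareKnown_le_of_patch (Nat.succ_pos _) patch_z_large (hdepth z)
        subset_passKnown patch_z_ignorant ⟨_, patchSum_mem_passKnown haz.symm (hdepth a), hr⟩
    linarith

theorem expect_weight_singleKnown_le (hG : G.Connected) (hK : ∃ v, Senses φ (K v)) :
    𝔼 r, weight 1 (ignorant φ (singleKnown K r G)).card
      ≤ 3 / 4 * weight 1 (ignorant φ K).card := by
  have anti : ∀ r, ignorant φ (singleKnown K r G) ⊆ ignorant φ K := fun r =>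
    ignorant_anti subset_singleKnown
  by_cases all_sense : ∀ v, Senses φ (K v)
  · have ignorant_eq : ignorant φ K = ∅ :=
      Finset.eq_empty_of_forall_notMem fun v hv => mem_ignorant.1 hv (all_sense v)
    simp only [ignorant_eq, Finset.subset_empty] at anti
    simp [anti, ignorant_eq, weight_zero]
  · push Not at all_sense
    obtain ⟨y, hy⟩ := all_sense
    obtain ⟨x, hx⟩ := hK
    obtain ⟨a, z, haz, ha, hz⟩ := exists_adj_boundary hG {v | Senses φ (K v)} hx hy
    refine expect_weight_le_of_drop (expect_randomSum_eq_zero (Finset.mem_singleton_self a) ha)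
      one_pos (fun r => Finset.card_le_card (anti r)) fun r hr => ?_
    refine Finset.card_lt_card <|
      (Finset.ssubset_iff_of_subset (anti r)).2 ⟨z, mem_ignorant.2 hz, ?_⟩
    rw [mem_ignorant, not_not]
    exact ⟨_, randomSum_mem_singleKnown haz.symm, hr⟩

end PatchSharing

/-! ### The dynamics of a meta round -/

namespace PatchSharing

variable {p : Params} {V : Type*}

/-- The local computations of all nodes at the beginning of round `s` of a meta round. -/
def prep (s : ℕ) (r : V → Seed p) (σ : V → State p) : V → State p :=
  fun v => prepare p s (r v) (σ v)

variable [Fintype V]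

open Classical in
/-- The effect of one round of communication on all (prepared) nodes. -/
noncomputable def comm (G : SimpleGraph V) (ph : Phase) (σ : V → State p) : V → State p :=
  fun v => update (σ v) ((Finset.univ.filter fun u => G.Adj v u).val.map
    fun u => message (σ u) ph) ph

/-- The effect of `j` rounds of communication without local computations in between. -/
noncomputable def commSeq (G : SimpleGraph V) (ph : ℕ → Phase) (σ : V → State p) :
    ℕ → V → State p
  | 0 => σ
  | j + 1 => comm G (ph j) (commSeq G ph σ j)

theorem commSeq_succ' (G : SimpleGraph V) (ph : ℕ → Phase) (σ : V → State p) (j : ℕ) :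
    commSeq G ph σ (j + 1) = commSeq G (fun i => ph (i + 1)) (comm G (ph 0) σ) j := by
  induction j with
  | zero => rfl
  | succ j ih => rw [commSeq, ih, commSeq]

/-- The expectation of `F` after the rounds `s, …, s + j - 1` of a meta round with graph `G`. -/
noncomputable def expectRounds [DecidableEq V] (G : SimpleGraph V) :
    ℕ → ℕ → ((V → State p) → ℝ) → (V → State p) → ℝ
  | _, 0, F, σ => F σ
  | s, j + 1, F, σ =>
      𝔼 r : V → Seed p, expectRounds G (s + 1) j F (comm G (phase p s) (prep s r σ))

section ExpectRounds

variable [DecidableEq V] (G : SimpleGraph V)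

theorem expectRounds_add (s i j : ℕ) (F : (V → State p) → ℝ) (σ : V → State p) :
    expectRounds G s (i + j) F σ = expectRounds G s i (expectRounds G (s + i) j F) σ := by
  induction i generalizing s σ with
  | zero => simp [expectRounds]
  | succ i ih =>
    rw [Nat.succ_add, expectRounds, expectRounds]
    refine Finset.expect_congr rfl fun r _ => ?_
    rw [ih, Nat.succ_add_eq_add_succ]

theorem expectRounds_of_quiet {s j : ℕ} {ph : ℕ → Phase}
    (hph : ∀ i < j, phase p (s + i) = ph i)
    (hquiet : ∀ i < j, ∀ r (st : State p), prepare p (s + i) r st = st)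
    (F : (V → State p) → ℝ) (σ : V → State p) :
    expectRounds G s j F σ = F (commSeq G ph σ j) := by
  induction j generalizing s ph σ with
  | zero => rfl
  | succ j ih =>
    have prep_eq : ∀ r : V → Seed p, prep s r σ = σ := fun r => funext fun v =>
      hquiet 0 (Nat.succ_pos _) (r v) (σ v)
    simp only [expectRounds, prep_eq]
    rw [Fintype.expect_const, ih (ph := fun i => ph (i + 1)), commSeq_succ',
      ← hph 0 (Nat.succ_pos _)]
    · rfl
    · exact fun i hi => by rw [Nat.succ_add_eq_add_succ, hph _ (Nat.succ_lt_succ hi)]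
    · exact fun i hi => by
        rw [Nat.succ_add_eq_add_succ]
        exact hquiet _ (Nat.succ_lt_succ hi)

theorem expectRounds_of_stage {s j : ℕ} {ph : ℕ → Phase} (hj : 0 < j)
    (hph : ∀ i < j, phase p (s + i) = ph i)
    (hquiet : ∀ i, 0 < i → i < j → ∀ r (st : State p), prepare p (s + i) r st = st)
    (F : (V → State p) → ℝ) (σ : V → State p) :
    expectRounds G s j F σ = 𝔼 r : V → Seed p, F (commSeq G ph (prep s r σ) j) := by
  obtain ⟨j, rfl⟩ := Nat.exists_eq_add_one.2 hj
  refine Finset.expect_congr rfl fun r _ => ?_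
  rw [expectRounds_of_quiet G (ph := fun i => ph (i + 1)), commSeq_succ',
    ← hph 0 (Nat.succ_pos _)]
  · rfl
  · exact fun i hi => by rw [Nat.succ_add_eq_add_succ, hph _ (Nat.succ_lt_succ hi)]
  · exact fun i hi => by
      rw [Nat.succ_add_eq_add_succ]
      exact hquiet _ (Nat.succ_pos _) (Nat.succ_lt_succ hi)

theorem expectRounds_of_stage_det {s j : ℕ} {ph : ℕ → Phase} (hj : 0 < j)
    (hph : ∀ i < j, phase p (s + i) = ph i)
    (hquiet : ∀ i, 0 < i → i < j → ∀ r (st : State p), prepare p (s + i) r st = st)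
    {f : State p → State p} (hf : ∀ r st, prepare p s r st = f st)
    (F : (V → State p) → ℝ) (σ : V → State p) :
    expectRounds G s j F σ = F (commSeq G ph (fun v => f (σ v)) j) := by
  have prep_eq : ∀ r : V → Seed p, prep s r σ = fun v => f (σ v) := fun r => funext fun v =>
    hf (r v) (σ v)
  simp only [expectRounds_of_stage G hj hph hquiet, prep_eq, Fintype.expect_const]

end ExpectRounds

section States

variable {n : ℕ} (uid : Fin n → Fin p.U) (inp : Fin n → TokenTable p.k p.k)
  (adv : (patchSharing p).Adversary n)

/-- The states of all nodes after the rounds recorded in a history. -/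
noncomputable def states (h : (patchSharing p).History n) : Fin n → State p :=
  (patchSharing p).run uid inp adv h

theorem states_cons (s : Fin n → (patchSharing p).Seed) (h : (patchSharing p).History n) :
    states uid inp adv (s :: h) = comm (adv h) (phase p (h.length % p.T))
      (prep (h.length % p.T) s (states uid inp adv h)) :=
  rfl

variable {adv}

theorem expectNext_pow_eq_expectRounds (hadv : adv.Stable p.T) (F : (Fin n → State p) → ℝ)
    (j : ℕ) (h : (patchSharing p).History n) (hj : h.length % p.T + j ≤ p.T) :
    ((patchSharing p).expectNext n ^ j) (fun h => F (states uid inp adv h)) h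
      = expectRounds (adv h) (h.length % p.T) j F (states uid inp adv h) := by
  induction j generalizing h with
  | zero => rfl
  | succ j ih =>
    rw [pow_succ']
    refine Finset.expect_congr rfl fun s _ => ?_
    rw [← states_cons]
    rcases Nat.eq_zero_or_pos j with rfl | hj_pos
    · rfl
    · have length_mod : (h.length + 1) % p.T = h.length % p.T + 1 := by
        rw [Nat.add_mod, Nat.mod_eq_of_lt (show 1 < p.T by omega), Nat.mod_eq_of_lt (by omega)]
      have adv_eq : adv (s :: h) = adv h := by
        refine hadv h s fun hdvd => ?_
        rw [Nat.dvd_iff_mod_eq_zero, length_mod] at hdvd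
        omega
      rw [ih (s :: h) (by rw [List.length_cons, length_mod]; omega), List.length_cons, length_mod,
        adv_eq]

end States

/-! ### The independent set computation -/

variable {G : SimpleGraph V}

open Classical in
theorem comm_prio (σ : V → State p) : comm G .prio σ = fun v => { σ v with
    best := (σ v).best ⊔ (Finset.univ.filter fun u => G.Adj v u).sup fun u => (σ u).best } := by
  funext v
  simp only [comm, update, message, Multiset.map_map]
  rfl

open Classical in
theorem comm_deactivate (σ : V → State p) :
    comm G .deactivate σ = fun v => if ∃ u, G.Adj v u ∧ (σ u).flag = true then
      { σ v with flag := true, active := false } else σ v := by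
  funext v
  have mem_messages : (Msg.deactivate ∈ (Finset.univ.filter fun u => G.Adj v u).val.map
      fun u => message (σ u) .deactivate) ↔ ∃ u, G.Adj v u ∧ (σ u).flag = true := by
    simp only [Multiset.mem_map, Finset.mem_val, Finset.mem_filter, Finset.mem_univ, true_and,
      message]
    refine exists_congr fun u => and_congr_right fun _ => ?_
    cases (σ u).flag <;> simp
  simp only [comm, update, mem_messages]

theorem commSeq_prio (hG : G.Connected) (σ : V → State p) (j : ℕ) :
    commSeq G (fun _ => .prio) σ j = fun v => { σ v with
      best := (distBall G j v).sup fun u => (σ u).best } := by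
  classical
  induction j with
  | zero => simp only [commSeq, distBall_zero hG, Finset.sup_singleton]
  | succ j ih =>
    simp only [commSeq, ih, comm_prio, distBall_succ hG, Finset.sup_union, Finset.sup_biUnion]

open Classical in
theorem commSeq_deactivate (hG : G.Connected) {σ : V → State p}
    (hσ : ∀ v, (σ v).flag = true → (σ v).active = false) (j : ℕ) :
    commSeq G (fun _ => .deactivate) σ j = fun v => { σ v with
      flag := decide (∃ u ∈ distBall G j v, (σ u).flag = true)
      active := (σ v).active && !decide (∃ u ∈ distBall G j v, (σ u).flag = true) } := by
  induction j with
  | zero =>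
    funext v
    have active_eq : ((σ v).active && !(σ v).flag) = (σ v).active := by
      cases h : (σ v).flag
      · simp
      · simp [hσ v h]
    simp [commSeq, distBall_zero hG, active_eq]
  | succ j ih =>
    funext v
    have heard_iff : (∃ w ∈ distBall G (j + 1) v, (σ w).flag = true) ↔
        (∃ u, G.Adj v u ∧ ∃ w ∈ distBall G j u, (σ w).flag = true) ∨
          ∃ w ∈ distBall G j v, (σ w).flag = true := by
      simp only [distBall_succ hG, Finset.mem_union, Finset.mem_biUnion, Finset.mem_filter,
        Finset.mem_univ, true_and]
      grind
    simp only [commSeq, ih, comm_deactivate, decide_eq_true_eq, heard_iff]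
    split_ifs with h
    · simp [h]
    · simp [h]

/-- One iteration of the independent set computation. -/
noncomputable def luby (G : SimpleGraph V) (σ : V → State p) (r : V → Seed p) : V → State p :=
  commSeq G (fun _ => .deactivate) (fun v =>
    (commSeq G (fun _ => .prio) (fun v => (σ v).draw (r v).1) p.D v).decideLeader) p.D

/-- The priority that a node draws. -/
def drawn (σ : V → State p) (r : V → Seed p) (v : V) : Prio p := ((σ v).draw (r v).1).mine

/-- A node becomes a leader if it is active and its priority is the highest within distance `D`. -/
def NewLeader (G : SimpleGraph V) (σ : V → State p) (r : V → Seed p) (v : V) : Prop :=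
  (σ v).active = true ∧ ∀ u ∈ distBall G p.D v, drawn σ r u ≤ drawn σ r v

open Classical in
theorem decideLeader_commSeq_prio (hG : G.Connected) (σ : V → State p) (r : V → Seed p) (v : V) :
    (commSeq G (fun _ => .prio) (fun v => (σ v).draw (r v).1) p.D v).decideLeader = { σ v with
      mine := drawn σ r v
      best := (distBall G p.D v).sup (drawn σ r)
      flag := decide (NewLeader G σ r v)
      leader := (σ v).leader || decide (NewLeader G σ r v)
      active := (σ v).active && !decide (NewLeader G σ r v) } := by
  have sup_eq_iff : (distBall G p.D v).sup (drawn σ r) = drawn σ r v ↔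
      ∀ u ∈ distBall G p.D v, drawn σ r u ≤ drawn σ r v := by
    rw [← Finset.sup_le_iff, le_antisymm_iff, and_iff_left]
    exact Finset.le_sup (by simp [mem_distBall])
  have condition_iff : (σ v).active = true ∧ (distBall G p.D v).sup (drawn σ r) = drawn σ r v ↔
      NewLeader G σ r v := and_congr_right fun _ => sup_eq_iff
  rw [commSeq_prio hG]
  change (if (σ v).active = true ∧ (distBall G p.D v).sup (drawn σ r) = drawn σ r v then _
    else _) = _
  by_cases h : NewLeader G σ r v
  · rw [if_pos (condition_iff.2 h)]
    simp only [h, decide_true, Bool.or_true, Bool.not_true, Bool.and_false]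
    rfl
  · rw [if_neg (mt condition_iff.1 h)]
    simp only [h, decide_false, Bool.or_false, Bool.not_false, Bool.and_true]
    rfl

open Classical in
theorem luby_eq (hG : G.Connected) (σ : V → State p) (r : V → Seed p) :
    luby G σ r = fun v => { σ v with
      mine := drawn σ r v
      best := (distBall G p.D v).sup (drawn σ r)
      flag := decide (∃ u ∈ distBall G p.D v, NewLeader G σ r u)
      leader := (σ v).leader || decide (NewLeader G σ r v)
      active := (σ v).active && !decide (∃ u ∈ distBall G p.D v, NewLeader G σ r u) } := by
  simp only [luby, decideLeader_commSeq_prio hG]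
  rw [commSeq_deactivate hG (by simp +contextual)]
  funext v
  have self_mem : v ∈ distBall G p.D v := by simp [mem_distBall]
  by_cases h : NewLeader G σ r v
  · have near : ∃ u ∈ distBall G p.D v, NewLeader G σ r u := ⟨v, self_mem, h⟩
    simp [h, near]
  · simp [h]

end PatchSharing

/-! ### Growing the trees -/

namespace PatchSharing

variable {p : Params} {V : Type*} {G : SimpleGraph V} {D : ℕ}

/-- The identifier of the parent of a node that has one. -/
def parentId (F : Forest G D) (uid : V → Fin p.U) (v : V) : Option (Fin p.U) :=
  match F.depth v with
  | some (_ + 1) => some (uid (F.parent v))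
  | _ => none

/-- The states of the nodes, with their positions in the trees replaced by those in `F`. -/
def writeForest (F : Forest G D) (σ : V → State p) : V → State p := fun v =>
  { σ v with depth := F.depth v, parent := parentId F (fun u => (σ u).uid) v }

/-- The nodes know their positions in the forest `F`, whose roots are the leaders. -/
structure Encodes (F : Forest G D) (σ : V → State p) : Prop where
  uid_injective : Function.Injective fun v => (σ v).uid
  leader_iff (v : V) : (σ v).leader = true ↔ F.depth v = some 0
  depth_eq (v : V) : (σ v).depth = F.depth v
  parent_eq (v : V) : (σ v).parent = parentId F (fun u => (σ u).uid) v

theorem encodes_writeForest {F : Forest G D} {σ : V → State p}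
    (huid : Function.Injective fun v => (σ v).uid)
    (hroot : ∀ v, F.depth v = some 0 ↔ (σ v).leader = true) : Encodes F (writeForest F σ) where
  uid_injective := huid
  leader_iff v := (hroot v).symm
  depth_eq _ := rfl
  parent_eq _ := rfl

variable [Fintype V]

open Classical in
theorem mem_treeSenders (σ : V → State p) (j : ℕ) (v : V) (x : Fin p.U) :
    x ∈ (((Finset.univ.filter fun u => G.Adj v u).val.map
        fun u => message (σ u) (.tree j)).filterMap Msg.getTree).toFinset ↔
      ∃ u, (G.Adj v u ∧ (σ u).depth = some j) ∧ (σ u).uid = x := by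
  simp only [Multiset.mem_toFinset, Multiset.mem_filterMap, Multiset.mem_map, Finset.mem_val,
    Finset.mem_filter, Finset.mem_univ, true_and, message, exists_exists_and_eq_and, and_assoc]
  refine exists_congr fun u => and_congr_right fun _ => ?_
  split_ifs with h <;> simp [h, Msg.getTree]

theorem comm_tree_of_mem_frontier {j : ℕ} {F : Forest G j} (σ : V → State p) {v : V}
    (hv : v ∈ F.frontier) : ∃ u, (G.Adj v u ∧ F.depth u = some j) ∧
      comm G (.tree j) (writeForest F σ) v
        = { σ v with depth := some (j + 1), parent := some (σ u).uid } := by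
  classical
  obtain ⟨depth_none, u, hu⟩ := hv
  have nonempty : (((Finset.univ.filter fun u => G.Adj v u).val.map fun u =>
      message (writeForest F σ u) (.tree j)).filterMap Msg.getTree).toFinset.Nonempty :=
    ⟨_, (mem_treeSenders _ _ _ _).2 ⟨u, hu, rfl⟩⟩
  obtain ⟨q, hq, hq_uid⟩ := (mem_treeSenders _ _ _ _).1 (Finset.min'_mem _ nonempty)
  refine ⟨q, hq, ?_⟩
  simp only [comm, update]
  rw [dif_pos ⟨depth_none, nonempty⟩, ← hq_uid]
  rfl

theorem comm_tree_of_notMem_frontier {j : ℕ} {F : Forest G j} (σ : V → State p) {v : V}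
    (hv : v ∉ F.frontier) :
    comm G (.tree j) (writeForest F σ) v = writeForest F σ v := by
  classical
  simp only [comm, update]
  refine dif_neg fun h => hv ⟨h.1, ?_⟩
  obtain ⟨x, hx⟩ := h.2
  obtain ⟨u, hu, -⟩ := (mem_treeSenders _ _ _ _).1 hx
  exact ⟨u, hu⟩

theorem exists_comm_tree_eq_grow {j : ℕ} (F : Forest G j) (σ : V → State p) :
    ∃ q hq, comm G (.tree j) (writeForest F σ) = writeForest (F.grow q hq) σ := by
  classical
  choose! q hq hcomm using fun v hv => comm_tree_of_mem_frontier (F := F) σ (v := v) hv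
  refine ⟨q, hq, funext fun v => ?_⟩
  by_cases hv : v ∈ F.frontier
  · rw [hcomm v hv]
    simp [writeForest, parentId, Forest.grow, hv]
  · rw [comm_tree_of_notMem_frontier σ hv]
    simp [writeForest, parentId, Forest.grow, hv]

theorem exists_forest_commSeq_tree (hG : G.Connected) (σ : V → State p) (j : ℕ) :
    ∃ F : Forest G j, F.IsBFS ∧ (∀ v, F.depth v = some 0 ↔ (σ v).leader = true) ∧
      commSeq G .tree (fun v => (σ v).plant) j = writeForest F σ := by
  classical
  induction j with
  | zero =>
    refine ⟨.ofRoots G {v | (σ v).leader = true}, Forest.isBFS_ofRoots hG _, fun v => ?_,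
      funext fun v => ?_⟩
    · simp [Forest.ofRoots]
    · cases h : (σ v).leader <;>
        simp [commSeq, State.plant, writeForest, parentId, Forest.ofRoots, h]
  | succ j ih =>
    obtain ⟨F, hF, hroot, heq⟩ := ih
    obtain ⟨q, hq, hgrow⟩ := exists_comm_tree_eq_grow F σ
    refine ⟨F.grow q hq, hF.grow hG q hq, fun v => ?_, by rw [commSeq, heq, hgrow]⟩
    rw [← hroot]
    by_cases hv : v ∈ F.frontier
    · simp [Forest.grow, hv, hv.1]
    · simp [Forest.grow, hv]

end PatchSharing

/-! ### Pipelined transmissions -/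

namespace PatchSharing

variable {p : Params} {V : Type*} [Fintype V] {G : SimpleGraph V} {σ : V → State p}

section Trees

variable {F : Forest G p.D}

theorem unpiece_piece (i : ℕ) (x : Vec p) (q : Fin (p.k + p.k)) :
    unpiece i (piece i x) q = if (q : ℕ) / p.w = i then x q else 0 := by
  rw [unpiece]
  split_ifs with h
  · have index_eq : i * p.w + (q : ℕ) % p.w = q := by
      rw [← h, mul_comm]
      exact Nat.div_add_mod _ _
    simp only [piece, index_eq, q.2, dif_pos]
  · rfl

theorem getVec_vec_piece (i : ℕ) (u u' : Fin p.U) (x : Vec p) (q : Fin (p.k + p.k)) :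
    Msg.getVec i u (.vec u' (piece i x)) q = if u' = u ∧ (q : ℕ) / p.w = i then x q else 0 := by
  by_cases h : u' = u
  · simp [Msg.getVec, h, unpiece_piece]
  · simp [Msg.getVec, h]

theorem div_w_lt (hS : 0 < p.S) (q : Fin (p.k + p.k)) : (q : ℕ) / p.w < p.S := by
  refine (Nat.div_lt_iff_lt_mul (Nat.succ_pos _)).2 (q.2.trans ?_)
  rw [← two_mul]
  exact Nat.lt_mul_div_succ (2 * p.k) hS

open Classical in
theorem sum_getVec_apply (G : SimpleGraph V) (σ : V → State p) (ph : Phase) (i : ℕ) (x : Fin p.U)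
    (v : V) (q : Fin (p.k + p.k)) :
    (((Finset.univ.filter fun u => G.Adj v u).val.map fun u => message (σ u) ph).map
        (Msg.getVec i x)).sum q
      = ∑ u ∈ Finset.univ.filter (fun u => G.Adj v u), Msg.getVec i x (message (σ u) ph) q := by
  rw [Multiset.map_map]
  exact Finset.sum_apply q _ _

open Classical in
theorem sum_getVec_of_adj (huid : Function.Injective fun v => (σ v).uid) {ph : Phase}
    (hph : ∀ w x c, message (σ w) ph = .vec x c → x = (σ w).uid) {u v : V} (hvu : G.Adj v u)
    (i : ℕ) (q : Fin (p.k + p.k)) :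
    (((Finset.univ.filter fun u => G.Adj v u).val.map fun u => message (σ u) ph).map
        (Msg.getVec i (σ u).uid)).sum q = Msg.getVec i (σ u).uid (message (σ u) ph) q := by
  rw [sum_getVec_apply]
  refine Finset.sum_eq_single_of_mem u (by simpa using hvu) fun w _ hne => ?_
  cases hm : message (σ w) ph with
  | vec x c =>
    rw [Msg.getVec, if_neg fun h => hne (huid ((hph w x c hm).symm.trans h)), Pi.zero_apply]
  | _ => rfl

/-! #### Up the trees -/

open Classical in
theorem getVec_message_up (hσ : Encodes F σ) (hS : 0 < p.S) {v : V} {δ : ℕ}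
    (hv : F.depth v = some δ) (j : ℕ) (u : V) (q : Fin (p.k + p.k)) :
    Msg.getVec (j + (δ + 1) - p.D) (σ v).uid (message (σ u) (.up j)) q
      = if u ∈ F.children δ v ∧ (q : ℕ) / p.w + p.D = j + (δ + 1) then (σ u).acc q else 0 := by
  rcases hu : F.depth u with _ | _ | ε
  · simp [message, hσ.depth_eq, hu, Msg.getVec, Forest.mem_children]
  · simp [message, hσ.depth_eq, hσ.parent_eq, parentId, hu, Msg.getVec, Forest.mem_children]
  · have piece_lt := div_w_lt hS q
    simp only [message, hσ.depth_eq, hσ.parent_eq, parentId, hu, Forest.mem_children]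
    by_cases hpar : F.parent u = v
    · obtain rfl : δ = ε := by simpa [hpar, hv] using F.depth_parent hu
      by_cases hsend : p.D ≤ j + (δ + 1) ∧ j + (δ + 1) - p.D < p.S
      · rw [if_pos hsend, getVec_vec_piece]
        exact if_congr (by simp only [hpar, true_and]; omega) rfl rfl
      · generalize (q : ℕ) / p.w = i at piece_lt ⊢
        rw [if_neg hsend, if_neg (by omega)]
        rfl
    · have uid_ne : (σ (F.parent u)).uid ≠ (σ v).uid := fun h => hpar (hσ.uid_injective h)
      simp only [hpar, and_false, false_and, if_false]
      split_ifs
      · rw [Msg.getVec, if_neg uid_ne, Pi.zero_apply]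
      · rfl

theorem comm_up_of_depth_eq_some (hσ : Encodes F σ) (hS : 0 < p.S) (j : ℕ) {v : V} {δ : ℕ}
    (hv : F.depth v = some δ) : comm G (.up j) σ v = { σ v with
      acc := fun q => (σ v).acc q + if (q : ℕ) / p.w + p.D = j + (δ + 1) then
        ∑ u ∈ F.children δ v, (σ u).acc q else 0 } := by
  classical
  have children_subset : F.children δ v ⊆ Finset.univ.filter fun u => G.Adj v u := fun u hu => by
    obtain ⟨hdepth, rfl⟩ := Forest.mem_children.1 hu
    simpa using (F.adj_parent hdepth).symm
  simp only [comm, update, hσ.depth_eq, hv]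
  congr 1
  funext q
  rw [Pi.add_apply, sum_getVec_apply]
  simp only [getVec_message_up hσ hS hv]
  rw [← Finset.sum_subset children_subset fun u _ hu => if_neg fun h => hu h.1]
  split_ifs with h
  · simp +contextual [h]
  · simp [h]

theorem comm_up_of_depth_eq_none (hσ : Encodes F σ) (j : ℕ) {v : V} (hv : F.depth v = none) :
    comm G (.up j) σ v = σ v := by
  simp only [comm, update, hσ.depth_eq, hv]

/-- What the nodes have accumulated after `j` rounds of summing up the vectors `c` in the trees:
the pieces that have already passed are summed over the subtree, the others are still those of the
node itself. -/
noncomputable def accAfter (F : Forest G p.D) (c : V → Vec p) (j : ℕ) (v : V) : Vec p := fun q =>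
  match F.depth v with
  | some δ => if (q : ℕ) / p.w + p.D ≤ j + δ then ∑ u ∈ F.subtree δ v, c u q else c v q
  | none => c v q

theorem accAfter_zero (F : Forest G p.D) (c : V → Vec p) (v : V) : accAfter F c 0 v = c v := by
  funext q
  rcases hv : F.depth v with _ | δ
  · simp only [accAfter, hv]
  · simp only [accAfter, hv]
    split_ifs with h
    · have hδ : p.D ≤ δ := by simpa using (Nat.le_add_left _ _).trans h
      rw [Forest.sum_subtree (fun u => c u q) hv, Finset.sum_eq_zero, add_zero]
      intro u hu
      have := F.depth_le (Forest.mem_children.1 hu).1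
      omega
    · rfl

theorem accAfter_succ (c : V → Vec p) (j : ℕ) {v : V} {δ : ℕ} (hv : F.depth v = some δ)
    (q : Fin (p.k + p.k)) :
    accAfter F c (j + 1) v q = accAfter F c j v q
      + if (q : ℕ) / p.w + p.D = j + (δ + 1) then ∑ u ∈ F.children δ v, accAfter F c j u q
        else 0 := by
  simp only [accAfter, hv]
  rcases lt_trichotomy ((q : ℕ) / p.w + p.D) (j + (δ + 1)) with hlt | heq | hgt
  · rw [if_pos (by omega), if_pos (by omega), if_neg (by omega), add_zero]
  · rw [if_pos (by omega), if_neg (by omega), if_pos heq, Forest.sum_subtree (fun u => c u q) hv]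
    congr 1
    refine Finset.sum_congr rfl fun u hu => ?_
    simp only [(Forest.mem_children.1 hu).1, if_pos heq.le]
  · rw [if_neg (by omega), if_neg (by omega), if_neg (by omega), add_zero]

theorem commSeq_up (hσ : Encodes F σ) (hS : 0 < p.S) (j : ℕ) :
    commSeq G .up σ j = fun v => { σ v with acc := accAfter F (fun u => (σ u).acc) j v } := by
  induction j with
  | zero => simp only [commSeq, accAfter_zero]
  | succ j ih =>
    have hσ' : Encodes F (commSeq G .up σ j) := by
      rw [ih]
      exact ⟨hσ.1, hσ.2, hσ.3, hσ.4⟩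
    rw [commSeq]
    funext v
    rcases hv : F.depth v with _ | δ
    · rw [comm_up_of_depth_eq_none hσ' j hv, ih]
      refine congrArg (fun a => { σ v with acc := a }) (funext fun q => ?_)
      simp only [accAfter, hv]
    · rw [comm_up_of_depth_eq_some hσ' hS j hv, ih]
      simp only [← accAfter_succ _ j hv]

theorem accAfter_E_root (hS : 0 < p.S) (hE : p.E = p.S + p.D) (c : V → Vec p) {x : V}
    (hx : F.depth x = some 0) : accAfter F c p.E x = ∑ u ∈ F.patch x, c u := by
  funext q
  have := div_w_lt hS q
  simp only [accAfter, hx]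
  rw [if_pos (by omega), Forest.patch, Forest.root, Forest.ancestor_self hx, Finset.sum_apply]

/-! #### Down the trees -/

section SumAfter

omit [Fintype V]

/-- What the nodes have assembled after `j` rounds of distributing the vectors `t` of the roots in
the trees. -/
noncomputable def sumAfter (F : Forest G p.D) (t : V → Vec p) (j : ℕ) (v : V) : Vec p := fun q =>
  match F.depth v with
  | some δ => if δ = 0 ∨ (q : ℕ) / p.w + δ ≤ j then t (F.root v) q else 0
  | none => 0

theorem sumAfter_succ_of_root (t : V → Vec p) (j : ℕ) {v : V}
    (hv : ∀ δ, F.depth v ≠ some (δ + 1)) : sumAfter F t (j + 1) v = sumAfter F t j v := by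
  funext q
  rcases hδ : F.depth v with _ | _ | δ
  · simp only [sumAfter, hδ]
  · simp only [sumAfter, hδ, true_or]
  · exact absurd hδ (hv δ)

theorem sumAfter_succ_of_succ (t : V → Vec p) (j : ℕ) {v : V} {δ : ℕ}
    (hv : F.depth v = some (δ + 1)) (q : Fin (p.k + p.k)) :
    sumAfter F t (j + 1) v q = sumAfter F t j v q
      + if (q : ℕ) / p.w + (δ + 1) = j + 1 then sumAfter F t j (F.parent v) q else 0 := by
  simp only [sumAfter, hv, F.depth_parent hv, Forest.root,
    Forest.ancestor_parent hv (Nat.zero_le δ)]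
  grind

theorem sumAfter_E (hS : 0 < p.S) (hE : p.E = p.S + p.D) (t : V → Vec p) {v : V}
    (hv : (F.depth v).isSome) : sumAfter F t p.E v = t (F.root v) := by
  funext q
  obtain ⟨δ, hδ⟩ := Option.isSome_iff_exists.1 hv
  have depth_le := F.depth_le hδ
  have piece_lt := div_w_lt hS q
  simp only [sumAfter, hδ]
  exact if_pos (Or.inr (by omega))

end SumAfter

theorem message_down_eq_vec {j : ℕ} {st : State p} {x : Fin p.U} {c : Piece p}
    (h : message st (.down j) = .vec x c) : x = st.uid := by
  simp only [message] at h
  split at h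
  · split_ifs at h
    exact (Msg.vec.inj h).1.symm
  · cases h

theorem comm_down_sum_of_root (hσ : Encodes F σ) (j : ℕ) {v : V}
    (hv : ∀ δ, F.depth v ≠ some (δ + 1)) : (comm G (.down j) σ v).sum = (σ v).sum := by
  rcases hδ : F.depth v with _ | _ | δ
  · simp only [comm, update, hσ.depth_eq, hδ]
  · simp only [comm, update, hσ.depth_eq, hσ.parent_eq, parentId, hδ]
  · exact absurd hδ (hv δ)

theorem comm_down_sum_of_succ (hσ : Encodes F σ) (hS : 0 < p.S) (j : ℕ) {v : V} {δ : ℕ}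
    (hv : F.depth v = some (δ + 1)) (q : Fin (p.k + p.k)) :
    (comm G (.down j) σ v).sum q = (σ v).sum q
      + if (q : ℕ) / p.w + (δ + 1) = j + 1 then (σ (F.parent v)).sum q else 0 := by
  have piece_lt := div_w_lt hS q
  simp only [comm, update, hσ.depth_eq, hσ.parent_eq, parentId, hv, Pi.add_apply,
    Nat.add_sub_add_right]
  rw [sum_getVec_of_adj hσ.uid_injective (fun _ _ _ => message_down_eq_vec) (F.adj_parent hv)]
  simp only [message, hσ.depth_eq, F.depth_parent hv]
  congr 1
  by_cases hsend : δ ≤ j ∧ j - δ < p.S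
  · rw [if_pos hsend, getVec_vec_piece]
    exact if_congr (by simp only [true_and]; omega) rfl rfl
  · generalize (q : ℕ) / p.w = i at piece_lt ⊢
    rw [if_neg hsend, if_neg (by omega)]
    rfl

open Classical in
theorem comm_down (hσ : Encodes F σ) (hS : 0 < p.S) {t : V → Vec p} {j : ℕ}
    (ht : ∀ v, (σ v).sum = sumAfter F t j v) : comm G (.down j) σ = fun v => { σ v with
      sum := sumAfter F t (j + 1) v
      known := if j + 1 = p.E ∧ (F.depth v).isSome then
        insert (sumAfter F t (j + 1) v) (σ v).known else (σ v).known } := by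
  funext v
  have sum_eq : (comm G (.down j) σ v).sum = sumAfter F t (j + 1) v := by
    by_cases hv : ∃ δ, F.depth v = some (δ + 1)
    · obtain ⟨δ, hδ⟩ := hv
      funext q
      rw [comm_down_sum_of_succ hσ hS j hδ, sumAfter_succ_of_succ t j hδ, ht, ht]
    · have hroot := not_exists.1 hv
      rw [comm_down_sum_of_root hσ j hroot, sumAfter_succ_of_root t j hroot, ht]
  rw [← sum_eq, ← hσ.depth_eq]
  simp only [comm, update]

theorem commSeq_down_of_lt (hσ : Encodes F σ) (hS : 0 < p.S) {t : V → Vec p}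
    (ht : ∀ v, (σ v).sum = sumAfter F t 0 v) {j : ℕ} (hj : j < p.E) :
    commSeq G .down σ j = fun v => { σ v with sum := sumAfter F t j v } := by
  induction j with
  | zero => simp only [commSeq, ← ht]
  | succ j ih =>
    have hσ' : Encodes F fun v => { σ v with sum := sumAfter F t j v } :=
      ⟨hσ.1, hσ.2, hσ.3, hσ.4⟩
    rw [commSeq, ih (Nat.lt_of_succ_lt hj), comm_down hσ' hS fun _ => rfl]
    simp only [hj.ne, false_and, if_false]

open Classical in
theorem commSeq_down (hσ : Encodes F σ) (hS : 0 < p.S) (hE : p.E = p.S + p.D) {t : V → Vec p}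
    (ht : ∀ v, (σ v).sum = sumAfter F t 0 v) :
    commSeq G .down σ p.E = fun v => { σ v with
      sum := sumAfter F t p.E v
      known := if (F.depth v).isSome then insert (t (F.root v)) (σ v).known
        else (σ v).known } := by
  obtain ⟨j, hj⟩ := Nat.exists_eq_add_one.2 (show 0 < p.E by omega)
  have hσ' : Encodes F fun v => { σ v with sum := sumAfter F t j v } :=
    ⟨hσ.1, hσ.2, hσ.3, hσ.4⟩
  rw [hj, commSeq, commSeq_down_of_lt hσ hS ht (by omega), comm_down hσ' hS fun _ => rfl, ← hj]
  funext v
  by_cases hv : (F.depth v).isSome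
  · simp only [hv, and_self, if_true, sumAfter_E hS hE t hv]
  · simp [hv]

end Trees

/-! #### Passing to the neighbours -/

variable {D : ℕ} {F : Forest G D}

open Classical in
theorem sum_getVec_pass (hσ : Encodes F σ) (j : ℕ) (v : V) (x : Fin p.U) (q : Fin (p.k + p.k)) :
    (((Finset.univ.filter fun u => G.Adj v u).val.map fun u => message (σ u) (.pass j)).map
        (Msg.getVec j x)).sum q
      = if (q : ℕ) / p.w = j then
          ∑ u ∈ (passers F v).filter (fun u => (σ u).uid = x), (σ u).sum q else 0 := by
  rw [sum_getVec_apply, passers, Finset.filter_filter, Finset.sum_filter, Finset.sum_filter,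
    Finset.ite_sum_zero]
  refine Finset.sum_congr rfl fun u _ => ?_
  simp only [message, hσ.depth_eq]
  by_cases hu : (F.depth u).isSome
  · simp only [hu, if_true, getVec_vec_piece]
    grind
  · simp [hu, Msg.getVec]

open Classical in
theorem passIds_eq (hσ : Encodes F σ) (j : ℕ) (v : V) :
    (((Finset.univ.filter fun u => G.Adj v u).val.map
        fun u => message (σ u) (.pass j)).filterMap Msg.getId).toFinset
      = (passers F v).image fun u => (σ u).uid := by
  ext x
  simp only [Multiset.mem_toFinset, Multiset.mem_filterMap, Multiset.mem_map, Finset.mem_val,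
    Finset.mem_filter, Finset.mem_univ, true_and, message, exists_exists_and_eq_and, passers,
    Finset.mem_image, hσ.depth_eq, and_assoc]
  refine exists_congr fun u => and_congr_right fun _ => ?_
  split_ifs with h <;> simp [h, Msg.getId]

open Classical in
theorem comm_pass (hσ : Encodes F σ) (j : ℕ) (v : V) : comm G (.pass j) σ v =
    let inbox : Fin p.U → Vec p := fun x q => (σ v).inbox x q + if (q : ℕ) / p.w = j then
      ∑ u ∈ (passers F v).filter (fun u => (σ u).uid = x), (σ u).sum q else 0
    let heard := (σ v).heard ∪ (passers F v).image fun u => (σ u).uid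
    { σ v with
      inbox := inbox
      heard := heard
      known := if j + 1 = p.S then (σ v).known ∪ heard.image inbox else (σ v).known } := by
  have inbox_eq : (fun x => (σ v).inbox x + (((Finset.univ.filter fun u => G.Adj v u).val.map
      fun u => message (σ u) (.pass j)).map (Msg.getVec j x)).sum) = fun x q => (σ v).inbox x q
        + if (q : ℕ) / p.w = j then
          ∑ u ∈ (passers F v).filter (fun u => (σ u).uid = x), (σ u).sum q else 0 := by
    funext x q
    rw [Pi.add_apply, sum_getVec_pass hσ]
  simp only [comm, update, inbox_eq, passIds_eq hσ]

/-- What the nodes have assembled in their inboxes after `j` rounds of passing vectors `y`. -/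
noncomputable def inboxAfter (F : Forest G D) (uid : V → Fin p.U) (y : V → Vec p) (j : ℕ) (v : V)
    (x : Fin p.U) : Vec p := fun q =>
  if (q : ℕ) / p.w < j then ∑ u ∈ (passers F v).filter (fun u => uid u = x), y u q else 0

theorem inboxAfter_succ (uid : V → Fin p.U) (y : V → Vec p) (j : ℕ) (v : V) (x : Fin p.U)
    (q : Fin (p.k + p.k)) :
    inboxAfter F uid y (j + 1) v x q = inboxAfter F uid y j v x q + if (q : ℕ) / p.w = j then
      ∑ u ∈ (passers F v).filter (fun u => uid u = x), y u q else 0 := by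
  simp only [inboxAfter]
  grind

open Classical in
theorem image_inboxAfter_S (hS : 0 < p.S) {uid : V → Fin p.U} (huid : Function.Injective uid)
    (y : V → Vec p) (v : V) : ((passers F v).image uid).image (inboxAfter F uid y p.S v)
      = (passers F v).image y := by
  rw [Finset.image_image]
  refine Finset.image_congr fun u hu => funext fun q => ?_
  rw [Function.comp_apply, inboxAfter, if_pos (div_w_lt hS q)]
  refine Finset.sum_eq_single_of_mem u (by simpa using hu) fun w hw hne => ?_
  exact absurd (huid (Finset.mem_filter.1 hw).2) hne

theorem ite_empty_union_self {α : Type*} [DecidableEq α] (c : Prop) [Decidable c] (s : Finset α) :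
    (if c then ∅ else s) ∪ s = s := by
  split_ifs
  · exact Finset.empty_union s
  · exact Finset.union_self s

open Classical in
theorem commSeq_pass_of_lt (hσ : Encodes F σ) (hinbox : ∀ v, (σ v).inbox = 0)
    (hheard : ∀ v, (σ v).heard = ∅) {j : ℕ} (hj : j < p.S) :
    commSeq G .pass σ j = fun v => { σ v with
      inbox := inboxAfter F (fun u => (σ u).uid) (fun u => (σ u).sum) j v
      heard := if j = 0 then ∅ else (passers F v).image fun u => (σ u).uid } := by
  induction j with
  | zero =>
    funext v
    have inbox_zero : inboxAfter F (fun u => (σ u).uid) (fun u => (σ u).sum) 0 v = 0 := by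
      funext x q
      simp [inboxAfter]
    rw [commSeq, inbox_zero, if_pos rfl, ← hinbox v, ← hheard v]
  | succ j ih =>
    have hσ' : Encodes F (commSeq G .pass σ j) := by
      rw [ih (Nat.lt_of_succ_lt hj)]
      exact ⟨hσ.1, hσ.2, hσ.3, hσ.4⟩
    funext v
    rw [commSeq, comm_pass hσ', ih (Nat.lt_of_succ_lt hj)]
    simp only [hj.ne, if_false, Nat.succ_ne_zero, ite_empty_union_self, ← inboxAfter_succ]

open Classical in
theorem commSeq_pass (hσ : Encodes F σ) (hS : 0 < p.S) (hinbox : ∀ v, (σ v).inbox = 0)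
    (hheard : ∀ v, (σ v).heard = ∅) :
    ∃ (inbox : V → Fin p.U → Vec p) (heard : V → Finset (Fin p.U)),
      commSeq G .pass σ p.S = fun v => { σ v with
        inbox := inbox v
        heard := heard v
        known := (σ v).known ∪ (passers F v).image fun u => (σ u).sum } := by
  obtain ⟨j, hj⟩ := Nat.exists_eq_add_one.2 hS
  have pass_lt := commSeq_pass_of_lt hσ hinbox hheard (show j < p.S by omega)
  have hσ' : Encodes F (commSeq G .pass σ j) := by
    rw [pass_lt]
    exact ⟨hσ.1, hσ.2, hσ.3, hσ.4⟩
  refine ⟨inboxAfter F (fun u => (σ u).uid) (fun u => (σ u).sum) p.S,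
    fun v => (passers F v).image fun u => (σ u).uid, funext fun v => ?_⟩
  rw [hj, commSeq, comm_pass hσ', pass_lt]
  simp only [← hj, if_true, ite_empty_union_self, ← inboxAfter_succ]
  rw [← image_inboxAfter_S hS hσ.uid_injective]

end PatchSharing

/-! ### The stages of a meta round -/

namespace PatchSharing

variable {p : Params}

theorem Params.D_mul_le : p.D * (2 * (2 * p.iters + 5)) ≤ p.T := Nat.div_mul_le_self _ _

theorem Params.S_pos (hD : 0 < p.D) : 0 < p.S := by
  have le_T : 1 * (2 * (2 * p.iters + 5)) ≤ p.T :=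
    (Nat.mul_le_mul_right _ hD).trans Params.D_mul_le
  rw [Params.S, if_neg hD.ne']
  omega

theorem Params.E_eq (hD : 0 < p.D) : p.E = p.S + p.D := if_neg hD.ne'

theorem Params.idleStart_eq (hD : 0 < p.D) :
    p.idleStart = p.treeStart + 5 * p.D + 5 * p.S := by
  simp only [Params.idleStart, Params.down₂, Params.up₂, Params.passStart, Params.down₁,
    Params.up₁, Params.E_eq hD]
  ring

theorem Params.idleStart_le (hD : 0 < p.D) : p.idleStart ≤ p.T := by
  have S_mul_le : p.S * 10 ≤ p.T := by
    rw [Params.S, if_neg hD.ne']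
    exact Nat.div_mul_le_self p.T 10
  have D_mul_le := Params.D_mul_le (p := p)
  have treeStart_eq : p.D * (2 * (2 * p.iters + 5)) = 2 * p.treeStart + 10 * p.D := by
    rw [Params.treeStart]
    ring
  rw [Params.idleStart_eq hD]
  omega

section Schedule

variable {s j : ℕ}

theorem phase_luby {i : ℕ} (hi : i < p.iters) (hj : j < 2 * p.D) :
    phase p (2 * p.D * i + j) = if j < p.D then .prio else .deactivate := by
  have lt_treeStart : 2 * p.D * i + j < p.treeStart :=
    (Nat.add_lt_add_left hj _).trans_le (Nat.mul_le_mul_left (2 * p.D) hi)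
  rw [phase, if_pos lt_treeStart, Nat.mul_add_mod, Nat.mod_eq_of_lt hj]

theorem phase_tree (hj : j < p.D) : phase p (p.treeStart + j) = .tree j := by
  grind [phase, Params.up₁]

theorem phase_up (hj : j < p.E) (hs : s = p.up₁ ∨ s = p.up₂) : phase p (s + j) = .up j := by
  grind [phase, Params.up₁, Params.down₁, Params.passStart, Params.up₂, Params.down₂]

theorem phase_down (hj : j < p.E) (hs : s = p.down₁ ∨ s = p.down₂) :
    phase p (s + j) = .down j := by
  grind [phase, Params.up₁, Params.down₁, Params.passStart, Params.up₂, Params.down₂,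
    Params.idleStart]

theorem phase_pass (hj : j < p.S) : phase p (p.passStart + j) = .pass j := by
  grind [phase, Params.up₁, Params.down₁, Params.passStart, Params.up₂]

theorem phase_idle : phase p (p.idleStart + j) = .idle := by
  grind [phase, Params.up₁, Params.down₁, Params.passStart, Params.up₂, Params.down₂,
    Params.idleStart]

variable (r : Seed p) (st : State p)

theorem prepare_luby (hD : 0 < p.D) {i : ℕ} (hi : i < p.iters) (hj : j < 2 * p.D) :
    prepare p (2 * p.D * i + j) r st =
      if j = 0 then (if i = 0 then st.reset else st).draw r.1
      else if j = p.D then st.decideLeader else st := by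
  have lt_treeStart : 2 * p.D * i + j < p.treeStart :=
    (Nat.add_lt_add_left hj _).trans_le (Nat.mul_le_mul_left (2 * p.D) hi)
  have mod_eq : (2 * p.D * i + j) % (2 * p.D) = j := by
    rw [Nat.mul_add_mod, Nat.mod_eq_of_lt hj]
  have eq_zero_iff : 2 * p.D * i + j = 0 ↔ i = 0 ∧ j = 0 := by
    rw [Nat.add_eq_zero_iff, mul_eq_zero]
    omega
  grind [prepare, Params.up₁, Params.down₁, Params.passStart, Params.up₂, Params.down₂]

theorem prepare_treeStart (hD : 0 < p.D) (hi : 0 < p.iters) :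
    prepare p p.treeStart r st = st.plant := by
  have treeStart_pos : 0 < p.treeStart := Nat.mul_pos (Nat.mul_pos two_pos hD) hi
  grind [prepare, Params.up₁, Params.down₁, Params.passStart, Params.up₂, Params.down₂]

theorem prepare_up (hD : 0 < p.D) (hs : s = p.up₁ ∨ s = p.up₂) :
    prepare p s r st = st.startUp r.2 := by
  have E_eq := Params.E_eq hD
  grind [prepare, Params.up₁, Params.down₁, Params.passStart, Params.up₂, Params.down₂]

theorem prepare_down (hD : 0 < p.D) (hs : s = p.down₁ ∨ s = p.down₂) :
    prepare p s r st = st.startDown := by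
  have E_eq := Params.E_eq hD
  grind [prepare, Params.up₁, Params.down₁, Params.passStart, Params.up₂, Params.down₂]

theorem prepare_eq_self (hs : p.treeStart < s) (hup : s ≠ p.up₁ ∧ s ≠ p.up₂)
    (hdown : s ≠ p.down₁ ∧ s ≠ p.down₂) : prepare p s r st = st := by
  grind [prepare]

end Schedule

section Stages

variable {V : Type*} [Fintype V] [DecidableEq V] (G : SimpleGraph V) (hD : 0 < p.D)
  (Φ : (V → State p) → ℝ) (σ : V → State p)
include hD

theorem expectRounds_prio {i : ℕ} (hi : i < p.iters) :
    expectRounds G (2 * p.D * i) p.D Φ σ = 𝔼 r : V → Seed p, Φ (commSeq G (fun _ => .prio)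
      (fun v => (if i = 0 then (σ v).reset else σ v).draw (r v).1) p.D) := by
  rw [expectRounds_of_stage G hD (ph := fun _ => .prio)]
  · refine Finset.expect_congr rfl fun r _ => ?_
    congr 2
    exact funext fun v => prepare_luby (j := 0) (r v) (σ v) hD hi (by omega)
  · exact fun j hj => by rw [phase_luby hi (by omega), if_pos hj]
  · exact fun j hj_pos hj r st => by
      rw [prepare_luby r st hD hi (by omega), if_neg hj_pos.ne', if_neg hj.ne]

theorem expectRounds_deactivate {i : ℕ} (hi : i < p.iters) :
    expectRounds G (2 * p.D * i + p.D) p.D Φ σ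
      = Φ (commSeq G (fun _ => .deactivate) (fun v => (σ v).decideLeader) p.D) := by
  refine expectRounds_of_stage_det G hD (fun j hj => ?_) (fun j hj_pos hj r st => ?_)
    (fun r st => ?_) Φ σ
  · rw [add_assoc, phase_luby hi (by omega), if_neg (by omega)]
  · rw [add_assoc, prepare_luby r st hD hi (by omega), if_neg (by omega), if_neg (by omega)]
  · rw [prepare_luby r st hD hi (by omega), if_neg hD.ne', if_pos rfl]

theorem expectRounds_luby {i : ℕ} (hi : i < p.iters) :
    expectRounds G (2 * p.D * i) (2 * p.D) Φ σ
      = 𝔼 r : V → Seed p, Φ (luby G (fun v => if i = 0 then (σ v).reset else σ v) r) := by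
  have rounds_eq : expectRounds G (2 * p.D * i) (2 * p.D) Φ σ
      = expectRounds G (2 * p.D * i) (p.D + p.D) Φ σ := by rw [two_mul p.D]
  rw [rounds_eq, expectRounds_add, expectRounds_prio G hD _ σ hi]
  simp only [expectRounds_deactivate G hD Φ _ hi]
  rfl

theorem expectRounds_tree (hi : 0 < p.iters) :
    expectRounds G p.treeStart p.D Φ σ = Φ (commSeq G .tree (fun v => (σ v).plant) p.D) := by
  refine expectRounds_of_stage_det G hD (fun j hj => phase_tree hj) (fun j hj_pos hj r st => ?_)
    (fun r st => prepare_treeStart r st hD hi) Φ σ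
  apply prepare_eq_self <;>
    grind [Params.up₁, Params.down₁, Params.passStart, Params.up₂, Params.down₂]

theorem expectRounds_up {s : ℕ} (hs : s = p.up₁ ∨ s = p.up₂) :
    expectRounds G s p.E Φ σ = 𝔼 r : V → Seed p,
      Φ (commSeq G .up (fun v => (σ v).startUp (r v).2) p.E) := by
  have E_eq := Params.E_eq hD
  rw [expectRounds_of_stage G (by omega) (fun j hj => phase_up hj hs)]
  · refine Finset.expect_congr rfl fun r _ => ?_
    congr 2
    exact funext fun v => prepare_up (r v) (σ v) hD hs
  · intro j hj_pos hj r st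
    apply prepare_eq_self <;>
      grind [Params.up₁, Params.down₁, Params.passStart, Params.up₂, Params.down₂]

theorem expectRounds_down {s : ℕ} (hs : s = p.down₁ ∨ s = p.down₂) :
    expectRounds G s p.E Φ σ = Φ (commSeq G .down (fun v => (σ v).startDown) p.E) := by
  have E_eq := Params.E_eq hD
  have S_pos := Params.S_pos hD
  refine expectRounds_of_stage_det G (by omega) (fun j hj => phase_down hj hs)
    (fun j hj_pos hj r st => ?_) (fun r st => prepare_down r st hD hs) Φ σ
  apply prepare_eq_self <;>
    grind [Params.up₁, Params.down₁, Params.passStart, Params.up₂, Params.down₂]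

theorem expectRounds_pass :
    expectRounds G p.passStart p.S Φ σ = Φ (commSeq G .pass σ p.S) := by
  have E_eq := Params.E_eq hD
  refine expectRounds_of_quiet G (fun j hj => phase_pass hj) (fun j hj r st => ?_) Φ σ
  apply prepare_eq_self <;>
    grind [Params.up₁, Params.down₁, Params.passStart, Params.up₂, Params.down₂]

omit [DecidableEq V] hD in
theorem commSeq_idle (j : ℕ) : commSeq G (fun _ => .idle) σ j = σ := by
  induction j with
  | zero => rfl
  | succ j ih => rw [commSeq, ih]; rfl

theorem expectRounds_idle (j : ℕ) : expectRounds G p.idleStart j Φ σ = Φ σ := by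
  have E_eq := Params.E_eq hD
  rw [expectRounds_of_quiet G (ph := fun _ => .idle) (fun j _ => phase_idle), commSeq_idle]
  intro j _ r st
  apply prepare_eq_self <;>
    grind [Params.up₁, Params.down₁, Params.passStart, Params.up₂, Params.down₂, Params.idleStart]

end Stages

section Share

variable {V : Type*} [Fintype V] {G : SimpleGraph V}

/-- A share step, up and down the trees. -/
noncomputable def share (G : SimpleGraph V) (σ : V → State p) (r : V → Seed p) : V → State p :=
  commSeq G .down (fun v =>
    (commSeq G .up (fun v => (σ v).startUp (r v).2) p.E v).startDown) p.E

theorem expectRounds_share [DecidableEq V] (hD : 0 < p.D) (G : SimpleGraph V) {s : ℕ}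
    (hs : s = p.up₁ ∨ s = p.up₂) (Φ : (V → State p) → ℝ) (σ : V → State p) :
    expectRounds G s (p.E + p.E) Φ σ = 𝔼 r : V → Seed p, Φ (share G σ r) := by
  have down_eq : s + p.E = p.down₁ ∨ s + p.E = p.down₂ :=
    hs.imp (congrArg (· + p.E)) (congrArg (· + p.E))
  rw [expectRounds_add, expectRounds_up G hD _ σ hs]
  simp only [expectRounds_down G hD Φ _ down_eq]
  rfl

variable {F : Forest G p.D} {σ : V → State p}

open Classical in
theorem share_eq (hD : 0 < p.D) (hσ : Encodes F σ) (r : V → Seed p) :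
    ∃ acc sum : V → Vec p, share G σ r = (fun v => { σ v with
        acc := acc v
        sum := sum v
        known := shareKnown F (fun u => (σ u).known) r v }) ∧
      ∀ v, (F.depth v).isSome → sum v = patchSum F (fun u => (σ u).known) r v := by
  have S_pos := Params.S_pos hD
  have E_eq := Params.E_eq hD
  set t : V → Vec p := patchSum F (fun u => (σ u).known) r with ht
  set acc : V → Vec p := accAfter F (fun u => combination (σ u).known (r u).2) p.E
  have up_eq : commSeq G .up (fun v => (σ v).startUp (r v).2) p.E
      = fun v => { σ v with acc := acc v } :=
    commSeq_up (σ := fun v => (σ v).startUp (r v).2) ⟨hσ.1, hσ.2, hσ.3, hσ.4⟩ S_pos p.E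
  have t_root {v : V} (hv : (F.depth v).isSome) : t (F.root v) = t v := by
    rw [ht, patchSum, patchSum, Forest.patch_root hv]
  have acc_root {v : V} (hv : F.depth v = some 0) : acc v = t v :=
    accAfter_E_root S_pos E_eq _ hv
  have sum_start (v : V) : (if (σ v).leader then acc v else 0) = sumAfter F t 0 v := by
    rw [if_congr (hσ.leader_iff v) rfl rfl]
    funext q
    rcases hv : F.depth v with _ | _ | δ
    · simp [sumAfter, hv]
    · simp [sumAfter, hv, t_root, acc_root hv]
    · simp [sumAfter, hv]
  refine ⟨acc, sumAfter F t p.E, ?_, fun v hv => ?_⟩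
  · have down_eq := commSeq_down
      (σ := fun v => { σ v with acc := acc v, sum := if (σ v).leader then acc v else 0 })
      ⟨hσ.1, hσ.2, hσ.3, hσ.4⟩ S_pos E_eq sum_start
    rw [share, up_eq]
    refine down_eq.trans (funext fun v => ?_)
    by_cases hv : (F.depth v).isSome
    · simp only [shareKnown, hv, if_true, t_root hv]
      rfl
    · simp only [shareKnown, hv, if_false, Bool.false_eq_true]
  · rw [sumAfter_E S_pos E_eq t hv, t_root hv]

open Classical in
theorem commSeq_pass_share (hD : 0 < p.D) (hσ : Encodes F σ) (hinbox : ∀ v, (σ v).inbox = 0)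
    (hheard : ∀ v, (σ v).heard = ∅) (r : V → Seed p) :
    ∃ (acc sum : V → Vec p) (inbox : V → Fin p.U → Vec p) (heard : V → Finset (Fin p.U)),
      commSeq G .pass (share G σ r) p.S = fun v => { σ v with
        acc := acc v
        sum := sum v
        inbox := inbox v
        heard := heard v
        known := passKnown F (fun u => (σ u).known) r v } := by
  obtain ⟨acc, sum, share_eq, sum_eq⟩ := share_eq hD hσ r
  have hσ' : Encodes F (share G σ r) := by
    rw [share_eq]
    exact ⟨hσ.1, hσ.2, hσ.3, hσ.4⟩
  obtain ⟨inbox, heard, pass_eq⟩ := commSeq_pass hσ' (Params.S_pos hD)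
    (by simpa [share_eq] using hinbox) (by simpa [share_eq] using hheard)
  refine ⟨acc, sum, inbox, heard, ?_⟩
  rw [pass_eq]
  funext v
  have passed_eq : (passers F v).image (fun u => (share G σ r u).sum)
      = (passers F v).image (patchSum F (fun u => (σ u).known) r) :=
    Finset.image_congr fun u hu => by
      rw [share_eq]
      exact sum_eq u (Finset.mem_filter.1 hu).2.2
  simp only [passed_eq, passKnown]
  rw [share_eq]

end Share

end PatchSharing

/-! ### Convergence of the independent set computation -/

namespace PatchSharing

variable {p : Params} {V : Type*} [Fintype V] {G : SimpleGraph V} {σ : V → State p}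
  {r : V → Seed p} {u v : V}

open Classical in
/-- The other active nodes within distance `D` of an active node. -/
noncomputable def rivals (G : SimpleGraph V) (σ : V → State p) (v : V) : Finset V :=
  Finset.univ.filter fun u => u ≠ v ∧ G.dist v u ≤ p.D ∧ (σ v).active = true ∧ (σ u).active = true

theorem mem_rivals : u ∈ rivals G σ v ↔
    u ≠ v ∧ G.dist v u ≤ p.D ∧ (σ v).active = true ∧ (σ u).active = true := by
  simp [rivals]

theorem mem_rivals_comm : u ∈ rivals G σ v ↔ v ∈ rivals G σ u := by
  rw [mem_rivals, mem_rivals, G.dist_comm (u := v) (v := u), ne_comm, and_comm (a := _ = true)]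

/-- The number of ordered pairs of rivals. -/
noncomputable def conflicts (G : SimpleGraph V) (σ : V → State p) : ℕ :=
  ∑ v, (rivals G σ v).card

theorem conflicts_le (G : SimpleGraph V) (σ : V → State p) :
    conflicts G σ ≤ Fintype.card V ^ 2 := by
  rw [sq, ← smul_eq_mul]
  exact Finset.sum_le_card_nsmul _ _ _ fun v _ => Finset.card_le_univ _

/-- The invariants of the independent set computation, in which the received vectors are `K`. -/
structure LubyInv (G : SimpleGraph V) (K : V → Finset (Vec p)) (σ : V → State p) : Prop where
  known_eq (v : V) : (σ v).known = K v
  inbox_eq (v : V) : (σ v).inbox = 0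
  heard_eq (v : V) : (σ v).heard = ∅
  uid_injective : Function.Injective fun v => (σ v).uid
  indep (x y : V) : (σ x).leader = true → (σ y).leader = true → G.dist x y ≤ p.D → x = y
  far (v x : V) : (σ v).active = true → (σ x).leader = true → p.D < G.dist v x
  near (v : V) : (σ v).active = false → ∃ x, (σ x).leader = true ∧ G.dist v x ≤ p.D

omit [Fintype V] in
theorem lubyInv_reset (hD : 0 < p.D) (G : SimpleGraph V)
    (huid : Function.Injective fun v => (σ v).uid) :
    LubyInv G (fun v => (σ v).known) fun v => (σ v).reset where
  known_eq _ := rfl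
  inbox_eq _ := rfl
  heard_eq _ := rfl
  uid_injective := huid
  indep x y hx := by simp [State.reset, hD.ne'] at hx
  far v x _ hx := by simp [State.reset, hD.ne'] at hx
  near v hv := by simp [State.reset] at hv

omit [Fintype V] in
theorem eq_of_drawn_eq (huid : Function.Injective fun v => (σ v).uid) (hu : (σ u).active = true)
    (hv : (σ v).active = true) (h : drawn σ r u = drawn σ r v) : u = v := by
  simp only [drawn, State.draw, if_pos hu, if_pos hv, WithBot.coe_inj] at h
  exact huid (congrArg (fun z => (ofLex z).2) h)

theorem LubyInv.eq_of_newLeader {K : V → Finset (Vec p)} (h : LubyInv G K σ)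
    (hu : NewLeader G σ r u) (hv : NewLeader G σ r v) (hd : G.dist u v ≤ p.D) : u = v :=
  eq_of_drawn_eq h.uid_injective hu.1 hv.1 (le_antisymm
    (hv.2 u (mem_distBall.2 (by rwa [G.dist_comm]))) (hu.2 v (mem_distBall.2 hd)))

theorem luby_active (hG : G.Connected) (σ : V → State p) (r : V → Seed p) (v : V) :
    (luby G σ r v).active = true ↔
      (σ v).active = true ∧ ∀ u, G.dist v u ≤ p.D → ¬ NewLeader G σ r u := by
  rw [luby_eq hG]
  simp [mem_distBall]

theorem luby_leader (hG : G.Connected) (σ : V → State p) (r : V → Seed p) (v : V) :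
    (luby G σ r v).leader = true ↔ (σ v).leader = true ∨ NewLeader G σ r v := by
  rw [luby_eq hG]
  simp

theorem LubyInv.luby (hG : G.Connected) {K : V → Finset (Vec p)} (h : LubyInv G K σ)
    (r : V → Seed p) : LubyInv G K (luby G σ r) where
  known_eq v := by rw [luby_eq hG]; exact h.known_eq v
  inbox_eq v := by rw [luby_eq hG]; exact h.inbox_eq v
  heard_eq v := by rw [luby_eq hG]; exact h.heard_eq v
  uid_injective := by rw [luby_eq hG]; exact h.uid_injective
  indep x y hx hy hd := by
    rw [luby_leader hG] at hx hy
    rcases hx with hx | hx <;> rcases hy with hy | hy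
    · exact h.indep x y hx hy hd
    · exact absurd (h.far y x hy.1 hx) (by rwa [G.dist_comm, not_lt])
    · exact absurd (h.far x y hx.1 hy) (not_lt.2 hd)
    · exact h.eq_of_newLeader hx hy hd
  far v x hv hx := by
    rw [luby_active hG] at hv
    rcases (luby_leader hG σ r x).1 hx with hx | hx
    · exact h.far v x hv.1 hx
    · exact not_le.1 fun hd => hv.2 x hd hx
  near v hv := by
    simp only [luby_leader hG]
    rw [← Bool.not_eq_true, luby_active hG] at hv
    by_cases hactive : (σ v).active = true
    · push Not at hv
      obtain ⟨u, hd, hu⟩ := hv hactive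
      exact ⟨u, Or.inr hu, hd⟩
    · obtain ⟨x, hx, hd⟩ := h.near v (by simpa using hactive)
      exact ⟨x, Or.inl hx, hd⟩

theorem newLeader_of_forall_rivals (hu : (σ u).active = true)
    (h : ∀ w ∈ rivals G σ u, (r w).1 < (r u).1) : NewLeader G σ r u := by
  refine ⟨hu, fun w hw => ?_⟩
  rcases eq_or_ne w u with rfl | hwu
  · exact le_rfl
  by_cases hactive : (σ w).active = true
  · have lt := h w (mem_rivals.2 ⟨hwu, mem_distBall.1 hw, hu, hactive⟩)
    simp only [drawn, State.draw, if_pos hu, if_pos hactive, WithBot.coe_le_coe]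
    exact Prod.Lex.toLex_le_toLex.2 (Or.inl lt)
  · simp only [drawn, State.draw, if_neg hactive, bot_le]

theorem luby_inactive_of_conflicts_eq_zero (hG : G.Connected) (r : V → Seed p)
    (h : conflicts G σ = 0) (v : V) : (luby G σ r v).active = false := by
  have rivals_eq : rivals G σ v = ∅ :=
    Finset.card_eq_zero.1 (Finset.sum_eq_zero_iff.1 h v (Finset.mem_univ v))
  rw [← Bool.not_eq_true, luby_active hG]
  rintro ⟨hv, no_leader⟩
  exact no_leader v (by simp) (newLeader_of_forall_rivals hv (by simp [rivals_eq]))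

/-- Node `u` draws a higher priority than all other rivals of `u` and of `v`. -/
def Beats (G : SimpleGraph V) (σ : V → State p) (r : V → Seed p) (u v : V) : Prop :=
  ∀ w, w ∈ rivals G σ u ∨ w ∈ rivals G σ v → w ≠ u → (r w).1 < (r u).1

theorem Beats.newLeader (h : Beats G σ r u v) (hu : (σ u).active = true) : NewLeader G σ r u :=
  newLeader_of_forall_rivals hu fun w hw => h w (Or.inl hw) (mem_rivals.1 hw).1

theorem Beats.eq {u' : V} (h : Beats G σ r u v) (h' : Beats G σ r u' v) (hu : u ∈ rivals G σ v)
    (hu' : u' ∈ rivals G σ v) : u = u' := by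
  by_contra hne
  exact lt_asymm (h u' (Or.inr hu') (Ne.symm hne)) (h' u (Or.inr hu) hne)

theorem rivals_luby_subset (hG : G.Connected) (σ : V → State p) (r : V → Seed p) (v : V) :
    rivals G (luby G σ r) v ⊆ rivals G σ v := fun w hw => by
  simp only [mem_rivals, luby_active hG] at hw
  exact mem_rivals.2 ⟨hw.1, hw.2.1, hw.2.2.1.1, hw.2.2.2.1⟩

theorem rivals_luby_eq_empty (hG : G.Connected) (hu : u ∈ rivals G σ v) (h : Beats G σ r u v) :
    rivals G (luby G σ r) v = ∅ := by
  refine Finset.eq_empty_of_forall_notMem fun w hw => ?_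
  obtain ⟨-, hd, -, hactive⟩ := mem_rivals.1 hu
  exact ((luby_active hG σ r v).1 (mem_rivals.1 hw).2.2.1).2 u hd (h.newLeader hactive)

open Classical in
theorem card_rivals_luby_le (hG : G.Connected) (σ : V → State p) (r : V → Seed p) (v : V) :
    ((rivals G (luby G σ r) v).card : ℝ) ≤ (rivals G σ v).card *
      (1 - ∑ u ∈ rivals G σ v, if Beats G σ r u v then (1 : ℝ) else 0) := by
  by_cases hb : ∃ u ∈ rivals G σ v, Beats G σ r u v
  · obtain ⟨u, hu, hbu⟩ := hb
    have sum_eq : (∑ u ∈ rivals G σ v, if Beats G σ r u v then (1 : ℝ) else 0) = 1 := by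
      rw [Finset.sum_eq_single_of_mem u hu fun u' hu' hne =>
        if_neg fun hbu' => hne (hbu'.eq hbu hu' hu), if_pos hbu]
    rw [sum_eq, rivals_luby_eq_empty hG hu hbu]
    simp
  · have sum_eq : (∑ u ∈ rivals G σ v, if Beats G σ r u v then (1 : ℝ) else 0) = 0 :=
      Finset.sum_eq_zero fun u hu => if_neg fun h => hb ⟨u, hu, h⟩
    rw [sum_eq, sub_zero, mul_one]
    exact_mod_cast Finset.card_le_card (rivals_luby_subset hG σ r v)

theorem sum_sum_rivals_div (G : SimpleGraph V) (σ : V → State p) :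
    ∑ v, ∑ u ∈ rivals G σ v,
      ((rivals G σ v).card : ℝ) / ((rivals G σ u).card + (rivals G σ v).card) =
        1 / 2 * conflicts G σ := by
  set d : V → ℝ := fun v => ((rivals G σ v).card : ℝ)
  have swap : ∑ v, ∑ u ∈ rivals G σ v, d v / (d u + d v) =
      ∑ v, ∑ u ∈ rivals G σ v, d u / (d u + d v) := by
    rw [Finset.sum_comm' (s' := fun u => rivals G σ u) (t' := Finset.univ)
      fun u v => by simp [mem_rivals_comm (u := u)]]
    simp only [add_comm]
  have add : ∑ v, ∑ u ∈ rivals G σ v, d v / (d u + d v) +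
      ∑ v, ∑ u ∈ rivals G σ v, d u / (d u + d v) = conflicts G σ := by
    simp only [← Finset.sum_add_distrib, conflicts, Finset.card_eq_sum_ones, Nat.cast_sum]
    refine Finset.sum_congr rfl fun v _ => Finset.sum_congr rfl fun u hu => ?_
    have d_pos : 0 < d v := Nat.cast_pos.2 (Finset.card_pos.2 ⟨u, hu⟩)
    have d_nonneg : 0 ≤ d u := Nat.cast_nonneg _
    rw [← add_div, add_comm (d v), div_self (by positivity), Nat.cast_one]
  linarith

variable [DecidableEq V]

open Classical in
theorem one_div_le_expect_beats (G : SimpleGraph V) (σ : V → State p) (hu : u ∈ rivals G σ v)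
    (hV : 2 * Fintype.card V ^ 2 ≤ p.prioRange) :
    1 / (2 * (((rivals G σ u).card : ℝ) + (rivals G σ v).card)) ≤
      𝔼 r : V → Seed p, if Beats G σ r u v then (1 : ℝ) else 0 := by
  set W := rivals G σ u ∪ rivals G σ v
  have mem_W : u ∈ W := Finset.mem_union_right _ hu
  have W_pos : (0 : ℝ) < W.card := by exact_mod_cast Finset.card_pos.2 ⟨u, mem_W⟩
  have W_le : (W.card : ℝ) ≤ (rivals G σ u).card + (rivals G σ v).card := by
    exact_mod_cast Finset.card_union_le _ _
  have hW : 2 * W.card ^ 2 ≤ p.prioRange := le_trans (by gcongr; exact Finset.card_le_univ W) hV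
  calc _ ≤ 1 / (2 * (W.card : ℝ)) := by gcongr
    _ ≤ 𝔼 r : V → Seed p, if ∀ w ∈ W, w ≠ u → (r w).1 < (r u).1 then (1 : ℝ) else 0 :=
      one_div_two_mul_card_le_expect_strictMax mem_W hW
    _ = _ := Finset.expect_congr rfl fun r _ => if_congr (by simp [W, Beats]) rfl rfl

theorem expect_conflicts_luby_le (hG : G.Connected) (σ : V → State p)
    (hV : 2 * Fintype.card V ^ 2 ≤ p.prioRange) :
    𝔼 r : V → Seed p, (conflicts G (luby G σ r) : ℝ) ≤ 3 / 4 * conflicts G σ := by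
  classical
  set d : V → ℝ := fun v => ((rivals G σ v).card : ℝ)
  calc 𝔼 r : V → Seed p, (conflicts G (luby G σ r) : ℝ)
      ≤ 𝔼 r : V → Seed p, ∑ v, d v *
          (1 - ∑ u ∈ rivals G σ v, if Beats G σ r u v then (1 : ℝ) else 0) := by
        refine Finset.expect_le_expect fun r _ => ?_
        rw [conflicts, Nat.cast_sum]
        exact Finset.sum_le_sum fun v _ => card_rivals_luby_le hG σ r v
    _ = ∑ v, d v * (1 - ∑ u ∈ rivals G σ v,
          𝔼 r : V → Seed p, if Beats G σ r u v then (1 : ℝ) else 0) := by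
        simp only [Finset.expect_sum_comm, ← Finset.mul_expect, Finset.expect_sub_distrib,
          Fintype.expect_const]
    _ ≤ ∑ v, d v * (1 - ∑ u ∈ rivals G σ v, 1 / (2 * (d u + d v))) := by
        gcongr with v _ u hu
        exact one_div_le_expect_beats G σ hu hV
    _ = ∑ v, d v - 1 / 2 * ∑ v, ∑ u ∈ rivals G σ v, d v / (d u + d v) := by
        rw [Finset.mul_sum, ← Finset.sum_sub_distrib]
        refine Finset.sum_congr rfl fun v _ => ?_
        rw [mul_sub, mul_one, Finset.mul_sum, Finset.mul_sum]
        congr 1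
        refine Finset.sum_congr rfl fun u _ => ?_
        rw [one_div, mul_inv]
        ring
    _ = 3 / 4 * conflicts G σ := by
        rw [sum_sum_rivals_div, conflicts, Nat.cast_sum]
        ring

/-- The expectation of `Φ` after `j` iterations of the independent set computation. -/
noncomputable def expectLuby (G : SimpleGraph V) (Φ : (V → State p) → ℝ) :
    ℕ → (V → State p) → ℝ
  | 0, σ => Φ σ
  | j + 1, σ => 𝔼 r : V → Seed p, expectLuby G Φ j (luby G σ r)

theorem expectRounds_eq_expectLuby (hD : 0 < p.D) (G : SimpleGraph V)
    (Φ : (V → State p) → ℝ) (j i : ℕ) (hij : i + (j + 1) = p.iters) (σ : V → State p) :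
    expectRounds G (2 * p.D * i) (2 * p.D * (j + 1)) Φ σ =
      expectLuby G Φ (j + 1) fun v => if i = 0 then (σ v).reset else σ v := by
  induction j generalizing i σ with
  | zero =>
    rw [zero_add, mul_one, expectRounds_luby G hD Φ σ (by omega)]
    rfl
  | succ j ih =>
    rw [show 2 * p.D * (j + 1 + 1) = 2 * p.D + 2 * p.D * (j + 1) by ring, expectRounds_add,
      expectRounds_luby G hD _ σ (by omega), expectLuby]
    refine Finset.expect_congr rfl fun r _ => ?_
    rw [show 2 * p.D * i + 2 * p.D = 2 * p.D * (i + 1) by ring, ih (i + 1) (by omega)]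
    simp

-- A single iteration completes the computation once there are no conflicts left.
theorem expectLuby_le (hG : G.Connected) (hV : 2 * Fintype.card V ^ 2 ≤ p.prioRange)
    {Φ : (V → State p) → ℝ} {K : V → Finset (Vec p)} {M M' : ℝ} (hM : M' ≤ M)
    (hΦ : ∀ σ, LubyInv G K σ → Φ σ ≤ M)
    (hΦ' : ∀ σ, LubyInv G K σ → (∀ v, (σ v).active = false) → Φ σ ≤ M') (j : ℕ)
    (hσ : LubyInv G K σ) :
    expectLuby G Φ (j + 1) σ ≤ M' + (M - M') * ((3 / 4) ^ j * conflicts G σ) := by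
  have sub_nonneg' : 0 ≤ M - M' := sub_nonneg.2 hM
  induction j generalizing σ with
  | zero =>
    rw [pow_zero, one_mul]
    refine Finset.expect_le Finset.univ_nonempty fun r _ => ?_
    change Φ (luby G σ r) ≤ _
    rcases (conflicts G σ).eq_zero_or_pos with no_conflicts | conflicts_pos
    · rw [no_conflicts, Nat.cast_zero, mul_zero, add_zero]
      exact hΦ' _ (hσ.luby hG r) (luby_inactive_of_conflicts_eq_zero hG r no_conflicts)
    · have one_le : (1 : ℝ) ≤ conflicts G σ := by exact_mod_cast conflicts_pos
      linarith [hΦ _ (hσ.luby hG r), le_mul_of_one_le_right sub_nonneg' one_le]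
  | succ j ih =>
    calc expectLuby G Φ (j + 1 + 1) σ
        ≤ 𝔼 r : V → Seed p, (M' + (M - M') * ((3 / 4) ^ j * conflicts G (luby G σ r))) :=
          Finset.expect_le_expect fun r _ => ih (hσ.luby hG r)
      _ = M' + (M - M') * ((3 / 4) ^ j *
            𝔼 r : V → Seed p, (conflicts G (luby G σ r) : ℝ)) := by
          rw [Finset.expect_add_distrib, Fintype.expect_const, ← Finset.mul_expect,
            ← Finset.mul_expect]
      _ ≤ M' + (M - M') * ((3 / 4) ^ j * (3 / 4 * conflicts G σ)) := by
          gcongr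
          exact expect_conflicts_luby_le hG σ hV
      _ = _ := by rw [pow_succ]; ring

end PatchSharing

/-! ### The progress in a meta round -/

namespace PatchSharing

variable {p : Params}

section Unsound

variable {V : Type*}

open Classical in
/-- The indicator function of the event that a node has received a vector outside `W`. -/
noncomputable def unsound (W : Submodule (ZMod 2) (Vec p)) (K : V → Finset (Vec p)) : ℝ :=
  if ∀ v, ∀ x ∈ K v, x ∈ W then 0 else 1

theorem unsound_of_mem {W : Submodule (ZMod 2) (Vec p)} {K : V → Finset (Vec p)}
    (hK : ∀ v, ∀ x ∈ K v, x ∈ W) : unsound W K = 0 := if_pos hK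

theorem unsound_nonneg (W : Submodule (ZMod 2) (Vec p)) (K : V → Finset (Vec p)) :
    0 ≤ unsound W K := by
  rw [unsound]
  split_ifs <;> norm_num

theorem unsound_le_one (W : Submodule (ZMod 2) (Vec p)) (K : V → Finset (Vec p)) :
    unsound W K ≤ 1 := by
  rw [unsound]
  split_ifs <;> norm_num

theorem unsound_mono (W : Submodule (ZMod 2) (Vec p)) {K K' : V → Finset (Vec p)}
    (hK : ∀ v, K v ⊆ K' v) : unsound W K ≤ unsound W K' := by
  by_cases sound : ∀ v, ∀ x ∈ K' v, x ∈ W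
  · rw [unsound_of_mem sound, unsound_of_mem fun v x hx => sound v x (hK v hx)]
  · exact (unsound_le_one W K).trans_eq (if_neg sound).symm

end Unsound

variable {V : Type*} [Fintype V] [DecidableEq V] {G : SimpleGraph V}
  {σ : V → State p} {K : V → Finset (Vec p)}

theorem expectRounds_up₁ (hD : 0 < p.D) {F : Forest G p.D} (hσ : Encodes F σ)
    (hinbox : ∀ v, (σ v).inbox = 0) (hheard : ∀ v, (σ v).heard = ∅)
    (f : (V → Finset (Vec p)) → ℝ) :
    expectRounds G p.up₁ (p.T - p.up₁) (fun σ => f fun v => (σ v).known) σ =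
      𝔼 r, 𝔼 r', f (shareKnown F (passKnown F (fun v => (σ v).known) r) r') := by
  have passStart_eq : p.up₁ + (p.E + p.E) = p.passStart := (Nat.add_assoc _ _ _).symm
  have idleStart_eq : p.up₂ + (p.E + p.E) = p.idleStart := (Nat.add_assoc _ _ _).symm
  have up₂_eq : p.passStart + p.S = p.up₂ := rfl
  have rest_eq : p.T - p.up₁ = p.E + p.E + (p.S + (p.E + p.E + (p.T - p.idleStart))) := by
    have := Params.idleStart_le hD
    omega
  rw [rest_eq, expectRounds_add, expectRounds_share hD G (Or.inl rfl), passStart_eq]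
  refine Finset.expect_congr rfl fun r _ => ?_
  obtain ⟨acc, sum, inbox, heard, pass_eq⟩ := commSeq_pass_share hD hσ hinbox hheard r
  rw [expectRounds_add, expectRounds_pass G hD, pass_eq, up₂_eq, expectRounds_add,
    expectRounds_share hD G (Or.inr rfl)]
  refine Finset.expect_congr rfl fun r' _ => ?_
  rw [idleStart_eq, expectRounds_idle G hD]
  obtain ⟨acc', sum', share_eq, -⟩ :=
    share_eq hD (Encodes.mk hσ.1 hσ.2 hσ.3 hσ.4 : Encodes F fun v => { σ v with
      acc := acc v
      sum := sum v
      inbox := inbox v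
      heard := heard v
      known := passKnown F (fun u => (σ u).known) r v }) r'
  rw [share_eq]

theorem LubyInv.exists_forest (hD : 0 < p.D) (hi : 0 < p.iters) (hG : G.Connected)
    (hσ : LubyInv G K σ) :
    ∃ F : Forest G p.D, F.IsBFS ∧ (∀ v, F.depth v = some 0 ↔ (σ v).leader = true) ∧
      ∀ f : (V → Finset (Vec p)) → ℝ,
        expectRounds G p.treeStart (p.T - p.treeStart) (fun σ => f fun v => (σ v).known) σ =
          𝔼 r, 𝔼 r', f (shareKnown F (passKnown F K r) r') := by
  obtain rfl : (fun v => (σ v).known) = K := funext hσ.known_eq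
  obtain ⟨F, hF, hroot, tree_eq⟩ := exists_forest_commSeq_tree hG σ p.D
  refine ⟨F, hF, hroot, fun f => ?_⟩
  have up₁_eq : p.treeStart + p.D = p.up₁ := rfl
  have rest_eq : p.T - p.treeStart = p.D + (p.T - p.up₁) := by
    have := Params.idleStart_le hD
    have := Params.idleStart_eq hD
    omega
  rw [rest_eq, expectRounds_add, expectRounds_tree G hD _ σ hi, tree_eq, up₁_eq,
    expectRounds_up₁ hD (encodes_writeForest hσ.uid_injective hroot) hσ.inbox_eq hσ.heard_eq]
  rfl

theorem expectRounds_eq_expectLuby_iters (hD : 0 < p.D) (hi : 0 < p.iters)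
    (F : (V → State p) → ℝ) : expectRounds G 0 p.T F σ =
      expectLuby G (expectRounds G p.treeStart (p.T - p.treeStart) F) p.iters
        fun v => (σ v).reset := by
  obtain ⟨j, iters_eq⟩ := Nat.exists_eq_add_one.2 hi
  have T_eq : p.T = 2 * p.D * (j + 1) + (p.T - p.treeStart) := by
    have := Params.idleStart_le hD
    have := Params.idleStart_eq hD
    rw [← iters_eq, ← Params.treeStart]
    omega
  rw [T_eq, expectRounds_add, zero_add, ← T_eq, Params.treeStart, iters_eq]
  simpa using expectRounds_eq_expectLuby hD G _ j 0 (by omega) σ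

/-- The conditions on the parameters under which all nodes of a network of `n` nodes are covered by
patches with probability at least one half in each meta round. -/
structure Params.Adequate (p : Params) (n : ℕ) : Prop where
  T_pos : 0 < p.T
  iters_pos : 0 < p.iters
  le_prioRange : 2 * n ^ 2 ≤ p.prioRange
  pow_iters_le : (3 / 4 : ℝ) ^ (p.iters - 1) * (n : ℝ) ^ 2 ≤ 1 / 2

theorem expectRounds_le_of_D_pos (hD : 0 < p.D) (hp : p.Adequate (Fintype.card V))
    (hG : G.Connected) (huid : Function.Injective fun v => (σ v).uid)
    {f : (V → Finset (Vec p)) → ℝ} {M M' : ℝ} (hM : M' ≤ M)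
    (hf : ∀ (F : Forest G p.D) r r',
      f (shareKnown F (passKnown F (fun v => (σ v).known) r) r') ≤ M)
    (hf' : ∀ F : Forest G p.D, F.IsBFS →
      (∀ x y, F.depth x = some 0 → F.depth y = some 0 → G.dist x y ≤ p.D → x = y) →
      (∀ v, (F.depth v).isSome) →
      𝔼 r, 𝔼 r', f (shareKnown F (passKnown F (fun v => (σ v).known) r) r') ≤ M') :
    expectRounds G 0 p.T (fun σ => f fun v => (σ v).known) σ ≤ (M + M') / 2 := by
  set Φ : (V → State p) → ℝ :=
    expectRounds G p.treeStart (p.T - p.treeStart) fun σ => f fun v => (σ v).known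
  obtain ⟨j, iters_eq⟩ := Nat.exists_eq_add_one.2 hp.iters_pos
  have le_M : ∀ τ, LubyInv G (fun v => (σ v).known) τ → Φ τ ≤ M := fun τ hτ => by
    obtain ⟨F, -, -, Φ_eq⟩ := hτ.exists_forest hD hp.iters_pos hG
    exact (Φ_eq f).trans_le (Finset.expect_le Finset.univ_nonempty fun r _ =>
      Finset.expect_le Finset.univ_nonempty fun r' _ => hf F r r')
  have le_M' : ∀ τ, LubyInv G (fun v => (σ v).known) τ → (∀ v, (τ v).active = false) →
      Φ τ ≤ M' := fun τ hτ hinactive => by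
    obtain ⟨F, hF, hroot, Φ_eq⟩ := hτ.exists_forest hD hp.iters_pos hG
    refine (Φ_eq f).trans_le (hf' F hF (fun x y hx hy => ?_) fun v => ?_)
    · exact hτ.indep x y ((hroot x).1 hx) ((hroot y).1 hy)
    · obtain ⟨x, hx, hd⟩ := hτ.near v (hinactive v)
      exact hF.depth_isSome ((hroot x).2 hx) hd
  have conflicts_small :
      (3 / 4 : ℝ) ^ j * conflicts G (fun v => (σ v).reset) ≤ 1 / 2 := by
    refine le_trans ?_ hp.pow_iters_le
    rw [iters_eq, Nat.add_sub_cancel]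
    gcongr
    exact_mod_cast conflicts_le G fun v => (σ v).reset
  rw [expectRounds_eq_expectLuby_iters hD hp.iters_pos, iters_eq]
  refine (expectLuby_le hG hp.le_prioRange hM le_M le_M' j (lubyInv_reset hD G huid)).trans ?_
  linarith [mul_le_mul_of_nonneg_left conflicts_small (sub_nonneg.2 hM)]

theorem expectRounds_of_D_eq_zero (hD : p.D = 0) (hT : 0 < p.T)
    (huid : Function.Injective fun v => (σ v).uid) (f : (V → Finset (Vec p)) → ℝ) :
    expectRounds G 0 p.T (fun σ => f fun v => (σ v).known) σ =
      𝔼 r, f (singleKnown (fun v => (σ v).known) r G) := by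
  classical
  have treeStart_eq : p.treeStart = 0 := by simp [Params.treeStart, hD]
  have E_eq : p.E = 0 := by simp [Params.E, hD]
  have S_eq : p.S = p.T := by simp [Params.S, hD]
  have up₁_eq : p.up₁ = 0 := by simp [Params.up₁, treeStart_eq, hD]
  have down₁_eq : p.down₁ = 0 := by simp [Params.down₁, up₁_eq, E_eq]
  have passStart_eq : p.passStart = 0 := by simp [Params.passStart, down₁_eq, E_eq]
  have up₂_eq : p.up₂ = p.T := by simp [Params.up₂, passStart_eq, S_eq]
  have down₂_eq : p.down₂ = p.T := by simp [Params.down₂, up₂_eq, E_eq]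
  rw [expectRounds_of_stage G (ph := .pass) hT (fun j hj => by grind [phase])
    fun j hj_pos hj r st => by grind [prepare]]
  refine Finset.expect_congr rfl fun r _ => ?_
  have prep_eq : prep 0 r σ = fun v => { σ v with
      active := true
      leader := true
      inbox := 0
      heard := ∅
      depth := some 0
      parent := none
      acc := combination (σ v).known (r v).2
      sum := combination (σ v).known (r v).2 } := by
    funext v
    simp [prep, prepare, treeStart_eq, up₁_eq, down₁_eq, hD, State.reset, State.plant,
      State.startUp, State.startDown]
  have encodes : Encodes (.ofRoots G Set.univ) (prep 0 r σ) := by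
    rw [prep_eq]
    exact ⟨huid, by simp [Forest.ofRoots], by simp [Forest.ofRoots],
      by simp [Forest.ofRoots, parentId]⟩
  obtain ⟨inbox, heard, pass_eq⟩ := commSeq_pass encodes (S_eq ▸ hT)
    (by simp [prep_eq]) (by simp [prep_eq])
  rw [← S_eq, pass_eq, prep_eq]
  congr 1
  funext v
  simp [singleKnown, randomSum, passers, Forest.ofRoots, SimpleGraph.neighborFinset_eq_filter]

theorem expectRounds_weight_le (hp : p.Adequate (Fintype.card V)) (hG : G.Connected)
    (huid : Function.Injective fun v => (σ v).uid) {φ : Vec p →ₗ[ZMod 2] ZMod 2}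
    (hσ : ∃ v, Senses φ (σ v).known) :
    expectRounds G 0 p.T (fun σ => weight p.minPatch (ignorant φ fun v => (σ v).known).card) σ ≤
      15 / 16 * weight p.minPatch (ignorant φ fun v => (σ v).known).card := by
  have nonneg := weight_nonneg p.minPatch (ignorant φ fun v => (σ v).known).card
  rcases p.D.eq_zero_or_pos with hD | hD
  · rw [expectRounds_of_D_eq_zero hD hp.T_pos huid fun K => weight p.minPatch (ignorant φ K).card]
    have minPatch_eq : p.minPatch = 1 := by rw [Params.minPatch, hD]
    rw [minPatch_eq] at nonneg ⊢
    linarith [expect_weight_singleKnown_le hG hσ]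
  · refine (expectRounds_le_of_D_pos hD hp hG huid
      (f := fun K => weight p.minPatch (ignorant φ K).card)
      (M := weight p.minPatch (ignorant φ fun v => (σ v).known).card)
      (by linarith) (fun F r r' => ?_)
      fun F hF hroots hdepth => expect_weight_meta_le hG hF hroots hdepth hσ).trans_eq (by ring)
    exact weight_mono _ (Finset.card_le_card ((ignorant_anti subset_shareKnown).trans
      (ignorant_anti subset_passKnown)))

theorem expectRounds_unsound_le (hp : p.Adequate (Fintype.card V)) (hG : G.Connected)
    (huid : Function.Injective fun v => (σ v).uid) {W : Submodule (ZMod 2) (Vec p)}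
    (hσ : ∀ v, ∀ x ∈ (σ v).known, x ∈ W) :
    expectRounds G 0 p.T (fun σ => unsound W fun v => (σ v).known) σ ≤ 0 := by
  rcases p.D.eq_zero_or_pos with hD | hD
  · rw [expectRounds_of_D_eq_zero hD hp.T_pos huid (unsound W)]
    exact Finset.expect_le Finset.univ_nonempty fun r _ =>
      (unsound_of_mem (singleKnown_mem hσ)).le
  · have sound : ∀ (F : Forest G p.D) r r',
        unsound W (shareKnown F (passKnown F (fun v => (σ v).known) r) r') = 0 :=
      fun F r r' => unsound_of_mem (shareKnown_mem (passKnown_mem hσ))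
    simpa using expectRounds_le_of_D_pos hD hp hG huid (f := unsound W) le_rfl
      (fun F r r' => (sound F r r').le) fun F _ _ _ => by simp [sound]

end PatchSharing

/-! ### Invariants of all rounds -/

namespace PatchSharing

variable {p : Params}

theorem State.decideLeader_uid (st : State p) : st.decideLeader.uid = st.uid := by
  rw [State.decideLeader]
  split_ifs <;> rfl

theorem State.decideLeader_known (st : State p) : st.decideLeader.known = st.known := by
  rw [State.decideLeader]
  split_ifs <;> rfl

theorem prepare_uid (s : ℕ) (r : Seed p) (st : State p) : (prepare p s r st).uid = st.uid := by
  simp only [prepare, apply_ite State.uid, State.reset, State.draw, State.decideLeader_uid,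
    State.plant, State.startUp, State.startDown, ite_self]

theorem prepare_known (s : ℕ) (r : Seed p) (st : State p) :
    (prepare p s r st).known = st.known := by
  simp only [prepare, apply_ite State.known, State.reset, State.draw, State.decideLeader_known,
    State.plant, State.startUp, State.startDown, ite_self]

theorem update_uid (st : State p) (ms : Multiset (Msg p)) (ph : Phase) :
    (update st ms ph).uid = st.uid := by
  cases ph <;> simp only [update] <;> split <;> rfl

theorem subset_update_known (st : State p) (ms : Multiset (Msg p)) (ph : Phase) :
    st.known ⊆ (update st ms ph).known := by
  classical
  cases ph with
  | prio | idle => exact subset_rfl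
  | deactivate | tree | up =>
    simp only [update]
    split <;> exact subset_rfl
  | down =>
    simp only [update]
    split_ifs
    · exact Finset.subset_insert _ _
    · exact subset_rfl
  | pass =>
    simp only [update]
    split_ifs
    · exact Finset.subset_union_left
    · exact subset_rfl

section States

variable {n : ℕ} (uid : Fin n → Fin p.U) (inp : Fin n → TokenTable p.k p.k)
  (adv : (patchSharing p).Adversary n)

theorem states_uid (h : (patchSharing p).History n) (v : Fin n) :
    (states uid inp adv h v).uid = uid v := by
  induction h with
  | nil => rfl
  | cons s h ih =>
    rw [states_cons]
    exact (update_uid _ _ _).trans ((prepare_uid _ _ _).trans ih)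

theorem states_known_subset_cons (s : Fin n → (patchSharing p).Seed)
    (h : (patchSharing p).History n) (v : Fin n) :
    (states uid inp adv h v).known ⊆ (states uid inp adv (s :: h) v).known := by
  rw [states_cons, ← prepare_known (h.length % p.T) (s v) (states uid inp adv h v)]
  exact subset_update_known _ _ _

theorem init_known_subset_states (h : (patchSharing p).History n) (v : Fin n) :
    (init p (uid v) (inp v)).known ⊆ (states uid inp adv h v).known := by
  induction h with
  | nil => exact subset_rfl
  | cons s h ih => exact ih.trans (states_known_subset_cons uid inp adv s h v)

variable {uid adv}

theorem expectNext_pow_T_eq_expectRounds (hadv : adv.Stable p.T) (F : (Fin n → State p) → ℝ)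
    {h : (patchSharing p).History n} (hh : p.T ∣ h.length) :
    ((patchSharing p).expectNext n ^ p.T) (fun h => F (states uid inp adv h)) h =
      expectRounds (adv h) 0 p.T F (states uid inp adv h) := by
  have start : h.length % p.T = 0 := Nat.mod_eq_zero_of_dvd hh
  rw [expectNext_pow_eq_expectRounds uid inp hadv F p.T h (by rw [start, zero_add]), start]

variable {inp}

theorem expectNext_pow_weight_le (hp : p.Adequate n) (huid : Function.Injective uid)
    (hconn : adv.AlwaysConnected) (hadv : adv.Stable p.T) {φ : Vec p →ₗ[ZMod 2] ZMod 2}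
    (hφ : ∃ v, Senses φ (init p (uid v) (inp v)).known) (R : ℕ) :
    ((patchSharing p).expectNext n ^ R) (fun h => weight p.minPatch
        (ignorant φ fun v => (states uid inp adv h v).known).card) [] ≤
      (15 / 16) ^ (R / p.T) * weight p.minPatch n := by
  set F : (Fin n → State p) → ℝ :=
    fun σ => weight p.minPatch (ignorant φ fun v => (σ v).known).card
  set X : (patchSharing p).History n → ℝ := fun h => F (states uid inp adv h)
  have meta_round_le : ∀ h : (patchSharing p).History n, p.T ∣ h.length →
      ((patchSharing p).expectNext n ^ p.T) X h ≤ 15 / 16 * X h := by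
    intro h hh
    rw [expectNext_pow_T_eq_expectRounds inp hadv F hh]
    refine expectRounds_weight_le (by simpa using hp) (hconn h) ?_ ?_
    · simpa only [states_uid] using huid
    · exact hφ.imp fun v hv => hv.mono (init_known_subset_states uid inp adv h v)
  have round_le : ∀ s h, X (s :: h) ≤ X h := fun s h => weight_mono _
    (Finset.card_le_card (ignorant_anti (states_known_subset_cons uid inp adv s h)))
  calc ((patchSharing p).expectNext n ^ R) X []
      = ((patchSharing p).expectNext n ^ (R / p.T * p.T))
          (((patchSharing p).expectNext n ^ (R % p.T)) X) [] := by
        rw [← Module.End.mul_apply, ← pow_add, mul_comm, Nat.div_add_mod]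
    _ ≤ ((patchSharing p).expectNext n ^ (R / p.T * p.T)) X [] :=
        (patchSharing p).expectNext_pow_mono _
          ((patchSharing p).expectNext_pow_le_self round_le _) _
    _ ≤ (15 / 16) ^ (R / p.T) * X [] :=
        (patchSharing p).expectNext_pow_mul_le (by norm_num) meta_round_le _
    _ ≤ (15 / 16) ^ (R / p.T) * weight p.minPatch n := by
        gcongr
        exact weight_mono _ (card_finset_fin_le _)

theorem expectNext_pow_unsound_le (hp : p.Adequate n) (huid : Function.Injective uid)
    (hconn : adv.AlwaysConnected) (hadv : adv.Stable p.T) {W : Submodule (ZMod 2) (Vec p)}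
    (hW : ∀ v, ∀ x ∈ (init p (uid v) (inp v)).known, x ∈ W) (R : ℕ) :
    ((patchSharing p).expectNext n ^ R)
      (fun h => unsound W fun v => (states uid inp adv h v).known) [] ≤ 0 := by
  set F : (Fin n → State p) → ℝ := fun σ => unsound W fun v => (σ v).known
  set X : (patchSharing p).History n → ℝ := fun h => F (states uid inp adv h)
  have meta_round_le : ∀ h : (patchSharing p).History n, p.T ∣ h.length →
      ((patchSharing p).expectNext n ^ p.T) X h ≤ 1 * X h := by
    intro h hh
    rw [one_mul]
    by_cases sound : ∀ v, ∀ x ∈ (states uid inp adv h v).known, x ∈ W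
    · rw [expectNext_pow_T_eq_expectRounds inp hadv F hh]
      refine (expectRounds_unsound_le (by simpa using hp) (hconn h) ?_ sound).trans
        (unsound_nonneg _ _)
      simpa only [states_uid] using huid
    · calc ((patchSharing p).expectNext n ^ p.T) X h
          ≤ ((patchSharing p).expectNext n ^ p.T) (fun _ => 1) h :=
            (patchSharing p).expectNext_pow_mono _ (fun _ => unsound_le_one _ _) _
        _ = 1 := congrFun ((patchSharing p).expectNext_pow_const 1 p.T) h
        _ = X h := (if_neg sound).symm
  have le_round : ∀ s h, X h ≤ X (s :: h) := fun s h =>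
    unsound_mono _ (states_known_subset_cons uid inp adv s h)
  obtain ⟨d, hd⟩ := Nat.exists_eq_add_of_le (Nat.le_mul_of_pos_right R hp.T_pos)
  calc ((patchSharing p).expectNext n ^ R) X []
      ≤ ((patchSharing p).expectNext n ^ R) (((patchSharing p).expectNext n ^ d) X) [] :=
        (patchSharing p).expectNext_pow_mono _
          ((patchSharing p).le_expectNext_pow_self le_round d) _
    _ = ((patchSharing p).expectNext n ^ (R * p.T)) X [] := by
        rw [← Module.End.mul_apply, ← pow_add, hd]
    _ ≤ 1 ^ R * X [] := (patchSharing p).expectNext_pow_mul_le zero_le_one meta_round_le _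
    _ = 0 := by rw [show X [] = 0 from unsound_of_mem hW, mul_zero]

end States

/-! ### Decoding -/

/-- The coefficient vector of a coded vector. -/
def coeff : Vec p →ₗ[ZMod 2] (Fin p.k → ZMod 2) := LinearMap.funLeft _ _ (Fin.castAdd p.k)

/-- The coded vectors that are combinations of the vectors of the tokens. -/
def codeSpace (tok : Fin p.k → Token p.k) : Submodule (ZMod 2) (Vec p) :=
  Submodule.span (ZMod 2) (Set.range fun i => codeword i (tok i))

theorem coeff_codeword (i : Fin p.k) (y : Token p.k) : coeff (codeword i y) = Pi.single i 1 :=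
  funext fun j => Fin.append_left _ _ j

theorem eq_of_codeword_mem_codeSpace {tok : Fin p.k → Token p.k} {i : Fin p.k} {y : Token p.k}
    (h : codeword i y ∈ codeSpace tok) : y = tok i := by
  obtain ⟨c, hc⟩ := (Submodule.mem_span_range_iff_exists_fun _).1 h
  have c_eq : c = Pi.single i 1 := by
    have coeff_eq := congrArg coeff hc
    simp only [map_sum, map_smul, coeff_codeword] at coeff_eq
    rw [← coeff_eq]
    exact pi_eq_sum_univ' c
  rw [c_eq, Fintype.sum_eq_single i fun j hj => by rw [Pi.single_eq_of_ne hj, zero_smul],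
    Pi.single_eq_same, one_smul] at hc
  funext j
  simpa only [codeword, Fin.append_right] using (congrFun hc (Fin.natAdd p.k j)).symm

theorem mem_init_known {tok : Fin p.k → Token p.k} {H : Finset (Fin p.k)} {u : Fin p.U}
    {x : Vec p} :
    x ∈ (init p u (initialTable tok H)).known ↔ ∃ i ∈ H, codeword i (tok i) = x := by
  simp [init, initialTable]

theorem decode_eq {tok : Fin p.k → Token p.k} {st : State p}
    (hsound : ∀ x ∈ st.known, x ∈ codeSpace tok)
    (hsenses : ∀ f : Module.Dual (ZMod 2) (Fin p.k → ZMod 2), f ≠ 0 →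
      Senses (f ∘ₗ coeff) st.known) (i : Fin p.k) : decode st i = some (tok i) := by
  set W := Submodule.span (ZMod 2) (st.known : Set (Vec p))
  have coeff_surjective : W.map coeff = ⊤ := by
    by_contra ne_top
    obtain ⟨f, hf, map_le_ker⟩ :=
      Submodule.exists_le_ker_of_lt_top _ (lt_top_iff_ne_top.2 ne_top)
    obtain ⟨x, hx, hfx⟩ := hsenses f hf
    exact hfx (map_le_ker (Submodule.mem_map_of_mem (Submodule.subset_span hx)))
  obtain ⟨x, hx, coeff_x⟩ : Pi.single i 1 ∈ W.map coeff := coeff_surjective ▸ Submodule.mem_top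
  have decodable : ∃ y : Token p.k, codeword i y ∈ W := by
    refine ⟨fun j => x (Fin.natAdd p.k j), ?_⟩
    rw [codeword, ← coeff_x]
    exact (Fin.append_castAdd_natAdd (f := x)).symm ▸ hx
  rw [decode, dif_pos decodable]
  exact congrArg some (eq_of_codeword_mem_codeSpace
    (Submodule.span_le.2 hsound decodable.choose_spec))

theorem senses_init {tok : Fin p.k → Token p.k} {ι : Type*} {H : ι → Finset (Fin p.k)}
    (hH : ∀ i, ∃ v, i ∈ H v) (uid : ι → Fin p.U)
    {f : Module.Dual (ZMod 2) (Fin p.k → ZMod 2)} (hf : f ≠ 0) :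
    ∃ v, Senses (f ∘ₗ coeff) (init p (uid v) (initialTable tok (H v))).known := by
  obtain ⟨i, hi⟩ : ∃ i, f (Pi.single i 1) ≠ 0 := by
    by_contra! vanishes
    exact hf ((Pi.basisFun _ _).ext fun i => by simpa using vanishes i)
  obtain ⟨v, hv⟩ := hH i
  refine ⟨v, codeword i (tok i), mem_init_known.2 ⟨i, hv, rfl⟩, ?_⟩
  rwa [LinearMap.comp_apply, coeff_codeword]

theorem one_le_potential_of_not_decode {V : Type*} [Fintype V] {σ : V → State p}
    {tok : Fin p.k → Token p.k} (hσ : ¬ ∀ v i, decode (σ v) i = some (tok i))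
    {N : Finset (Module.Dual (ZMod 2) (Fin p.k → ZMod 2))} (hN : ∀ f ≠ 0, f ∈ N) :
    1 ≤ unsound (codeSpace tok) (fun v => (σ v).known) +
      ∑ f ∈ N, weight p.minPatch (ignorant (f ∘ₗ coeff) fun v => (σ v).known).card := by
  set X : Module.Dual (ZMod 2) (Fin p.k → ZMod 2) → ℝ :=
    fun f => weight p.minPatch (ignorant (f ∘ₗ coeff) fun v => (σ v).known).card
  have X_nonneg : ∀ f ∈ N, 0 ≤ X f := fun f _ => weight_nonneg _ _
  by_cases sound : ∀ v, ∀ x ∈ (σ v).known, x ∈ codeSpace tok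
  · obtain ⟨v, f, hf, ignores⟩ : ∃ v, ∃ f : Module.Dual (ZMod 2) (Fin p.k → ZMod 2),
        f ≠ 0 ∧ ¬ Senses (f ∘ₗ coeff) (σ v).known := by
      by_contra! senses
      exact hσ fun v => decode_eq (sound v) (senses v)
    have one_le : 1 ≤ X f := one_le_weight _ (Finset.card_pos.2 ⟨v, mem_ignorant.2 ignores⟩)
    linarith [Finset.single_le_sum X_nonneg (hN f hf),
      unsound_nonneg (codeSpace tok) fun v => (σ v).known]
  · rw [unsound, if_neg sound]
    linarith [Finset.sum_nonneg X_nonneg]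

theorem card_finset_dual_le {k : ℕ} (N : Finset (Module.Dual (ZMod 2) (Fin k → ZMod 2))) :
    N.card ≤ 2 ^ k := by
  have : Finite (Module.Dual (ZMod 2) (Fin k → ZMod 2)) := Module.finite_of_finite (ZMod 2)
  let _ := Fintype.ofFinite (Module.Dual (ZMod 2) (Fin k → ZMod 2))
  refine (Finset.card_le_univ N).trans_eq ?_
  rw [Module.card_eq_pow_finrank (K := ZMod 2), Subspace.dual_finrank_eq,
    Module.finrank_fin_fun, ZMod.card]

theorem sum_expectNext_pow_weight_le {n : ℕ} (hp : p.Adequate n) {uid : Fin n → Fin p.U}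
    (huid : Function.Injective uid) {tok : Fin p.k → Token p.k} {H : Fin n → Finset (Fin p.k)}
    (hH : ∀ i, ∃ v, i ∈ H v) {adv : (patchSharing p).Adversary n} (hconn : adv.AlwaysConnected)
    (hadv : adv.Stable p.T) {N : Finset (Module.Dual (ZMod 2) (Fin p.k → ZMod 2))}
    (hN : ∀ f ∈ N, f ≠ 0) (R : ℕ) :
    ∑ f ∈ N, ((patchSharing p).expectNext n ^ R) (fun h => weight p.minPatch
      (ignorant (f ∘ₗ coeff) fun v =>
        (states uid (fun v => initialTable tok (H v)) adv h v).known).card) [] ≤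
      2 ^ p.k * ((15 / 16) ^ (R / p.T) * weight p.minPatch n) := by
  refine (Finset.sum_le_card_nsmul _ _ _ fun f hf => expectNext_pow_weight_le hp huid hconn hadv
    (senses_init hH uid (hN f hf)) R).trans ?_
  have card_le : (N.card : ℝ) ≤ 2 ^ p.k := by exact_mod_cast card_finset_dual_le N
  have weight_nonneg := weight_nonneg p.minPatch n
  rw [nsmul_eq_mul]
  gcongr

theorem solvesIndexedBroadcast {n : ℕ} (hp : p.Adequate n) (R : ℕ) :
    SolvesIndexedBroadcast (patchSharing p) n p.T R
      (1 - 2 ^ p.k * ((15 / 16) ^ (R / p.T) * weight p.minPatch n)) := by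
  classical
  intro uid huid tok H hH adv hconn hadv
  have : Finite (Module.Dual (ZMod 2) (Fin p.k → ZMod 2)) := Module.finite_of_finite (ZMod 2)
  let _ := Fintype.ofFinite (Module.Dual (ZMod 2) (Fin p.k → ZMod 2))
  set N := Finset.univ.erase (0 : Module.Dual (ZMod 2) (Fin p.k → ZMod 2))
  set inp : Fin n → TokenTable p.k p.k := fun v => initialTable tok (H v)
  set unsoundness : (patchSharing p).History n → ℝ :=
    fun h => unsound (codeSpace tok) fun v => (states uid inp adv h v).known
  set potential : Module.Dual (ZMod 2) (Fin p.k → ZMod 2) → (patchSharing p).History n → ℝ :=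
    fun f h => weight p.minPatch
      (ignorant (f ∘ₗ coeff) fun v => (states uid inp adv h v).known).card
  have unsoundness_le : ((patchSharing p).expectNext n ^ R) unsoundness [] ≤ 0 := by
    refine expectNext_pow_unsound_le hp huid hconn hadv (fun v x hx => ?_) R
    obtain ⟨i, -, rfl⟩ := mem_init_known.1 hx
    exact Submodule.subset_span ⟨i, rfl⟩
  have sum_potential_le := sum_expectNext_pow_weight_le hp huid (tok := tok) hH hconn hadv
    (fun f hf => Finset.ne_of_mem_erase (s := Finset.univ) hf) R
  calc 1 - 2 ^ p.k * ((15 / 16) ^ (R / p.T) * weight p.minPatch n)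
      ≤ ((patchSharing p).expectNext n ^ R)
          ((fun _ => 1) - (unsoundness + ∑ f ∈ N, potential f)) [] := by
        rw [map_sub, map_add, map_sum, (patchSharing p).expectNext_pow_const, Pi.sub_apply,
          Pi.add_apply, Finset.sum_apply]
        linarith
    _ ≤ _ := by
        refine (patchSharing p).expectNext_pow_le_outputProb (fun h => ?_) fun h hh => ?_
        · refine sub_le_self _ (add_nonneg (unsound_nonneg _ _) ?_)
          rw [Finset.sum_apply]
          exact Finset.sum_nonneg fun f _ => weight_nonneg _ _
        · refine sub_nonpos.2 ?_
          rw [Pi.add_apply, Finset.sum_apply]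
          exact one_le_potential_of_not_decode hh fun f hf =>
            Finset.mem_erase.2 ⟨hf, Finset.mem_univ f⟩

end PatchSharing

/-! ### The choice of the parameters -/

namespace PatchSharing

variable {p : Params} {n : ℕ}

theorem Params.lt_two_pow_ell (hN : n ≤ 2 * p.N) : n < 2 ^ p.ell := by
  have lt_pow : p.N < 2 ^ (Nat.log 2 p.N + 1) := Nat.lt_pow_succ_log_self one_lt_two p.N
  rw [ell, pow_succ]
  omega

theorem Params.adequate (hκ : 20 ≤ p.κ) (hN : n ≤ 2 * p.N) (hT : 0 < p.T) : p.Adequate n := by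
  have two_le_ell : 2 ≤ p.ell := Nat.le_add_left _ _
  have le_iters : 20 * p.ell ≤ p.iters := Nat.mul_le_mul_right _ hκ
  have sq_le : n ^ 2 ≤ 4 ^ p.ell := by
    calc n ^ 2 ≤ (2 ^ p.ell) ^ 2 := Nat.pow_le_pow_left (lt_two_pow_ell hN).le 2
      _ = 4 ^ p.ell := by rw [← pow_mul, mul_comm, pow_mul]; norm_num
  refine ⟨hT, by omega, ?_, ?_⟩
  · calc 2 * n ^ 2 ≤ 4 ^ p.ell * 4 ^ p.ell :=
          Nat.mul_le_mul ((show 2 ≤ 4 by norm_num).trans (Nat.le_pow (by omega))) sq_le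
      _ = p.prioRange := by rw [prioRange, ← mul_pow, pow_mul]; norm_num
  · calc (3 / 4 : ℝ) ^ (p.iters - 1) * (n : ℝ) ^ 2
        ≤ (3 / 4) ^ (10 * p.ell) * 4 ^ p.ell := by
          refine mul_le_mul (pow_le_pow_of_le_one (by norm_num) (by norm_num) (by omega))
            (by exact_mod_cast sq_le) (by positivity) (by positivity)
      _ = ((3 / 4) ^ 10 * 4) ^ p.ell := by rw [pow_mul, mul_pow]
      _ ≤ (1 / 4) ^ p.ell := by gcongr; norm_num
      _ ≤ (1 / 4) ^ 1 := pow_le_pow_of_le_one (by norm_num) (by norm_num) (by omega)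
      _ ≤ 1 / 2 := by norm_num

theorem half_le_log (hn : 2 ≤ n) : (1 / 2 : ℝ) ≤ Real.log n := by
  have log_two_le : Real.log 2 ≤ Real.log n :=
    Real.log_le_log (by norm_num) (by exact_mod_cast hn)
  linarith [Real.log_two_gt_d9]

theorem natLog_add_one_le (hn : 2 ≤ n) : (Nat.log 2 n + 1 : ℝ) ≤ 4 * Real.log n := by
  have natLog_le : (Nat.log 2 n : ℝ) ≤ Real.log n / Real.log 2 := Real.natLog_le_logb n 2
  have div_le : Real.log n / Real.log 2 ≤ 2 * Real.log n := by
    rw [div_le_iff₀ (by positivity)]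
    nlinarith [half_le_log hn, Real.log_two_gt_d9]
  linarith [half_le_log hn]

theorem Params.ell_le (hn : 2 ≤ n) (hN : p.N ≤ 2 * n) : (p.ell : ℝ) ≤ 8 * Real.log n := by
  have natLog_le : Nat.log 2 p.N ≤ Nat.log 2 n + 1 := by
    rw [← Nat.log_mul_base one_lt_two (by omega)]
    exact Nat.log_mono_right (by omega)
  have ell_le : (p.ell : ℝ) ≤ Nat.log 2 n + 3 := by
    exact_mod_cast Nat.add_le_add_right natLog_le 2
  linarith [natLog_add_one_le hn, half_le_log hn]

theorem Params.T_le (p : Params) : p.T ≤ 4 * (2 * p.iters + 5) * p.minPatch := by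
  have D_succ_le : p.D + 1 ≤ 2 * p.minPatch := by
    rw [minPatch]
    omega
  calc p.T ≤ 2 * (2 * p.iters + 5) * (p.D + 1) :=
        (Nat.lt_mul_div_succ p.T (by positivity)).le
    _ ≤ 2 * (2 * p.iters + 5) * (2 * p.minPatch) := Nat.mul_le_mul_left _ D_succ_le
    _ = 4 * (2 * p.iters + 5) * p.minPatch := by ring

theorem div_minPatch_mul_T_le (hκ : p.κ = 20) (hn : 2 ≤ n) (hN : p.N ≤ 2 * n) :
    ((n / p.minPatch : ℕ) : ℝ) * p.T ≤ 1320 * (n * Real.log n) := by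
  have mul_T_le : n / p.minPatch * p.T ≤ 4 * (2 * p.iters + 5) * n := by
    calc n / p.minPatch * p.T
        ≤ n / p.minPatch * (4 * (2 * p.iters + 5) * p.minPatch) := Nat.mul_le_mul_left _ p.T_le
      _ = 4 * (2 * p.iters + 5) * (n / p.minPatch * p.minPatch) := by ring
      _ ≤ 4 * (2 * p.iters + 5) * n := Nat.mul_le_mul_left _ (Nat.div_mul_le_self n _)
  rw [Params.iters, hκ] at mul_T_le
  calc ((n / p.minPatch : ℕ) : ℝ) * p.T ≤ 4 * (2 * (20 * p.ell) + 5) * n := by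
        exact_mod_cast mul_T_le
    _ ≤ 1320 * Real.log n * n := by
        refine mul_le_mul_of_nonneg_right ?_ n.cast_nonneg
        linarith [Params.ell_le hn hN, half_le_log hn]
    _ = 1320 * (n * Real.log n) := by ring

theorem le_metaRounds {c R : ℕ} (hκ : p.κ = 20) (hn : 2 ≤ n) (hN : p.N ≤ 2 * n) (hb : 1 ≤ p.b)
    (hT : 1 ≤ p.T)
    (hR : ((16 * (1330 + 4 * c) : ℕ) : ℝ) * ((n + p.b * p.T ^ 2) * Real.log n) ≤ R) :
    16 * (p.k + n / p.minPatch + (c + 1) * (Nat.log 2 n + 1)) ≤ R / p.T := by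
  rw [Nat.le_div_iff_mul_le hT]
  have log_ge := half_le_log hn
  set Q : ℝ := p.b * p.T ^ 2 with Q_eq
  have T_le : (p.T : ℝ) ≤ Q := by
    rw [Q_eq]
    exact_mod_cast (Nat.le_self_pow two_ne_zero p.T).trans (Nat.le_mul_of_pos_left _ hb)
  have k_mul_T : ((p.k : ℕ) : ℝ) * p.T = Q := by
    rw [Params.k, Q_eq]
    push_cast
    ring
  have Q_le : Q ≤ 2 * (Q * Real.log n) := by nlinarith
  have natLog_mul_T_le : (Nat.log 2 n + 1 : ℝ) * p.T ≤ 4 * (Q * Real.log n) := by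
    calc (Nat.log 2 n + 1 : ℝ) * p.T ≤ 4 * Real.log n * Q :=
          mul_le_mul (natLog_add_one_le hn) T_le (by positivity) (by positivity)
      _ = 4 * (Q * Real.log n) := by ring
  have mul_natLog_mul_T_le := mul_le_mul_of_nonneg_left natLog_mul_T_le
    (show (0 : ℝ) ≤ c + 1 by positivity)
  have div_mul_T_le := div_minPatch_mul_T_le hκ hn hN
  have : (0 : ℝ) ≤ Q * Real.log n := by positivity
  have : (0 : ℝ) ≤ n * Real.log n := by positivity
  have : (0 : ℝ) ≤ c * (n * Real.log n) := by positivity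
  have mul_T_le :
      (16 * (p.k + (n / p.minPatch : ℕ) + (c + 1) * (Nat.log 2 n + 1)) * p.T : ℝ) ≤ R := by
    refine le_trans ?_ hR
    push_cast
    nlinarith
  exact_mod_cast mul_T_le

theorem two_pow_mul_weight_le {k d c M : ℕ} (hn : 0 < n)
    (hM : 16 * (k + n / d + (c + 1) * (Nat.log 2 n + 1)) ≤ M) :
    (2 : ℝ) ^ k * ((15 / 16) ^ M * weight d n) ≤ 1 / (n : ℝ) ^ c := by
  set m := (c + 1) * (Nat.log 2 n + 1)
  have pow_le : (15 / 16 : ℝ) ^ M ≤ (1 / 2) ^ (k + n / d + m) := by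
    calc (15 / 16 : ℝ) ^ M ≤ (15 / 16) ^ (16 * (k + n / d + m)) :=
          pow_le_pow_of_le_one (by norm_num) (by norm_num) hM
      _ = ((15 / 16) ^ 16) ^ (k + n / d + m) := pow_mul _ _ _
      _ ≤ (1 / 2) ^ (k + n / d + m) := by gcongr; norm_num
  have pow_succ_le : (n : ℝ) ^ (c + 1) ≤ 2 ^ m := by
    rw [show m = (Nat.log 2 n + 1) * (c + 1) from mul_comm _ _, pow_mul]
    gcongr
    exact_mod_cast (Nat.lt_pow_succ_log_self one_lt_two n).le
  rw [le_div_iff₀ (by positivity), weight]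
  calc (2 : ℝ) ^ k * ((15 / 16) ^ M * (n * 2 ^ (n / d))) * n ^ c
      = (15 / 16) ^ M * (2 ^ k * 2 ^ (n / d) * n ^ (c + 1)) := by ring
    _ ≤ (1 / 2) ^ (k + n / d + m) * (2 ^ k * 2 ^ (n / d) * 2 ^ m) := by gcongr
    _ = 1 := by
        rw [← pow_add, ← pow_add, ← mul_pow]
        norm_num

/-! ### The size of messages -/

/-- Messages as elements of a sum of product types, whose cardinality is easily computed. -/
def Msg.toSum : Msg p →
    Option (Option (Option (Fin p.prioRange × Fin p.U) ⊕ (Fin p.U ⊕ Fin p.U × Piece p)))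
  | .silent => none
  | .deactivate => some none
  | .prio x => some (some (.inl (WithBot.recBotCoe none (fun y => some (ofLex y)) x)))
  | .tree u => some (some (.inr (.inl u)))
  | .vec u c => some (some (.inr (.inr (u, c))))

theorem Msg.toSum_injective : Function.Injective (Msg.toSum (p := p)) := by
  intro x y h
  cases x <;> cases y <;> simp only [Msg.toSum, Option.some.injEq, reduceCtorEq, Sum.inl.injEq,
    Sum.inr.injEq, Prod.mk.injEq] at h
  case prio.prio x y =>
    induction x using WithBot.recBotCoe <;> induction y using WithBot.recBotCoe <;> simp_all
  case vec.vec => rw [h.1, h.2]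
  all_goals simp [h]

theorem Msg.card_le : Nat.card (Msg p) ≤
    p.prioRange * p.U + 1 + (p.U + p.U * 2 ^ p.w) + 1 + 1 := by
  refine (Nat.card_le_card_of_injective _ Msg.toSum_injective).trans_eq ?_
  simp [ZMod.card]

theorem Params.w_le (hb : 1 ≤ p.b) (hT : 1 ≤ p.T) : p.w ≤ 41 * p.b := by
  have T_le_S : p.T ≤ 20 * p.S := by
    rcases p.D.eq_zero_or_pos with hD | hD
    · rw [S, if_pos hD]
      omega
    · have S_pos := S_pos hD
      rw [S, if_neg hD.ne'] at S_pos ⊢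
      omega
  have div_le : 2 * p.k / p.S ≤ 40 * p.b := by
    refine Nat.div_le_of_le_mul ?_
    calc 2 * p.k = 2 * p.b * p.T := by rw [k, mul_assoc]
      _ ≤ 2 * p.b * (20 * p.S) := Nat.mul_le_mul_left _ T_le_S
      _ = p.S * (40 * p.b) := by ring
  rw [w]
  omega

theorem le_two_pow_of_log_le {b : ℕ} (hb : Real.log n ≤ b) : n ≤ 2 ^ (2 * b) := by
  have : (n : ℝ) ≤ 2 ^ (2 * b) := by
    calc (n : ℝ) ≤ Real.exp (Real.log n) := Real.le_exp_log _
      _ ≤ Real.exp b := Real.exp_le_exp.2 hb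
      _ = Real.exp 1 ^ b := (Real.exp_one_pow b).symm
      _ ≤ (2 ^ 2) ^ b := by
          gcongr
          linarith [Real.exp_one_lt_d9]
      _ = 2 ^ (2 * b) := (pow_mul _ _ _).symm
  exact_mod_cast this

theorem Params.prioRange_le (hN : p.N ≤ 2 * n) (hb : 1 ≤ p.b) (hlog : Real.log n ≤ p.b) :
    p.prioRange ≤ 2 ^ (20 * p.b) := by
  have natLog_le : Nat.log 2 p.N ≤ 2 * p.b + 1 := by
    calc Nat.log 2 p.N ≤ Nat.log 2 (2 ^ (2 * p.b + 1)) := by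
          refine Nat.log_mono_right (hN.trans ?_)
          rw [pow_succ']
          exact Nat.mul_le_mul_left 2 (le_two_pow_of_log_le hlog)
      _ = 2 * p.b + 1 := Nat.log_pow one_lt_two _
  refine Nat.pow_le_pow_right two_pos ?_
  rw [ell]
  omega

theorem messageBits {A : ℕ} (hN : p.N ≤ 2 * n) (hlog : Real.log n ≤ p.b) (hb : 1 ≤ p.b)
    (hT : 1 ≤ p.T) (hU : p.U ≤ n ^ A) : (patchSharing p).MessageBits ((2 * A + 44) * p.b) := by
  refine ⟨Finite.of_injective _ Msg.toSum_injective, Msg.card_le.trans ?_⟩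
  have U_le : p.U ≤ 2 ^ (2 * A * p.b) := by
    calc p.U ≤ (2 ^ (2 * p.b)) ^ A :=
          hU.trans (Nat.pow_le_pow_left (le_two_pow_of_log_le hlog) A)
      _ = 2 ^ (2 * A * p.b) := by rw [← pow_mul, mul_right_comm]
  set E := 2 ^ ((2 * A + 41) * p.b)
  have prio_le : p.prioRange * p.U ≤ E := by
    calc p.prioRange * p.U ≤ 2 ^ (20 * p.b) * 2 ^ (2 * A * p.b) :=
          Nat.mul_le_mul (Params.prioRange_le hN hb hlog) U_le
      _ = 2 ^ (20 * p.b + 2 * A * p.b) := (pow_add _ _ _).symm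
      _ ≤ E := Nat.pow_le_pow_right two_pos (by linarith)
  have vec_le : p.U * 2 ^ p.w ≤ E := by
    calc p.U * 2 ^ p.w ≤ 2 ^ (2 * A * p.b) * 2 ^ (41 * p.b) :=
          Nat.mul_le_mul U_le (Nat.pow_le_pow_right two_pos (Params.w_le hb hT))
      _ = E := by rw [← pow_add, ← add_mul]
  have tree_le : p.U ≤ E := U_le.trans (Nat.pow_le_pow_right two_pos (by linarith))
  have one_le : 1 ≤ E := Nat.one_le_two_pow
  calc p.prioRange * p.U + 1 + (p.U + p.U * 2 ^ p.w) + 1 + 1 ≤ E * 2 ^ 3 := by omega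
    _ = 2 ^ ((2 * A + 41) * p.b + 3) := (pow_add _ _ _).symm
    _ ≤ 2 ^ ((2 * A + 44) * p.b) := Nat.pow_le_pow_right two_pos (by linarith)

end PatchSharing

theorem lemma11 :
    ∃ κ : ℕ, ∀ A : ℕ, ∃ B : ℕ, ∀ c : ℕ, ∃ C : ℕ, ∀ n N b T U : ℕ,
      2 ≤ n → n ≤ 2 * N → N ≤ 2 * n → Real.log n ≤ b → 1 ≤ T → U ≤ n ^ A →
      (patchSharing ⟨κ, N, b, T, U⟩).MessageBits (B * b) ∧
      ∀ R : ℕ, (C : ℝ) * ((n + b * T ^ 2) * Real.log n) ≤ R →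
        SolvesIndexedBroadcast (patchSharing ⟨κ, N, b, T, U⟩) n T R (1 - 1 / (n : ℝ) ^ c) := by
  refine ⟨20, fun A => ⟨2 * A + 44, fun c => ⟨16 * (1330 + 4 * c), ?_⟩⟩⟩
  intro n N b T U hn hN hN' hlog hT hU
  set p : PatchSharing.Params := ⟨20, N, b, T, U⟩
  have one_le_b : 1 ≤ b := by
    have : (0 : ℝ) < b := by linarith [PatchSharing.half_le_log hn]
    exact_mod_cast this
  refine ⟨PatchSharing.messageBits (p := p) hN' hlog one_le_b hT hU, fun R hR => ?_⟩
  have metaRounds := PatchSharing.le_metaRounds (p := p) rfl hn hN' one_le_b hT hR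
  have failure_le := PatchSharing.two_pow_mul_weight_le (by omega) metaRounds
  have adequate : p.Adequate n := PatchSharing.Params.adequate le_rfl hN hT
  intro uid huid tok H hH adv hconn hadv
  exact (sub_le_sub_left failure_le 1).trans
    (PatchSharing.solvesIndexedBroadcast adequate R uid huid tok H hH adv hconn hadv)
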